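/- Let $m>1$ and $\Phi(r)=\frac{1}{m(m+1)}\left(\frac{1}{(1-r)^m}-mr-1\right)$ for $r<1$. Let $(V_\delta,R_\delta,\sigma_\delta)_{0<\delta<1}$ be a family of high-energy solitary waves, that is: for every $\delta\in(0,1)$ we have $\sigma_\delta>0$ and, for all $x\in\mathbb R$, $$R_\delta'(x)=V_\delta(x+\tfrac12)-V_\delta(x-\tfrac12),\qquad \sigma_\delta V_\delta'(x)=\Phi'(R_\delta(x+\tfrac12))-\Phi'(R_\delta(x-\tfrac12));$$ the functions $V_\delta,R_\delta$ lie in $L^2(\mathbb R)\cap BC^1(\mathbb R)$ and are nonnegative, even and unimodal (increasing on $(-\infty,0]$, decreasing on $[0,\infty)$); $\|V_\delta\|_2=1-\delta$; $R_\delta$ takes values in $[0,1)$; and $\int_{\mathbb R}\Phi(R_\delta(x))\,dx\to+\infty$ as $\delta\to0$. The initial value problem $$\tilde S_0''=\frac{2}{m+1}\,\frac{1}{(1+\tilde S_0)^{m+1}},\qquad \tilde S_0(0)=\tilde S_0'(0)=0,$$ has a unique solution $\tilde S_0$ on $\mathbb R$ (with $1+\tilde S_0>0$). Put $\bar\mu=\frac{2}{\sqrt{m(m+1)}}$,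 $\bar\kappa=\int_0^\infty x\,\tilde S_0''(x)\,dx$, $\tilde W_0(x)=\frac12(\tilde S_0'(x)+\bar\mu)$, $\tilde T_0(x)=\frac12(\tilde S_0(x)+\bar\mu x+\bar\kappa)$ and, for small $\varepsilon>0$, $$\hat\mu_\varepsilon=\frac{\bar\mu\,\varepsilon}{1+\varepsilon(\bar\kappa-1)},\qquad \hat\sigma_\varepsilon=\varepsilon^{-m-2}\hat\mu_\varepsilon^2,$$ $$\hat R_\varepsilon(x)=\begin{cases}1-\varepsilon-\varepsilon\tilde S_0(|x|/\hat\mu_\varepsilon)&|x|<\frac12,\\ \varepsilon\,\tilde T_0((1-|x|)/\hat\mu_\varepsilon)&\frac12\le|x|<\frac32,\\ 0&\text{else,}\end{cases}\qquad \hat V_\varepsilon(x)=\frac{\varepsilon}{\hat\mu_\varepsilon}\begin{cases}\tilde W_0((\frac12-|x|)/\hat\mu_\varepsilon)&|x|<1,\\ 0&\text{else,}\end{cases}$$ and $\hat\delta_\varepsilon=1-\|\hat V_\varepsilon\|_2$. Then $\hat\delta_\varepsilon\sim\varepsilon$, in the sense that $\hat\delta_\varepsilon/\varepsilon$ converges to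 a positive constant as $\varepsilon\to0$ (in particular $\hat\delta_\varepsilon\in(0,1)$ for all small $\varepsilon>0$), and for every $q\in[1,\infty]$ $$\|\hat R_\varepsilon-R_{\hat\delta_\varepsilon}\|_q+\|\hat V_\varepsilon-V_{\hat\delta_\varepsilon}\|_q+\varepsilon^{m}\,|\hat\sigma_\varepsilon-\sigma_{\hat\delta_\varepsilon}|=O(\varepsilon^{m-1})\qquad\text{as }\varepsilon\to0.$$ -/

import Mathlib

open MeasureTheory Filter Topology Set
open scoped ENNReal

noncomputable section

namespace HighEnergyFPU

/-- The interaction potential `Φ(r) = (1/(m(m+1))) ((1-r)^(-m) - m r - 1)`, meaningful for `r < 1`. -/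
def potential (m : ℝ) (r : ℝ) : ℝ :=
  1 / (m * (m + 1)) * (1 / (1 - r) ^ m - m * r - 1)

/-- Bounded `C¹` functions with bounded derivative. -/
def IsBC1 (f : ℝ → ℝ) : Prop :=
  ContDiff ℝ 1 f ∧ ∃ C : ℝ, ∀ x, |f x| ≤ C ∧ |deriv f x| ≤ C

/-- Unimodal profile: increasing for negative and decreasing for positive arguments. -/
def IsUnimodal (f : ℝ → ℝ) : Prop :=
  MonotoneOn f (Iic 0) ∧ AntitoneOn f (Ici 0)

/-- `(V, R, σ)` solves the travelling wave equations
`R'(x) = V(x+1/2) - V(x-1/2)` and `σ V'(x) = Φ'(R(x+1/2)) - Φ'(R(x-1/2))` with `σ > 0`. -/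
structure IsTravellingWave (m : ℝ) (V R : ℝ → ℝ) (σ : ℝ) : Prop where
  speed_pos : 0 < σ
  distance_eq : ∀ x, deriv R x = V (x + 1 / 2) - V (x - 1 / 2)
  velocity_eq : ∀ x, σ * deriv V x =
    deriv (potential m) (R (x + 1 / 2)) - deriv (potential m) (R (x - 1 / 2))

/-- The `L²` norm on the real line. -/
def norm2 (f : ℝ → ℝ) : ℝ := (eLpNorm f 2 volume).toReal

/-- A family of high-energy solitary waves `(V_δ, R_δ, σ_δ)`, `0 < δ < 1`. -/
structure IsHighEnergyFamily (m : ℝ) (V R : ℝ → ℝ → ℝ) (σ : ℝ → ℝ) : Prop where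
  wave : ∀ δ ∈ Ioo (0 : ℝ) 1, IsTravellingWave m (V δ) (R δ) (σ δ)
  V_memLp : ∀ δ ∈ Ioo (0 : ℝ) 1, MemLp (V δ) 2 volume
  R_memLp : ∀ δ ∈ Ioo (0 : ℝ) 1, MemLp (R δ) 2 volume
  V_bc1 : ∀ δ ∈ Ioo (0 : ℝ) 1, IsBC1 (V δ)
  R_bc1 : ∀ δ ∈ Ioo (0 : ℝ) 1, IsBC1 (R δ)
  V_nonneg : ∀ δ ∈ Ioo (0 : ℝ) 1, ∀ x, 0 ≤ V δ x
  V_even : ∀ δ ∈ Ioo (0 : ℝ) 1, Function.Even (V δ)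
  R_even : ∀ δ ∈ Ioo (0 : ℝ) 1, Function.Even (R δ)
  V_unimodal : ∀ δ ∈ Ioo (0 : ℝ) 1, IsUnimodal (V δ)
  R_unimodal : ∀ δ ∈ Ioo (0 : ℝ) 1, IsUnimodal (R δ)
  V_norm : ∀ δ ∈ Ioo (0 : ℝ) 1, norm2 (V δ) = 1 - δ
  R_range : ∀ δ ∈ Ioo (0 : ℝ) 1, ∀ x, R δ x ∈ Ico (0 : ℝ) 1
  energy_explodes : Tendsto (fun δ => ∫ x, potential m (R δ x)) (𝓝[>] 0) atTop

/-- `S` is a global solution of the initial value problem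
`S'' = (2/(m+1)) (1+S)^(-(m+1))`, `S(0) = S'(0) = 0`. -/
structure IsLimitProfile (m : ℝ) (S : ℝ → ℝ) : Prop where
  pos : ∀ x, 0 < 1 + S x
  differentiable : Differentiable ℝ S
  ode : ∀ x, HasDerivAt (deriv S) (2 / (m + 1) * (1 / (1 + S x) ^ (m + 1))) x
  init : S 0 = 0
  init_deriv : deriv S 0 = 0

/-- `μ̄ = 2/√(m(m+1))`. -/
def muBar (m : ℝ) : ℝ := 2 / √(m * (m + 1))

/-- `κ̄ = ∫_0^∞ x S''(x) dx`. -/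
def kappaBar (S : ℝ → ℝ) : ℝ := ∫ x in Ioi (0 : ℝ), x * deriv (deriv S) x

/-- Limit profile of the transition scaling, `(S' + μ̄)/2`. -/
def transitionProfile (m : ℝ) (S : ℝ → ℝ) (x : ℝ) : ℝ :=
  1 / 2 * (deriv S x + muBar m)

/-- Limit profile of the foot scaling, `(S + μ̄ x + κ̄)/2`. -/
def footProfile (m : ℝ) (S : ℝ → ℝ) (x : ℝ) : ℝ :=
  1 / 2 * (S x + muBar m * x + kappaBar S)

/-- `μ̂_ε`. -/
def muHat (m : ℝ) (S : ℝ → ℝ) (ε : ℝ) : ℝ :=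
  muBar m * ε / (1 + ε * (kappaBar S - 1))

/-- `σ̂_ε`. -/
def sigmaHat (m : ℝ) (S : ℝ → ℝ) (ε : ℝ) : ℝ :=
  ε ^ (-m - 2) * muHat m S ε ^ 2

/-- The approximate distance profile `R̂_ε`. -/
def RHat (m : ℝ) (S : ℝ → ℝ) (ε x : ℝ) : ℝ :=
  if |x| < 1 / 2 then 1 - ε - ε * S (|x| / muHat m S ε)
  else if |x| < 3 / 2 then ε * footProfile m S ((1 - |x|) / muHat m S ε)
  else 0

/-- The approximate velocity profile `V̂_ε`. -/
def VHat (m : ℝ) (S : ℝ → ℝ) (ε x : ℝ) : ℝ :=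
  ε / muHat m S ε *
    (if |x| < 1 then transitionProfile m S ((1 / 2 - |x|) / muHat m S ε) else 0)

/-- `δ̂_ε = 1 - ‖V̂_ε‖₂`. -/
def deltaHat (m : ℝ) (S : ℝ → ℝ) (ε : ℝ) : ℝ := 1 - norm2 (VHat m S ε)

end HighEnergyFPU

end

/-!
The limit profile. The substitution `1 + S = (1 + z²)^(1/m)` turns the initial value problem into
a first order equation for `z` that is solved by quadrature (`exists_isLimitProfile`). Energy
conservation reads `S'² = μ̄² (1 - (1+S)^(-m))`, and since solutions grow linearly
(`growthRate_mul_le`) the slope converges like `(1+y)^(-m)` and `μ̄ y - S(y)` converges to `κ̄` like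
`(1+y)^(1-m)` (`IsLimitProfile.exists_asymptote`). The linearised equation has a coefficient that
decays like `(1+y)^(-3)`, so a residual `η` causes errors of at most `O(η y²)` (`stability`), which
also gives uniqueness.

A single wave. Let `R(0) = 1 - η`. Because `∫ V² ≤ 1`, the profile `V` is close to the indicator
function of `[-1/2, 1/2]`, and `R(1/2) ≤ 3/4` (`IsSolitaryWave.R_half_le`). On `[-1/2, 1/2]` the
equation for `R` involves only one large stress, namely `Φ'(R(x))`; hence the rescaled tip
`(1 - η - R(y/s))/η` with `σ s² η^(m+2) = 1` solves the limiting equation up to `O(η^(m+1))`, and it is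
convex. Stability over the range `0 ≤ y ≤ s/2 = O(1/η)` yields the tip with error `O(η^m)`. The sum
`V(x+1/2) + V(x-1/2)` is constant up to `O(η^m)`, while the difference is the slope of the tip;
this gives the transition layers and, after integration, the feet. Matching tip and foot at
`x = 1/2` yields `η s μ̄ = 1 + η (κ̄ - 1) + O(η^m)`. For `|x| ≥ 1` the inequality
`V(x) ≤ O(η^m) V(x-1)` implies exponentially decaying tails. Everything is collected in
`exists_wave_approximation`, with errors of the form `O(η^m) exp(-|x|)` so that all `L^q` norms are
controlled at once.

The parameters. The squared norm of `V̂_ε` is `1 - 2aε + bε² + O(ε^m)` with `a > 0`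
(`exists_norm2_VHat_expansion`); positivity of `a` rests on the pointwise inequality
`(μ̄ - S')² ≤ (2/m) S''`. If a wave has the same norm as `V̂_ε`, comparing it with the approximation
for its own amplitude shows `|ε - η| = O(ε^m)` (`exists_amplitude_comparison`). The explicit profiles
are Lipschitz functions of the logarithms of their parameters, so replacing `η` by `ε` costs
`O(ε^(m-1))`. Finally, `∫ Φ(R_δ)` is bounded as long as `R_δ(0)` stays away from `1`, so the blow-up
of the energy forces `η → 0` along the family.
-/

namespace HighEnergyFPU

/-! ### Comparison of increments -/

theorem sub_le_sub_of_hasDerivAt_le {f g f' g' : ℝ → ℝ} {a b : ℝ} (hab : a ≤ b)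
    (hf : ∀ x ∈ Icc a b, HasDerivAt f (f' x) x) (hg : ∀ x ∈ Icc a b, HasDerivAt g (g' x) x)
    (h : ∀ x ∈ Icc a b, f' x ≤ g' x) : f b - f a ≤ g b - g a := by
  have hmono : MonotoneOn (fun x => g x - f x) (Icc a b) := by
    refine monotoneOn_of_deriv_nonneg (convex_Icc a b) ?_ ?_ ?_
    · exact fun x hx => ((hg x hx).sub (hf x hx)).continuousAt.continuousWithinAt
    · intro x hx
      rw [interior_Icc] at hx
      have hx' := Ioo_subset_Icc_self hx
      exact ((hg x hx').sub (hf x hx')).differentiableAt.differentiableWithinAt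
    · intro x hx
      rw [interior_Icc] at hx
      have hx' := Ioo_subset_Icc_self hx
      have := ((hg x hx').sub (hf x hx')).deriv
      change 0 ≤ deriv (g - f) x
      rw [this]
      linarith [h x hx']
  have := hmono (left_mem_Icc.2 hab) (right_mem_Icc.2 hab) hab
  simp only at this
  linarith

theorem abs_sub_le_sub_of_hasDerivAt_le {f g f' g' : ℝ → ℝ} {a b : ℝ} (hab : a ≤ b)
    (hf : ∀ x ∈ Icc a b, HasDerivAt f (f' x) x) (hg : ∀ x ∈ Icc a b, HasDerivAt g (g' x) x)
    (h : ∀ x ∈ Icc a b, |f' x| ≤ g' x) : |f b - f a| ≤ g b - g a := by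
  rw [abs_le]
  constructor
  · have := sub_le_sub_of_hasDerivAt_le hab (fun x hx => (hf x hx).neg) hg
      (fun x hx => (neg_le_abs _).trans (h x hx))
    simp only [Pi.neg_apply] at this
    linarith
  · exact sub_le_sub_of_hasDerivAt_le hab hf hg (fun x hx => (le_abs_self _).trans (h x hx))

theorem abs_sub_le_mul_of_hasDerivAt {f f' : ℝ → ℝ} {a b C : ℝ} (hab : a ≤ b)
    (hf : ∀ x ∈ Icc a b, HasDerivAt f (f' x) x)
    (h : ∀ x ∈ Icc a b, |f' x| ≤ C) : |f b - f a| ≤ C * (b - a) := by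
  have hg : ∀ x ∈ Icc a b, HasDerivAt (fun y => C * y) C x := fun x _ => by
    simpa using (hasDerivAt_id x).const_mul C
  have := abs_sub_le_sub_of_hasDerivAt_le hab hf hg h
  linarith

theorem mul_le_sub_of_hasDerivAt {f f' : ℝ → ℝ} {a b C : ℝ} (hab : a ≤ b)
    (hf : ∀ x ∈ Icc a b, HasDerivAt f (f' x) x)
    (h : ∀ x ∈ Icc a b, C ≤ f' x) : C * (b - a) ≤ f b - f a := by
  have hg : ∀ x ∈ Icc a b, HasDerivAt (fun y => C * y) C x := fun x _ => by
    simpa using (hasDerivAt_id x).const_mul C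
  have := sub_le_sub_of_hasDerivAt_le hab hg hf h
  linarith

theorem sub_le_mul_of_hasDerivAt {f f' : ℝ → ℝ} {a b C : ℝ} (hab : a ≤ b)
    (hf : ∀ x ∈ Icc a b, HasDerivAt f (f' x) x)
    (h : ∀ x ∈ Icc a b, f' x ≤ C) : f b - f a ≤ C * (b - a) := by
  have hg : ∀ x ∈ Icc a b, HasDerivAt (fun y => C * y) C x := fun x _ => by
    simpa using (hasDerivAt_id x).const_mul C
  have := sub_le_sub_of_hasDerivAt_le hab hf hg h
  linarith

/-! ### The force of the limiting initial value problem -/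

/-- The right-hand side `s ↦ (2/(m+1)) (1+s)^(-(m+1))` of the limiting initial value problem. -/
noncomputable def force (m s : ℝ) : ℝ := 2 / (m + 1) * (1 / (1 + s) ^ (m + 1))

theorem force_pos {m s : ℝ} (hm : 1 < m) (hs : 0 < 1 + s) : 0 < force m s := by
  unfold force
  have := Real.rpow_pos_of_pos hs (m + 1)
  positivity

theorem force_anti {m s t : ℝ} (hm : 1 < m) (hs : 0 < 1 + s) (hst : s ≤ t) :
    force m t ≤ force m s := by
  unfold force
  have := Real.rpow_pos_of_pos hs (m + 1)
  gcongr

theorem force_one_le {m : ℝ} (hm : 1 < m) : force m 1 ≤ 1 / 4 := by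
  unfold force
  have h2 : (4 : ℝ) ≤ (1 + 1) ^ (m + 1) := by
    calc (4 : ℝ) = (1 + 1) ^ (2 : ℝ) := by norm_num
      _ ≤ _ := Real.rpow_le_rpow_of_exponent_le (by norm_num) (by linarith)
  have h1 : 2 / (m + 1) ≤ 1 := by rw [div_le_one (by linarith)]; linarith
  calc _ ≤ 1 * (1 / 4 : ℝ) := by gcongr
    _ = _ := by norm_num

theorem hasDerivAt_force {m s : ℝ} (hm : 1 < m) (hs : 0 < 1 + s) :
    HasDerivAt (force m) (-2 * (1 / (1 + s) ^ (m + 2))) s := by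
  have h1 : HasDerivAt (fun t : ℝ => 1 + t) 1 s := by simpa using (hasDerivAt_id s).const_add 1
  have h2 := (h1.rpow_const (p := -(m + 1)) (Or.inl hs.ne')).const_mul (2 / (m + 1))
  have hev : force m =ᶠ[𝓝 s] fun t => 2 / (m + 1) * (1 + t) ^ (-(m + 1)) := by
    have : ∀ᶠ t in 𝓝 s, 0 < 1 + t := h1.continuousAt.eventually (lt_mem_nhds hs)
    filter_upwards [this] with t ht
    rw [force, Real.rpow_neg ht.le, one_div]
  refine (h2.congr_of_eventuallyEq hev).congr_deriv ?_
  have hm1 : m + 1 ≠ 0 := by linarith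
  rw [show -(m + 1) - 1 = -(m + 2) by ring, Real.rpow_neg hs.le]
  field_simp

theorem continuousAt_force {m s : ℝ} (hm : 1 < m) (hs : 0 < 1 + s) : ContinuousAt (force m) s :=
  (hasDerivAt_force hm hs).continuousAt

theorem abs_force_sub_le {m p s t : ℝ} (hm : 1 < m) (hp : 0 < p) (hs : p ≤ 1 + s)
    (ht : p ≤ 1 + t) : |force m s - force m t| ≤ 2 * (1 / p ^ (m + 2)) * |s - t| := by
  have key : ∀ s t : ℝ, p ≤ 1 + s → s ≤ t →
      |force m t - force m s| ≤ 2 * (1 / p ^ (m + 2)) * (t - s) := by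
    intro s t hs hst
    refine abs_sub_le_mul_of_hasDerivAt hst
      (fun x hx => hasDerivAt_force hm (by linarith [hx.1])) fun x hx => ?_
    have h1 : p ≤ 1 + x := by linarith [hx.1]
    have h3 := Real.rpow_pos_of_pos (hp.trans_le h1) (m + 2)
    have h4 := Real.rpow_pos_of_pos hp (m + 2)
    have h5 : p ^ (m + 2) ≤ (1 + x) ^ (m + 2) := Real.rpow_le_rpow hp.le h1 (by linarith)
    rw [abs_mul, abs_of_pos (by positivity : 0 < 1 / (1 + x) ^ (m + 2))]
    rw [abs_neg, abs_two]
    gcongr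
  rcases le_total s t with h | h
  · rw [abs_sub_comm, abs_sub_comm s t, abs_of_nonneg (sub_nonneg.2 h)]
    exact key s t hs h
  · rw [abs_of_nonneg (sub_nonneg.2 h)]
    exact key t s ht h

/-! ### Growth and stability for the initial value problem -/

/-- The slope in the linear lower bound for solutions of the initial value problem. -/
noncomputable def growthRate (m : ℝ) : ℝ := force m 1 / 4

theorem growthRate_pos {m : ℝ} (hm : 1 < m) : 0 < growthRate m :=
  div_pos (force_pos hm (by norm_num)) (by norm_num)

/-- Approximate convex solutions grow at least linearly: as long as `S ≤ 1` the force is bounded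
below, and once `S` has a definite slope convexity preserves it. -/
theorem growthRate_mul_le {m L : ℝ} (hm : 1 < m) {S S1 S2 : ℝ → ℝ}
    (h1 : ∀ y ∈ Icc 0 L, HasDerivAt S (S1 y) y) (h2 : ∀ y ∈ Icc 0 L, HasDerivAt S1 (S2 y) y)
    (hS0 : S 0 = 0) (hS10 : S1 0 = 0) (hconv : ∀ y ∈ Icc 0 L, 0 ≤ S2 y)
    (happ : ∀ y ∈ Icc 0 L, force m (S y) - force m 1 / 2 ≤ S2 y) :
    ∀ y ∈ Icc 0 L, growthRate m * (1 + y) ≤ 1 + S y := by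
  have hf1 := force_pos hm (show (0:ℝ) < 1 + 1 by norm_num)
  have hf1' := force_one_le hm
  have hS1mono : ∀ a b, 0 ≤ a → a ≤ b → b ≤ L → S1 a ≤ S1 b := by
    intro a b ha hab hb
    have := mul_le_sub_of_hasDerivAt (C := 0) hab
      (fun x hx => h2 x ⟨ha.trans hx.1, hx.2.trans hb⟩)
      (fun x hx => hconv x ⟨ha.trans hx.1, hx.2.trans hb⟩)
    linarith
  have hS1nn : ∀ y ∈ Icc 0 L, 0 ≤ S1 y := fun y hy => by
    have := hS1mono 0 y le_rfl hy.1 hy.2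
    linarith
  have hSmono : ∀ a b, 0 ≤ a → a ≤ b → b ≤ L → S a ≤ S b := by
    intro a b ha hab hb
    have := mul_le_sub_of_hasDerivAt (C := 0) hab
      (fun x hx => h1 x ⟨ha.trans hx.1, hx.2.trans hb⟩)
      (fun x hx => hS1nn x ⟨ha.trans hx.1, hx.2.trans hb⟩)
    linarith
  have hSnn : ∀ y ∈ Icc 0 L, 0 ≤ S y := fun y hy => by
    have := hSmono 0 y le_rfl hy.1 hy.2
    linarith
  intro y hy
  unfold growthRate
  rcases le_total y 1 with hy1 | hy1
  · have := hSnn y hy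
    nlinarith
  · have h1L : (1 : ℝ) ≤ L := hy1.trans hy.2
    have hS_one : force m 1 / 4 ≤ S 1 := by
      rcases le_total (S 1) 1 with hle | hge
      · have hS2 : ∀ x ∈ Icc (0:ℝ) 1, force m 1 / 2 ≤ S2 x := fun x hx => by
          have hx' : x ∈ Icc 0 L := ⟨hx.1, hx.2.trans h1L⟩
          have ha := force_anti hm (by linarith [hSnn x hx'] : 0 < 1 + S x)
            ((hSmono x 1 hx.1 hx.2 h1L).trans hle)
          linarith [happ x hx']
        have hS1' : ∀ x ∈ Icc (0:ℝ) 1, force m 1 / 2 * x ≤ S1 x := fun x hx => by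
          have := mul_le_sub_of_hasDerivAt hx.1
            (fun z hz => h2 z ⟨hz.1, hz.2.trans (hx.2.trans h1L)⟩)
            (fun z hz => hS2 z ⟨hz.1, hz.2.trans hx.2⟩)
          rw [hS10] at this
          linarith
        have hq : ∀ x ∈ Icc (0:ℝ) 1,
            HasDerivAt (fun z : ℝ => force m 1 / 4 * z ^ 2) (force m 1 / 2 * x) x := fun x _ => by
          refine ((hasDerivAt_pow 2 x).const_mul (force m 1 / 4)).congr_deriv ?_
          norm_num
          ring
        have := sub_le_sub_of_hasDerivAt_le zero_le_one hq
          (fun z hz => h1 z ⟨hz.1, hz.2.trans h1L⟩) hS1'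
        norm_num at this
        linarith
      · linarith
    -- the chord estimate `S y ≥ y * S 1` for the convex function `S` with `S 0 = 0`
    have ha : S y - S 1 ≥ S1 1 * (y - 1) :=
      mul_le_sub_of_hasDerivAt hy1
        (fun x hx => h1 x ⟨zero_le_one.trans hx.1, hx.2.trans hy.2⟩)
        (fun x hx => hS1mono 1 x zero_le_one hx.1 (hx.2.trans hy.2))
    have hb : S 1 - S 0 ≤ S1 1 * (1 - 0) :=
      sub_le_mul_of_hasDerivAt zero_le_one
        (fun x hx => h1 x ⟨hx.1, hx.2.trans h1L⟩)
        (fun x hx => hS1mono x 1 hx.1 hx.2 h1L)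
    rw [hS0] at hb
    nlinarith

/-- The amplification factor in the stability estimate. -/
noncomputable def stabConst (m : ℝ) : ℝ :=
  Real.exp (2 * (2 * (1 / growthRate m ^ (m + 2))))

theorem stabConst_pos (m : ℝ) : 0 < stabConst m := Real.exp_pos _

/-- Stability of the initial value problem. The linearisation has a coefficient that decays like
`(1+y)^(-3)`, so that residuals are amplified at most quadratically in `y`. -/
theorem stability {m L η : ℝ} (hm : 1 < m) {S S1 S2 T T1 T2 : ℝ → ℝ}
    (hSc : Continuous S) (hTc : Continuous T)
    (hS1 : ∀ y ∈ Icc 0 L, HasDerivAt S (S1 y) y) (hS2 : ∀ y ∈ Icc 0 L, HasDerivAt S1 (S2 y) y)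
    (hT1 : ∀ y ∈ Icc 0 L, HasDerivAt T (T1 y) y) (hT2 : ∀ y ∈ Icc 0 L, HasDerivAt T1 (T2 y) y)
    (h0 : S 0 = T 0) (h10 : S1 0 = T1 0)
    (hSg : ∀ y ∈ Icc 0 L, growthRate m * (1 + y) ≤ 1 + S y)
    (hTg : ∀ y ∈ Icc 0 L, growthRate m * (1 + y) ≤ 1 + T y)
    (hS : ∀ y ∈ Icc 0 L, |S2 y - force m (S y)| ≤ η)
    (hT : ∀ y ∈ Icc 0 L, T2 y = force m (T y)) :
    ∀ y ∈ Icc 0 L, |S1 y - T1 y| ≤ stabConst m * η * y ∧ |S y - T y| ≤ stabConst m * η * y ^ 2 := by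
  intro Y hY
  have hη : 0 ≤ η := (abs_nonneg _).trans (hS Y hY)
  set c := growthRate m with hc
  have hcpos : 0 < c := growthRate_pos hm
  set B := 2 * (1 / c ^ (m + 2)) with hB
  have hBpos : 0 < B := by have := Real.rpow_pos_of_pos hcpos (m + 2); positivity
  -- `a` bounds `|S2 - T2|`; the weight is continuous on all of `ℝ`, and multiplied by `t ≥ 0` it is
  -- at most `B / (1 + t²)`, whose primitive `B arctan t` is bounded
  set a : ℝ → ℝ := fun t => B / ((1 + t ^ 2) * (1 + |t|)) * |S t - T t| + η with ha
  have hac : Continuous a := by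
    refine Continuous.add (Continuous.mul (Continuous.div continuous_const (by fun_prop) ?_)
      (hSc.sub hTc).abs) continuous_const
    intro x; positivity
  have ha0 : ∀ t, 0 ≤ a t := fun t => by simp only [ha]; positivity
  set A : ℝ → ℝ := fun y => ∫ t in (0:ℝ)..y, a t with hA
  have hA' : ∀ y, HasDerivAt A (a y) y := fun y =>
    intervalIntegral.integral_hasDerivAt_right (hac.intervalIntegrable _ _)
      (hac.stronglyMeasurableAtFilter _ _) hac.continuousAt
  have hA0 : A 0 = 0 := by simp [hA]
  have hAmono : Monotone A := monotone_of_hasDerivAt_nonneg (f' := a) hA' ha0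
  have hLip : ∀ y ∈ Icc 0 L, |S2 y - T2 y| ≤ a y := by
    intro y hy
    have h1y : 0 < 1 + y := by linarith [hy.1]
    have hl := abs_force_sub_le hm (mul_pos hcpos h1y) (hSg y hy) (hTg y hy)
    have hpow : (1 + y ^ 2) * (1 + |y|) ≤ (1 + y) ^ (m + 2) := by
      rw [abs_of_nonneg hy.1]
      calc (1 + y ^ 2) * (1 + y) ≤ (1 + y) ^ (3:ℝ) := by
            rw [show (3:ℝ) = (3:ℕ) by norm_num, Real.rpow_natCast]
            nlinarith [hy.1, mul_nonneg hy.1 hy.1]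
        _ ≤ _ := Real.rpow_le_rpow_of_exponent_le (by linarith [hy.1]) (by linarith)
    have hle : 2 * (1 / (c * (1 + y)) ^ (m + 2)) ≤ B / ((1 + y ^ 2) * (1 + |y|)) := by
      rw [Real.mul_rpow hcpos.le h1y.le, hB]
      have := Real.rpow_pos_of_pos hcpos (m + 2)
      have hp2 : 0 < (1 + y ^ 2) * (1 + |y|) := by positivity
      rw [show 2 * (1 / c ^ (m + 2)) / ((1 + y ^ 2) * (1 + |y|)) =
        2 * (1 / (c ^ (m + 2) * ((1 + y ^ 2) * (1 + |y|)))) by field_simp]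
      gcongr
    calc |S2 y - T2 y| = |(force m (S y) - force m (T y)) + (S2 y - force m (S y))| := by
          rw [hT y hy]; ring_nf
      _ ≤ |force m (S y) - force m (T y)| + |S2 y - force m (S y)| := abs_add_le _ _
      _ ≤ 2 * (1 / (c * (1 + y)) ^ (m + 2)) * |S y - T y| + η := add_le_add hl (hS y hy)
      _ ≤ a y := by
          simp only [ha]
          gcongr
  have hd1 : ∀ y ∈ Icc 0 L, |S1 y - T1 y| ≤ A y := by
    intro y hy
    have hsub : ∀ x ∈ Icc 0 y, x ∈ Icc 0 L := fun x hx => ⟨hx.1, hx.2.trans hy.2⟩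
    have := abs_sub_le_sub_of_hasDerivAt_le hy.1
      (fun x hx => (hS2 x (hsub x hx)).sub (hT2 x (hsub x hx))) (fun x _ => hA' x)
      (fun x hx => hLip x (hsub x hx))
    simpa [h10, hA0] using this
  have hd0 : ∀ y ∈ Icc 0 L, |S y - T y| ≤ A y * y := by
    intro y hy
    have hsub : ∀ x ∈ Icc 0 y, x ∈ Icc 0 L := fun x hx => ⟨hx.1, hx.2.trans hy.2⟩
    have := abs_sub_le_mul_of_hasDerivAt hy.1
      (fun x hx => (hS1 x (hsub x hx)).sub (hT1 x (hsub x hx)))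
      (fun x hx => (hd1 x (hsub x hx)).trans (hAmono hx.2))
    simpa [h0] using this
  have hGron : ∀ y ∈ Icc 0 L, A y ≤ stabConst m * η * y := by
    intro y hy
    have hsub : ∀ x ∈ Icc 0 y, x ∈ Icc 0 L := fun x hx => ⟨hx.1, hx.2.trans hy.2⟩
    have hE : ∀ x ∈ Icc 0 y, HasDerivAt (fun x => A x * Real.exp (-(B * Real.arctan x)))
        ((a x - B / (1 + x ^ 2) * A x) * Real.exp (-(B * Real.arctan x))) x := by
      intro x _
      refine ((hA' x).mul ((Real.hasDerivAt_arctan x).const_mul B).neg.exp).congr_deriv ?_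
      simp only [one_div, Pi.neg_apply]
      ring
    have hle := sub_le_mul_of_hasDerivAt (C := η) hy.1 hE (by
      intro x hx
      have hexp : Real.exp (-(B * Real.arctan x)) ≤ 1 := by
        rw [Real.exp_le_one_iff]
        have : 0 ≤ Real.arctan x := Real.arctan_nonneg.2 hx.1
        nlinarith
      have hAx : 0 ≤ A x := hA0 ▸ hAmono hx.1
      have hax : a x - B / (1 + x ^ 2) * A x ≤ η := by
        have h3 : B / ((1 + x ^ 2) * (1 + |x|)) * |S x - T x| ≤
            B / ((1 + x ^ 2) * (1 + |x|)) * (A x * x) := by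
          gcongr
          exact hd0 x (hsub x hx)
        have h4 : B / ((1 + x ^ 2) * (1 + |x|)) * (A x * x) ≤ B / (1 + x ^ 2) * A x := by
          have hx1 : 0 ≤ x := hx.1
          rw [abs_of_nonneg hx1,
            show B / ((1 + x ^ 2) * (1 + x)) * (A x * x) = B / (1 + x ^ 2) * A x * (x / (1 + x)) by
            field_simp]
          refine mul_le_of_le_one_right (by positivity) ?_
          rw [div_le_one (by positivity)]
          linarith
        simp only [ha]
        linarith
      calc _ ≤ η * Real.exp (-(B * Real.arctan x)) := by gcongr
        _ ≤ η := mul_le_of_le_one_right hη hexp)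
    simp only [hA0, zero_mul, sub_zero] at hle
    have hexp2 : Real.exp (-(2 * B)) ≤ Real.exp (-(B * Real.arctan y)) := by
      rw [Real.exp_le_exp]
      have := (Real.arctan_lt_pi_div_two y).le
      have := Real.pi_le_four
      nlinarith
    have hAy : 0 ≤ A y := hA0 ▸ hAmono hy.1
    have hfin : A y * Real.exp (-(2 * B)) ≤ η * y := (by gcongr : _ ≤ _).trans hle
    have hst : stabConst m = Real.exp (2 * B) := rfl
    rw [hst]
    calc A y = Real.exp (2 * B) * (A y * Real.exp (-(2 * B))) := by
          rw [Real.exp_neg]; field_simp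
      _ ≤ Real.exp (2 * B) * (η * y) := by gcongr
      _ = _ := by ring
  refine ⟨(hd1 Y hY).trans (hGron Y hY), (hd0 Y hY).trans ?_⟩
  calc A Y * Y ≤ stabConst m * η * Y * Y := by gcongr; exacts [hY.1, hGron Y hY]
    _ = _ := by ring

/-! ### Existence and uniqueness of the limit profile -/

theorem muBar_pos {m : ℝ} (hm : 1 < m) : 0 < muBar m := by
  unfold muBar
  have : 0 < m * (m + 1) := by nlinarith
  positivity

theorem muBar_sq {m : ℝ} (hm : 1 < m) : muBar m ^ 2 = 4 / (m * (m + 1)) := by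
  unfold muBar
  have : 0 ≤ m * (m + 1) := by nlinarith
  rw [div_pow, Real.sq_sqrt this]
  norm_num

/-- Time as a function of the parameter `z` in which the limit profile is `(1+z²)^(1/m) - 1`. -/
noncomputable def profileTime (m z : ℝ) : ℝ :=
  ∫ w in (0:ℝ)..z, (1 + w ^ 2) ^ (1 / m - 1 / 2) / √(m / (m + 1))

theorem hasDerivAt_profileTime (m z : ℝ) :
    HasDerivAt (profileTime m) ((1 + z ^ 2) ^ (1 / m - 1 / 2) / √(m / (m + 1))) z := by
  have hc : Continuous fun w : ℝ => (1 + w ^ 2) ^ (1 / m - 1 / 2) / √(m / (m + 1)) := by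
    refine Continuous.div_const (Continuous.rpow_const (by fun_prop) fun x => Or.inl ?_) _
    positivity
  exact intervalIntegral.integral_hasDerivAt_right (hc.intervalIntegrable _ _)
    (hc.stronglyMeasurableAtFilter _ _) hc.continuousAt

theorem speedFactor_pos {m : ℝ} (hm : 1 < m) : 0 < √(m / (m + 1)) :=
  Real.sqrt_pos.2 (div_pos (by linarith) (by linarith))

theorem strictMono_profileTime {m : ℝ} (hm : 1 < m) : StrictMono (profileTime m) :=
  strictMono_of_hasDerivAt_pos (hasDerivAt_profileTime m) fun z =>
    div_pos (Real.rpow_pos_of_pos (by positivity) _) (speedFactor_pos hm)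

theorem surjective_profileTime {m : ℝ} (hm : 1 < m) :
    Function.Surjective (profileTime m) := by
  have hc := speedFactor_pos hm
  have hars : ∀ z, HasDerivAt (fun z => Real.arsinh z / √(m / (m + 1)))
      ((√(1 + z ^ 2))⁻¹ / √(m / (m + 1))) z := fun z =>
    (Real.hasDerivAt_arsinh z).div_const _
  have hle : ∀ z : ℝ, (√(1 + z ^ 2))⁻¹ / √(m / (m + 1)) ≤
      (1 + z ^ 2) ^ (1 / m - 1 / 2) / √(m / (m + 1)) := fun z => by
    have h1 : (1 : ℝ) ≤ 1 + z ^ 2 := by nlinarith [sq_nonneg z]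
    have : (√(1 + z ^ 2))⁻¹ ≤ (1 + z ^ 2) ^ (1 / m - 1 / 2) := by
      rw [Real.sqrt_eq_rpow, ← Real.rpow_neg (by linarith)]
      apply Real.rpow_le_rpow_of_exponent_le h1
      have : 0 < 1 / m := by positivity
      linarith
    gcongr
  have h0 : profileTime m 0 = 0 := by simp [profileTime]
  have hlim1 : Tendsto (fun z => Real.arsinh z / √(m / (m + 1))) atTop atTop :=
    Real.sinhOrderIso.symm.tendsto_atTop.atTop_div_const hc
  have hlim2 : Tendsto (fun z => Real.arsinh z / √(m / (m + 1))) atBot atBot :=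
    Real.sinhOrderIso.symm.tendsto_atBot.atBot_div_const hc
  refine Continuous.surjective
    (continuous_iff_continuousAt.2 fun z => (hasDerivAt_profileTime m z).continuousAt) ?_ ?_
  · refine tendsto_atTop_mono' _ ?_ hlim1
    filter_upwards [eventually_ge_atTop 0] with z hz
    have := sub_le_sub_of_hasDerivAt_le hz (fun x _ => hars x)
      (fun x _ => hasDerivAt_profileTime m x) (fun x _ => hle x)
    simpa [h0] using this
  · refine tendsto_atBot_mono' _ ?_ hlim2
    filter_upwards [eventually_le_atBot 0] with z hz
    have := sub_le_sub_of_hasDerivAt_le hz (fun x _ => hars x)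
      (fun x _ => hasDerivAt_profileTime m x) (fun x _ => hle x)
    simpa [h0] using this

theorem IsLimitProfile.ode' {m : ℝ} {S : ℝ → ℝ} (hS : IsLimitProfile m S) (x : ℝ) :
    HasDerivAt (deriv S) (force m (S x)) x := hS.ode x

/-- Existence by quadrature: the substitution `1 + S = (1+z²)^(1/m)` removes the singularity of
the first order equation at `S = 0`. -/
theorem exists_isLimitProfile {m : ℝ} (hm : 1 < m) : ∃ S : ℝ → ℝ, IsLimitProfile m S := by
  have hc := speedFactor_pos hm
  have hm0 : 0 < m := by linarith
  set c := √(m / (m + 1)) with hcdef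
  have hc2 : c ^ 2 = m / (m + 1) := Real.sq_sqrt (by positivity)
  let e := (strictMono_profileTime hm).orderIsoOfSurjective _ (surjective_profileTime hm)
  let z : ℝ → ℝ := fun x => e.symm x
  have hinv : ∀ x, profileTime m (z x) = x := fun x => e.apply_symm_apply x
  have hzd : ∀ x, HasDerivAt z (c * (1 + z x ^ 2) ^ (1 / 2 - 1 / m)) x := fun x => by
    have hpos : 0 < 1 + z x ^ 2 := by positivity
    refine (HasDerivAt.of_local_left_inverse e.symm.continuous.continuousAt
      (hasDerivAt_profileTime m (z x))
      (div_pos (Real.rpow_pos_of_pos hpos _) hc).ne' (.of_forall hinv)).congr_deriv ?_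
    rw [inv_div, show (1:ℝ) / 2 - 1 / m = -(1 / m - 1 / 2) by ring, Real.rpow_neg hpos.le]
    rfl
  have hqd : ∀ x, HasDerivAt (fun x => 1 + z x ^ 2)
      (2 * z x * (c * (1 + z x ^ 2) ^ (1 / 2 - 1 / m))) x := fun x => by
    refine (((hzd x).pow 2).const_add 1).congr_deriv ?_
    norm_num
  have hz0 : z 0 = 0 := by
    have h0 : e 0 = 0 := by
      change profileTime m 0 = 0
      simp [profileTime]
    have := e.symm_apply_apply 0
    rwa [h0] at this
  let S : ℝ → ℝ := fun x => (1 + z x ^ 2) ^ (1 / m) - 1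
  have hSd : ∀ x, HasDerivAt S (2 * c / m * (z x * (1 + z x ^ 2) ^ (-(1/2) : ℝ))) x := fun x => by
    have hpos : 0 < 1 + z x ^ 2 := by positivity
    refine (((hqd x).rpow_const (p := 1 / m) (Or.inl hpos.ne')).sub_const 1).congr_deriv ?_
    rw [show (-(1/2) : ℝ) = (1 / 2 - 1 / m) + (1 / m - 1) by ring, Real.rpow_add hpos]
    ring
  have hdS : deriv S = fun x => 2 * c / m * (z x * (1 + z x ^ 2) ^ (-(1/2) : ℝ)) :=
    funext fun x => (hSd x).deriv
  have hS1 : ∀ x, 1 + S x = (1 + z x ^ 2) ^ (1 / m) := fun x => by simp [S]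
  refine ⟨S, fun x => ?_, fun x => (hSd x).differentiableAt, fun x => ?_, ?_, ?_⟩
  · rw [hS1]; exact Real.rpow_pos_of_pos (by positivity) _
  · have hpos : 0 < 1 + z x ^ 2 := by positivity
    rw [hdS]
    refine (((hzd x).mul ((hqd x).rpow_const (p := (-(1/2) : ℝ))
      (Or.inl hpos.ne'))).const_mul (2 * c / m)).congr_deriv ?_
    rw [hS1, ← Real.rpow_mul hpos.le, show (1 / m * (m + 1)) = 1 + 1 / m by field_simp,
      one_div ((1 + z x ^ 2) ^ (1 + 1 / m)), ← Real.rpow_neg hpos.le]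
    have e1 : (1 + z x ^ 2) ^ (-(1/2) : ℝ) =
        (1 + z x ^ 2) ^ ((-(1/2) : ℝ) - 1) * (1 + z x ^ 2) := by
      rw [Real.rpow_sub_one hpos.ne']; field_simp
    have e2 : (1 + z x ^ 2) ^ (-(1 + 1 / m) : ℝ) =
        (1 + z x ^ 2) ^ (1 / 2 - 1 / m : ℝ) * (1 + z x ^ 2) ^ ((-(1/2) : ℝ) - 1) := by
      rw [← Real.rpow_add hpos]; ring_nf
    rw [e2, e1]
    have e3 : 2 / (m + 1) = 2 * c / m * c := by
      rw [show 2 * c / m * c = 2 * c ^ 2 / m by ring, hc2]; field_simp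
    rw [e3]
    ring
  · simp [S, hz0]
  · rw [hdS]; simp [hz0]

section Profile

variable {m : ℝ} {S : ℝ → ℝ}

theorem IsLimitProfile.hasDerivAt (hS : IsLimitProfile m S) (x : ℝ) :
    HasDerivAt S (deriv S x) x := (hS.differentiable x).hasDerivAt

theorem IsLimitProfile.continuous (hS : IsLimitProfile m S) : Continuous S :=
  hS.differentiable.continuous

theorem IsLimitProfile.continuous_deriv (hS : IsLimitProfile m S) : Continuous (deriv S) :=
  continuous_iff_continuousAt.2 fun x => (hS.ode x).continuousAt

theorem IsLimitProfile.growth (hm : 1 < m) (hS : IsLimitProfile m S) {y : ℝ} (hy : 0 ≤ y) :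
    growthRate m * (1 + y) ≤ 1 + S y := by
  have hf : 0 < force m 1 := force_pos hm (by norm_num)
  exact growthRate_mul_le (L := y) hm (fun x _ => hS.hasDerivAt x) (fun x _ => hS.ode' x)
    hS.init hS.init_deriv (fun x _ => (force_pos hm (hS.pos x)).le) (fun x _ => by linarith)
    y ⟨hy, le_rfl⟩

theorem IsLimitProfile.neg (hS : IsLimitProfile m S) : IsLimitProfile m (fun x => S (-x)) := by
  have hd : deriv (fun x => S (-x)) = fun x => -deriv S (-x) := funext fun x => deriv_comp_neg S x
  refine ⟨fun x => hS.pos _, hS.differentiable.comp differentiable_neg, fun x => ?_, ?_, ?_⟩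
  · rw [hd]
    exact ((hS.ode (-x)).scomp x (hasDerivAt_neg x)).neg.congr_deriv (by simp)
  · simp [hS.init]
  · simp [hd, hS.init_deriv]

theorem IsLimitProfile.eq_of_nonneg (hm : 1 < m) {T : ℝ → ℝ} (hS : IsLimitProfile m S)
    (hT : IsLimitProfile m T) {y : ℝ} (hy : 0 ≤ y) : S y = T y := by
  have := (stability (L := y) (η := 0) hm hS.continuous hT.continuous
    (fun x _ => hS.hasDerivAt x) (fun x _ => hS.ode' x)
    (fun x _ => hT.hasDerivAt x) (fun x _ => hT.ode' x)
    (by rw [hS.init, hT.init]) (by rw [hS.init_deriv, hT.init_deriv])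
    (fun x hx => hS.growth hm hx.1) (fun x hx => hT.growth hm hx.1)
    (fun x _ => by simp) (fun x _ => rfl) y ⟨hy, le_rfl⟩).2
  simp only [mul_zero, zero_mul] at this
  linarith [abs_nonpos_iff.1 this]

theorem IsLimitProfile.unique (hm : 1 < m) {T : ℝ → ℝ} (hS : IsLimitProfile m S)
    (hT : IsLimitProfile m T) : S = T := by
  funext y
  rcases le_total 0 y with hy | hy
  · exact hS.eq_of_nonneg hm hT hy
  · simpa using hS.neg.eq_of_nonneg hm hT.neg (neg_nonneg.2 hy)

theorem IsLimitProfile.even (hm : 1 < m) (hS : IsLimitProfile m S) (y : ℝ) : S (-y) = S y :=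
  congrFun (hS.neg.unique hm hS) y

theorem IsLimitProfile.deriv_odd (hm : 1 < m) (hS : IsLimitProfile m S) (y : ℝ) :
    deriv S (-y) = -deriv S y := by
  have h := deriv_comp_neg S y
  rw [hS.neg.unique hm hS] at h
  linarith

/-! ### Asymptotics of the limit profile -/

theorem IsLimitProfile.deriv_nonneg (hm : 1 < m) (hS : IsLimitProfile m S) {y : ℝ} (hy : 0 ≤ y) :
    0 ≤ deriv S y := by
  have := mul_le_sub_of_hasDerivAt (C := 0) hy (fun x _ => hS.ode' x)
    (fun x _ => (force_pos hm (hS.pos x)).le)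
  linarith [hS.init_deriv]

theorem IsLimitProfile.nonneg (hm : 1 < m) (hS : IsLimitProfile m S) (y : ℝ) : 0 ≤ S y := by
  have key : ∀ y, 0 ≤ y → 0 ≤ S y := fun y hy => by
    have := mul_le_sub_of_hasDerivAt (C := 0) hy (fun x _ => hS.hasDerivAt x)
      (fun x hx => hS.deriv_nonneg hm hx.1)
    linarith [hS.init]
  rcases le_total 0 y with hy | hy
  · exact key y hy
  · rw [← hS.even hm]; exact key _ (neg_nonneg.2 hy)

theorem IsLimitProfile.energy (hm : 1 < m) (hS : IsLimitProfile m S) (y : ℝ) :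
    deriv S y ^ 2 = muBar m ^ 2 * (1 - 1 / (1 + S y) ^ m) := by
  have hd : ∀ x, HasDerivAt (fun x => deriv S x ^ 2 + muBar m ^ 2 * (1 + S x) ^ (-m)) 0 x := by
    intro x
    have hp := hS.pos x
    refine (((hS.ode' x).pow 2).add ((((hS.hasDerivAt x).const_add 1).rpow_const (p := -m)
      (Or.inl hp.ne')).const_mul (muBar m ^ 2))).congr_deriv ?_
    rw [muBar_sq hm, force, show -m - 1 = -(m + 1) by ring, Real.rpow_neg hp.le]
    have h1 := (Real.rpow_pos_of_pos hp (m + 1)).ne'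
    have h2 : m + 1 ≠ 0 := by linarith
    have h3 : m ≠ 0 := by linarith
    field_simp
    norm_num
    ring
  have h := is_const_of_deriv_eq_zero (fun x => (hd x).differentiableAt)
    (fun x => (hd x).deriv) y 0
  simp only [hS.init, hS.init_deriv, add_zero, Real.one_rpow] at h
  rw [Real.rpow_neg (hS.pos y).le] at h
  rw [one_div]
  linarith

theorem IsLimitProfile.inv_rpow_pos (hS : IsLimitProfile m S) (y : ℝ) :
    0 < 1 / (1 + S y) ^ m :=
  one_div_pos.2 (Real.rpow_pos_of_pos (hS.pos y) m)

theorem IsLimitProfile.abs_deriv_le (hm : 1 < m) (hS : IsLimitProfile m S) (y : ℝ) :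
    |deriv S y| ≤ muBar m := by
  apply abs_le_of_sq_le_sq _ (muBar_pos hm).le
  rw [hS.energy hm]
  have := hS.inv_rpow_pos y
  nlinarith [sq_nonneg (muBar m)]

/-- The constant in the bound `(1+S)^(-m) ≤ C (1+y)^(-m)`. -/
noncomputable def decayConst (m : ℝ) : ℝ := 1 / growthRate m ^ m

theorem decayConst_pos (hm : 1 < m) : 0 < decayConst m :=
  one_div_pos.2 (Real.rpow_pos_of_pos (growthRate_pos hm) m)

theorem IsLimitProfile.inv_rpow_le (hm : 1 < m) (hS : IsLimitProfile m S) {y : ℝ} (hy : 0 ≤ y) :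
    1 / (1 + S y) ^ m ≤ decayConst m * (1 + y) ^ (-m) := by
  have hg := growthRate_pos hm
  have h1 : 0 < 1 + y := by linarith
  have h := Real.rpow_le_rpow (by positivity) (hS.growth hm hy) (by linarith : 0 ≤ m)
  have h2 : 0 < (growthRate m * (1 + y)) ^ m := Real.rpow_pos_of_pos (by positivity) m
  calc 1 / (1 + S y) ^ m ≤ 1 / (growthRate m * (1 + y)) ^ m := by gcongr
    _ = _ := by
      rw [Real.mul_rpow hg.le h1.le, Real.rpow_neg h1.le, decayConst]
      field_simp

theorem IsLimitProfile.muBar_sub_deriv_le (hm : 1 < m) (hS : IsLimitProfile m S) {y : ℝ}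
    (hy : 0 ≤ y) : muBar m - deriv S y ≤ muBar m * decayConst m * (1 + y) ^ (-m) := by
  have hμ := muBar_pos hm
  have h := hS.energy hm y
  have hd := hS.deriv_nonneg hm hy
  have hle := (abs_le.1 (hS.abs_deriv_le hm y)).2
  have h1 : muBar m - deriv S y ≤ muBar m * (1 / (1 + S y) ^ m) := by
    have : muBar m * (muBar m - deriv S y) ≤ muBar m * (muBar m * (1 / (1 + S y) ^ m)) := by
      nlinarith
    exact le_of_mul_le_mul_left this hμ
  have h2 := hS.inv_rpow_le hm hy
  nlinarith

theorem IsLimitProfile.le_muBar_mul (hm : 1 < m) (hS : IsLimitProfile m S) (y : ℝ) :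
    S y ≤ muBar m * |y| := by
  have key : ∀ y, 0 ≤ y → S y ≤ muBar m * y := fun y hy => by
    have := sub_le_mul_of_hasDerivAt hy (fun x _ => hS.hasDerivAt x)
      (fun x _ => (abs_le.1 (hS.abs_deriv_le hm x)).2)
    linarith [hS.init]
  rcases le_total 0 y with hy | hy
  · rw [abs_of_nonneg hy]; exact key y hy
  · rw [← hS.even hm, abs_of_nonpos hy]; exact key _ (neg_nonneg.2 hy)

theorem IsLimitProfile.abs_mul_force_le (hm : 1 < m) (hS : IsLimitProfile m S) (y : ℝ) :
    |y| * force m (S y) ≤ 1 / growthRate m := by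
  have hg := growthRate_pos hm
  have key : ∀ y, 0 ≤ y → y * force m (S y) ≤ 1 / growthRate m := fun y hy => by
    have h1 : (1:ℝ) ≤ 1 + S y := by linarith [hS.nonneg hm y]
    have h2 : 1 + S y ≤ (1 + S y) ^ (m + 1) := by
      simpa using Real.rpow_le_rpow_of_exponent_le h1 (by linarith : (1:ℝ) ≤ m + 1)
    have h3 := hS.growth hm hy
    have h4 : force m (S y) ≤ 1 * (1 / (growthRate m * (1 + y))) := by
      unfold force
      have : 2 / (m + 1) ≤ 1 := by rw [div_le_one (by linarith)]; linarith
      gcongr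
      exact h3.trans h2
    calc y * force m (S y) ≤ y * (1 * (1 / (growthRate m * (1 + y)))) := by gcongr
      _ = 1 / growthRate m * (y / (1 + y)) := by field_simp
      _ ≤ 1 / growthRate m := by
        refine mul_le_of_le_one_right (by positivity) ?_
        rw [div_le_one (by linarith)]; linarith
  rcases le_total 0 y with hy | hy
  · rw [abs_of_nonneg hy]; exact key y hy
  · rw [← hS.even hm, abs_of_nonpos hy]; exact key _ (neg_nonneg.2 hy)

theorem tendsto_one_add_rpow (hm : 1 < m) :
    Tendsto (fun y : ℝ => (1 + y) ^ (1 - m)) atTop (𝓝 0) := by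
  have h := (tendsto_rpow_neg_atTop (show 0 < m - 1 by linarith)).comp
    (tendsto_atTop_add_const_left atTop (1:ℝ) tendsto_id)
  simpa [Function.comp_def] using h

/-- A function whose derivative is `O((1+y)^(-m))` with `m > 1` converges at the rate
`(1+y)^(1-m)`. -/
theorem exists_limit_of_abs_deriv_le (hm : 1 < m) {g g' : ℝ → ℝ} {C : ℝ}
    (hg : ∀ y, 0 ≤ y → HasDerivAt g (g' y) y)
    (hle : ∀ y, 0 ≤ y → |g' y| ≤ C * (1 + y) ^ (-m)) :
    ∃ l, ∀ y, 0 ≤ y → |g y - l| ≤ C / (m - 1) * (1 + y) ^ (1 - m) := by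
  have hC : 0 ≤ C := by
    have := (abs_nonneg _).trans (hle 0 le_rfl)
    simpa using this
  have hm1 : m - 1 ≠ 0 := by linarith
  have hp : ∀ y, 0 ≤ y → HasDerivAt (fun y : ℝ => -(C / (m - 1)) * (1 + y) ^ (1 - m))
      (C * (1 + y) ^ (-m)) y := fun y hy => by
    have h1 : HasDerivAt (fun t : ℝ => 1 + t) 1 y := by simpa using (hasDerivAt_id y).const_add 1
    refine ((h1.rpow_const (p := 1 - m) (Or.inl (by linarith))).const_mul
      (-(C / (m - 1)))).congr_deriv ?_
    rw [show 1 - m - 1 = -m by ring]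
    field_simp
    ring
  have hd : ∀ a b, 0 ≤ a → a ≤ b → |g b - g a| ≤ C / (m - 1) * (1 + a) ^ (1 - m) := by
    intro a b ha hab
    have := abs_sub_le_sub_of_hasDerivAt_le hab (fun x hx => hg x (ha.trans hx.1))
      (fun x hx => hp x (ha.trans hx.1)) (fun x hx => hle x (ha.trans hx.1))
    have h2 : 0 ≤ C / (m - 1) * (1 + b) ^ (1 - m) :=
      mul_nonneg (div_nonneg hC (by linarith)) (Real.rpow_nonneg (by linarith) _)
    linarith
  have hlim : Tendsto (fun y : ℝ => C / (m - 1) * (1 + y) ^ (1 - m)) atTop (𝓝 0) := by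
    simpa using (tendsto_one_add_rpow hm).const_mul (C / (m - 1))
  have hcau : CauchySeq g := by
    rw [Metric.cauchySeq_iff']
    intro ε hε
    obtain ⟨N, hN⟩ := ((hlim.eventually (gt_mem_nhds hε)).and (eventually_ge_atTop 0)).exists
    refine ⟨N, fun n hn => ?_⟩
    rw [Real.dist_eq]
    exact (hd N n hN.2 hn).trans_lt hN.1
  obtain ⟨l, hl⟩ := cauchySeq_tendsto_of_complete hcau
  refine ⟨l, fun y hy => ?_⟩
  rw [abs_sub_comm]
  refine le_of_tendsto (hl.sub_const (g y)).abs ?_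
  filter_upwards [eventually_ge_atTop y] with z hz using hd y z hy hz

theorem rpow_one_sub_eq {y : ℝ} (hy : 0 ≤ y) : (1 + y) ^ (1 - m) = (1 + y) * (1 + y) ^ (-m) := by
  rw [sub_eq_add_neg, Real.rpow_add (by linarith), Real.rpow_one]

/-- The asymptote of the limit profile. -/
theorem IsLimitProfile.exists_asymptote (hm : 1 < m) (hS : IsLimitProfile m S) :
    ∃ C, 0 < C ∧ ∀ y, 0 ≤ y →
      |muBar m * y - S y - kappaBar S| ≤ C * (1 + y) ^ (1 - m) := by
  have hμ := muBar_pos hm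
  have hC : 0 < muBar m * decayConst m := mul_pos hμ (decayConst_pos hm)
  have hd : ∀ y, HasDerivAt (fun y => muBar m * y - S y) (muBar m - deriv S y) y := fun y => by
    exact (((hasDerivAt_id y).const_mul (muBar m)).sub (hS.hasDerivAt y)).congr_deriv (by simp)
  have hnn : ∀ y, 0 ≤ muBar m - deriv S y := fun y =>
    sub_nonneg.2 (abs_le.1 (hS.abs_deriv_le hm y)).2
  obtain ⟨l, hl⟩ := exists_limit_of_abs_deriv_le hm (fun y _ => hd y) (fun y hy => by
    rw [abs_of_nonneg (hnn y)]
    exact hS.muBar_sub_deriv_le hm hy)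
  have hkd : ∀ y, HasDerivAt (fun y => y * deriv S y - S y) (y * deriv (deriv S) y) y := fun y => by
    rw [(hS.ode' y).deriv]
    refine (((hasDerivAt_id y).mul (hS.ode' y)).sub (hS.hasDerivAt y)).congr_deriv ?_
    simp
  have hlim : Tendsto (fun y => y * deriv S y - S y) atTop (𝓝 l) := by
    rw [tendsto_iff_norm_sub_tendsto_zero]
    have h0 := (tendsto_one_add_rpow hm).const_mul
      (muBar m * decayConst m / (m - 1) + muBar m * decayConst m)
    rw [mul_zero] at h0
    refine squeeze_zero' (.of_forall fun _ => norm_nonneg _) ?_ h0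
    filter_upwards [eventually_ge_atTop 0] with y hy
    have h1 := hl y hy
    have h2 : |y * (muBar m - deriv S y)| ≤ muBar m * decayConst m * (1 + y) ^ (1 - m) := by
      rw [abs_of_nonneg (mul_nonneg hy (hnn y)), rpow_one_sub_eq hy]
      have := hS.muBar_sub_deriv_le hm hy
      calc y * (muBar m - deriv S y) ≤ (1 + y) * (muBar m * decayConst m * (1 + y) ^ (-m)) :=
            mul_le_mul (by linarith) this (hnn y) (by linarith)
        _ = _ := by ring
    rw [Real.norm_eq_abs]
    calc |y * deriv S y - S y - l|
        = |(muBar m * y - S y - l) - y * (muBar m - deriv S y)| := by ring_nf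
      _ ≤ _ := abs_sub _ _
      _ ≤ _ := by rw [add_mul]; exact add_le_add h1 h2
  have hκ : kappaBar S = l := by
    have := integral_Ioi_of_hasDerivAt_of_nonneg' (a := 0) (fun x _ => hkd x) (fun x hx => by
      rw [(hS.ode' x).deriv]
      exact mul_nonneg (le_of_lt hx) (force_pos hm (hS.pos x)).le) hlim
    simpa [kappaBar, hS.init] using this
  exact ⟨_, div_pos hC (by linarith : 0 < m - 1), fun y hy => hκ ▸ hl y hy⟩

/-- The deficit `∫_0^y (μ̄² - S'(t)²)/2 dt` of kinetic energy with respect to the asymptotic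
slope. -/
noncomputable def kineticDeficit (m : ℝ) (S : ℝ → ℝ) (y : ℝ) : ℝ :=
  ∫ t in (0:ℝ)..y, (muBar m ^ 2 - deriv S t ^ 2) / 2

theorem IsLimitProfile.hasDerivAt_kineticDeficit (hS : IsLimitProfile m S) (y : ℝ) :
    HasDerivAt (kineticDeficit m S) ((muBar m ^ 2 - deriv S y ^ 2) / 2) y := by
  have hd := hS.continuous_deriv
  have hc : Continuous fun t => (muBar m ^ 2 - deriv S t ^ 2) / 2 := by fun_prop
  exact intervalIntegral.integral_hasDerivAt_right (hc.intervalIntegrable _ _)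
    (hc.stronglyMeasurableAtFilter _ _) hc.continuousAt

theorem IsLimitProfile.kineticDeficit_neg (hm : 1 < m) (hS : IsLimitProfile m S) (y : ℝ) :
    kineticDeficit m S (-y) = -kineticDeficit m S y := by
  unfold kineticDeficit
  rw [intervalIntegral.integral_symm, neg_inj]
  have := intervalIntegral.integral_comp_neg (a := 0) (b := y)
    (fun t => (muBar m ^ 2 - deriv S t ^ 2) / 2)
  simp only [neg_zero, hS.deriv_odd hm, neg_sq] at this
  exact this.symm

/-- Since `(1 - u)² ≤ (1 - u²)^(1+1/m)` for `0 ≤ u ≤ 1`, the square of the slope defect is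
controlled by the force. -/
theorem IsLimitProfile.sq_muBar_sub_deriv_le (hm : 1 < m) (hS : IsLimitProfile m S) {y : ℝ}
    (hy : 0 ≤ y) : (muBar m - deriv S y) ^ 2 ≤ 2 / m * force m (S y) := by
  have hm0 : 0 < m := by linarith
  have hμ := muBar_pos hm
  have hen := hS.energy hm y
  have hd := hS.deriv_nonneg hm hy
  have hle := (abs_le.1 (hS.abs_deriv_le hm y)).2
  have hp := hS.pos y
  have hX0 := hS.inv_rpow_pos y
  set X := 1 / (1 + S y) ^ m with hX
  obtain ⟨t, ht⟩ : ∃ t, t = (muBar m - deriv S y) / muBar m := ⟨_, rfl⟩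
  have ht0 : 0 ≤ t := ht ▸ div_nonneg (by linarith) hμ.le
  have ht1 : t ≤ 1 := by rw [ht, div_le_one hμ]; linarith
  have hder : deriv S y = muBar m * (1 - t) := by rw [ht]; field_simp; ring
  have htX : t ≤ X := by
    rw [hder, mul_pow] at hen
    have := mul_left_cancel₀ (pow_ne_zero 2 hμ.ne') hen
    nlinarith
  have hpow : t ^ 2 ≤ 1 / (1 + S y) ^ (m + 1) := by
    have h1 : t ^ (1 + 1 / m) ≤ X ^ (1 + 1 / m) := Real.rpow_le_rpow ht0 htX (by positivity)
    have h2 : X ^ (1 + 1 / m) = 1 / (1 + S y) ^ (m + 1) := by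
      rw [hX, Real.div_rpow zero_le_one (Real.rpow_nonneg hp.le _), Real.one_rpow,
        ← Real.rpow_mul hp.le]
      congr 2
      field_simp
    have h3 : t ^ 2 ≤ t ^ (1 + 1 / m) := by
      rw [← Real.rpow_natCast]
      apply Real.rpow_le_rpow_of_exponent_ge' ht0 ht1 (by positivity)
      have : 1 / m ≤ 1 := by rw [div_le_one hm0]; linarith
      push_cast; linarith
    linarith
  have : (muBar m - deriv S y) ^ 2 = muBar m ^ 2 * t ^ 2 := by rw [hder]; ring
  rw [this, muBar_sq hm, force]
  calc 4 / (m * (m + 1)) * t ^ 2 ≤ 4 / (m * (m + 1)) * (1 / (1 + S y) ^ (m + 1)) := by gcongr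
    _ = _ := by field_simp; norm_num

/-- The kinetic deficit converges, and its limit `A` satisfies `A/μ̄ - κ̄ > -1`. This strict
inequality is what makes the leading coefficient of `δ̂_ε` positive. -/
theorem IsLimitProfile.exists_kineticDeficit_limit (hm : 1 < m) (hS : IsLimitProfile m S) :
    ∃ A C, 0 < C ∧ (∀ y, 0 ≤ y → |kineticDeficit m S y - A| ≤ C * (1 + y) ^ (1 - m)) ∧
      0 < A / muBar m + 1 - kappaBar S := by
  have hμ := muBar_pos hm
  have hm0 : 0 < m := by linarith
  have hC : 0 < muBar m ^ 2 / 2 * decayConst m := mul_pos (by positivity) (decayConst_pos hm)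
  obtain ⟨A, hA⟩ := exists_limit_of_abs_deriv_le (C := muBar m ^ 2 / 2 * decayConst m) hm
    (fun y _ => hS.hasDerivAt_kineticDeficit (m := m) y) (fun y hy => by
      have h1 := hS.inv_rpow_pos y
      have h2 := hS.inv_rpow_le hm hy
      have h3 : (muBar m ^ 2 - deriv S y ^ 2) / 2 = muBar m ^ 2 / 2 * (1 / (1 + S y) ^ m) := by
        rw [hS.energy hm]; ring
      rw [h3, abs_of_pos (by positivity), mul_assoc]
      gcongr)
  obtain ⟨C, hC0, hκ⟩ := hS.exists_asymptote hm
  refine ⟨A, _, div_pos hC (by linarith : 0 < m - 1), hA, ?_⟩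
  have hlow : ∀ y, 0 ≤ y →
      -(1 / m) * muBar m ≤ kineticDeficit m S y - muBar m * (muBar m * y - S y) := by
    intro y hy
    have h := sub_le_sub_of_hasDerivAt_le hy
      (fun x _ => (hS.ode' x).const_mul (-(1 / m)))
      (fun x _ => (hS.hasDerivAt_kineticDeficit (m := m) x).sub
        ((((hasDerivAt_id x).const_mul (muBar m)).sub (hS.hasDerivAt x)).const_mul (muBar m)))
      (fun x hx => by
        have := hS.sq_muBar_sub_deriv_le hm hx.1
        have e : 2 / m * force m (S x) = 2 * (1 / m * force m (S x)) := by ring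
        rw [e] at this
        nlinarith)
    have h0 : kineticDeficit m S 0 = 0 := by simp [kineticDeficit]
    simp only [Pi.sub_apply, id, hS.init, hS.init_deriv, h0, mul_zero, sub_zero] at h
    have h4 := (abs_le.1 (hS.abs_deriv_le hm y)).2
    have h5 : 0 < 1 / m := by positivity
    nlinarith
  have hlim : Tendsto (fun y => kineticDeficit m S y - muBar m * (muBar m * y - S y)) atTop
      (𝓝 (A - muBar m * kappaBar S)) := by
    have aux : ∀ (g : ℝ → ℝ) (l K : ℝ), (∀ y, 0 ≤ y → |g y - l| ≤ K * (1 + y) ^ (1 - m)) →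
        Tendsto g atTop (𝓝 l) := by
      intro g l K h
      rw [tendsto_iff_norm_sub_tendsto_zero]
      have h0 := (tendsto_one_add_rpow hm).const_mul K
      rw [mul_zero] at h0
      refine squeeze_zero' (.of_forall fun _ => norm_nonneg _) ?_ h0
      filter_upwards [eventually_ge_atTop 0] with y hy using h y hy
    exact (aux _ _ _ hA).sub ((aux _ _ _ hκ).const_mul (muBar m))
  have hfin : -(1 / m) * muBar m ≤ A - muBar m * kappaBar S := by
    refine ge_of_tendsto hlim ?_
    filter_upwards [eventually_ge_atTop 0] with y hy using hlow y hy
  have h1m : 1 / m < 1 := by rw [div_lt_one hm0]; exact hm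
  have : A / muBar m + 1 - kappaBar S = (A - muBar m * kappaBar S + muBar m) / muBar m := by
    field_simp
    ring
  rw [this]
  apply div_pos _ hμ
  nlinarith

end Profile

/-! ### The stress `Φ'` -/

/-- The derivative `Φ'(r) = ((1-r)^(-(m+1)) - 1)/(m+1)` of the potential, written through
`force`. -/
noncomputable def stress (m r : ℝ) : ℝ := force m (-r) / 2 - 1 / (m + 1)

theorem hasDerivAt_potential {m r : ℝ} (hm : 1 < m) (hr : r < 1) :
    HasDerivAt (potential m) (stress m r) r := by
  have hp : 0 < 1 - r := by linarith
  have h1 : HasDerivAt (fun t : ℝ => 1 - t) (-1) r := by simpa using (hasDerivAt_id r).const_sub 1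
  have h2 := (((h1.rpow_const (p := -m) (Or.inl hp.ne')).sub
    ((hasDerivAt_id r).const_mul m)).sub_const 1).const_mul (1 / (m * (m + 1)))
  have hev : potential m =ᶠ[𝓝 r] fun t => 1 / (m * (m + 1)) *
      (((fun x : ℝ => (1 - x) ^ (-m)) - fun y => m * id y) t - 1) := by
    have : ∀ᶠ t in 𝓝 r, 0 < 1 - t := h1.continuousAt.eventually (lt_mem_nhds hp)
    filter_upwards [this] with t ht
    simp only [potential, Pi.sub_apply, id]
    rw [Real.rpow_neg ht.le, one_div ((1 - t) ^ m)]
  refine (h2.congr_of_eventuallyEq hev).congr_deriv ?_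
  rw [stress, force, show -m - 1 = -(m + 1) by ring, Real.rpow_neg hp.le, ← sub_eq_add_neg]
  have h3 := (Real.rpow_pos_of_pos hp (m + 1)).ne'
  have h4 : m + 1 ≠ 0 := by linarith
  have h5 : m ≠ 0 := by linarith
  field_simp

theorem stress_zero {m : ℝ} : stress m 0 = 0 := by
  simp only [stress, force, neg_zero, add_zero, Real.one_rpow]
  ring

theorem stress_mono {m r t : ℝ} (hm : 1 < m) (ht : t < 1) (hrt : r ≤ t) :
    stress m r ≤ stress m t := by
  unfold stress
  have := force_anti hm (s := -t) (t := -r) (by linarith) (by linarith)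
  linarith

theorem stress_nonneg {m r : ℝ} (hm : 1 < m) (hr : r ∈ Ico (0:ℝ) 1) : 0 ≤ stress m r :=
  stress_zero (m := m) ▸ stress_mono hm hr.2 hr.1

theorem stress_le_mul {m p r : ℝ} (hm : 1 < m) (hp : 0 < p) (hr : 0 ≤ r) (hrp : r ≤ 1 - p) :
    stress m r ≤ 1 / p ^ (m + 2) * r := by
  have h := abs_force_sub_le (s := -r) (t := 0) hm hp (by linarith) (by linarith)
  have h0 := stress_zero (m := m)
  unfold stress at h0 ⊢
  rw [neg_zero] at h0
  have h1 := (le_abs_self _).trans h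
  rw [sub_zero, abs_neg, abs_of_nonneg hr] at h1
  linarith

/-! ### Single solitary waves -/

/-- A nonnegative, even and unimodal solitary wave whose velocity profile has `L²` norm at most
one. -/
structure IsSolitaryWave (m : ℝ) (V R : ℝ → ℝ) (σ : ℝ) : Prop where
  wave : IsTravellingWave m V R σ
  V_memLp : MemLp V 2 volume
  R_memLp : MemLp R 2 volume
  V_bc1 : IsBC1 V
  R_bc1 : IsBC1 R
  V_nonneg : ∀ x, 0 ≤ V x
  V_even : Function.Even V
  R_even : Function.Even R
  V_unimodal : IsUnimodal V
  R_unimodal : IsUnimodal R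
  V_norm : norm2 V ≤ 1
  R_range : ∀ x, R x ∈ Ico (0 : ℝ) 1

theorem IsHighEnergyFamily.isSolitaryWave {m : ℝ} {V R : ℝ → ℝ → ℝ} {σ : ℝ → ℝ}
    (h : IsHighEnergyFamily m V R σ) {δ : ℝ} (hδ : δ ∈ Ioo (0:ℝ) 1) :
    IsSolitaryWave m (V δ) (R δ) (σ δ) :=
  ⟨h.wave δ hδ, h.V_memLp δ hδ, h.R_memLp δ hδ, h.V_bc1 δ hδ, h.R_bc1 δ hδ, h.V_nonneg δ hδ,
    h.V_even δ hδ, h.R_even δ hδ, h.V_unimodal δ hδ, h.R_unimodal δ hδ,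
    by rw [h.V_norm δ hδ]; linarith [hδ.1], h.R_range δ hδ⟩

theorem norm2_sq {f : ℝ → ℝ} (hf : MemLp f 2 volume) : norm2 f ^ 2 = ∫ x, f x ^ 2 := by
  have h0 : 0 ≤ ∫ x, f x ^ 2 := integral_nonneg fun x => sq_nonneg _
  rw [norm2, hf.eLpNorm_eq_integral_rpow_norm (by norm_num) (by norm_num)]
  simp only [ENNReal.toReal_ofNat, Real.rpow_ofNat, Real.norm_eq_abs, sq_abs]
  rw [ENNReal.toReal_ofReal (Real.rpow_nonneg h0 _), ← Real.rpow_natCast, ← Real.rpow_mul h0]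
  norm_num

theorem tendsto_zero_of_antitoneOn_memLp {f : ℝ → ℝ} (hf : MemLp f 2 volume)
    (h0 : ∀ x, 0 ≤ f x) (hanti : AntitoneOn f (Ici 0)) : Tendsto f atTop (𝓝 0) := by
  have hint : Integrable (fun x => f x ^ 2) := hf.integrable_sq
  set I := ∫ x, f x ^ 2
  have hle : ∀ x, 0 < x → f x ≤ √(I / x) := by
    intro x hx
    apply Real.le_sqrt_of_sq_le
    rw [le_div_iff₀ hx]
    calc f x ^ 2 * x = ∫ _ in Ioc 0 x, f x ^ 2 := by
          simp [hx.le, mul_comm]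
      _ ≤ ∫ t in Ioc 0 x, f t ^ 2 := by
          refine setIntegral_mono_on (by simp) hint.integrableOn
            measurableSet_Ioc fun t ht => ?_
          have := hanti ht.1.le hx.le ht.2
          have := h0 x
          gcongr
      _ ≤ I := setIntegral_le_integral hint (.of_forall fun t => sq_nonneg _)
  have hlim : Tendsto (fun x => √(I / x)) atTop (𝓝 0) := by
    have : Tendsto (fun x : ℝ => I / x) atTop (𝓝 0) := tendsto_const_nhds.div_atTop tendsto_id
    simpa using this.sqrt
  refine squeeze_zero' (.of_forall h0) ?_ hlim
  filter_upwards [eventually_gt_atTop 0] with x hx using hle x hx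

/-- The integrated form of the travelling wave equations; the constant of integration vanishes
because both profiles decay at infinity. -/
theorem eq_integral_window {F g : ℝ → ℝ} (hg : Continuous g)
    (hF : ∀ x, HasDerivAt F (g (x + 1 / 2) - g (x - 1 / 2)) x)
    (hF0 : Tendsto F atTop (𝓝 0)) (hg0 : Tendsto g atTop (𝓝 0)) (x : ℝ) :
    F x = ∫ t in (x - 1 / 2)..(x + 1 / 2), g t := by
  set P : ℝ → ℝ := fun y => ∫ t in (0:ℝ)..y, g t with hP
  have hPd : ∀ y, HasDerivAt P (g y) y := fun y =>
    intervalIntegral.integral_hasDerivAt_right (hg.intervalIntegrable _ _)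
      (hg.stronglyMeasurableAtFilter _ _) hg.continuousAt
  have hwin : ∀ x, ∫ t in (x - 1 / 2)..(x + 1 / 2), g t = P (x + 1 / 2) - P (x - 1 / 2) := fun x =>
    (intervalIntegral.integral_interval_sub_left (hg.intervalIntegrable _ _)
      (hg.intervalIntegrable _ _)).symm
  have hd : ∀ y, HasDerivAt (fun x => F x - (P (x + 1 / 2) - P (x - 1 / 2))) 0 y := fun y => by
    refine ((hF y).sub (((hPd (y + 1 / 2)).comp_add_const y (1 / 2)).sub
      ((hPd (y - 1 / 2)).comp_sub_const y (1 / 2)))).congr_deriv ?_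
    ring
  have hconst := fun y => is_const_of_deriv_eq_zero (fun x => (hd x).differentiableAt)
    (fun x => (hd x).deriv) x y
  have hlim : Tendsto (fun x => F x - (P (x + 1 / 2) - P (x - 1 / 2))) atTop (𝓝 (0 - 0)) := by
    refine hF0.sub ?_
    rw [Metric.tendsto_atTop]
    intro ε hε
    obtain ⟨N, hN⟩ := Metric.tendsto_atTop.1 hg0 (ε / 2) (by positivity)
    refine ⟨N + 1 / 2, fun n hn => ?_⟩
    rw [← hwin, dist_zero_right]
    have := intervalIntegral.norm_integral_le_of_norm_le_const (a := n - 1 / 2) (b := n + 1 / 2)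
      (f := g) (C := ε / 2) (fun t ht => by
        rw [uIoc_of_le (by linarith)] at ht
        have := hN t (by linarith [ht.1])
        rw [dist_zero_right] at this
        exact this.le)
    have e : |n + 1 / 2 - (n - 1 / 2)| = 1 := by
      rw [show n + 1 / 2 - (n - 1 / 2) = 1 by ring]; norm_num
    rw [e, mul_one] at this
    linarith
  have h0 : F x - (P (x + 1 / 2) - P (x - 1 / 2)) = 0 := by
    refine tendsto_nhds_unique (tendsto_const_nhds.congr fun y => hconst y) (by simpa using hlim)
  rw [hwin]
  linarith

theorem integral_window_le {g : ℝ → ℝ} (hg : Continuous g) {x C : ℝ}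
    (h : ∀ t ∈ Icc (x - 1 / 2) (x + 1 / 2), g t ≤ C) :
    ∫ t in (x - 1 / 2)..(x + 1 / 2), g t ≤ C := by
  have := intervalIntegral.integral_mono_on (μ := volume) (a := x - 1 / 2) (b := x + 1 / 2)
    (by linarith) (hg.intervalIntegrable _ _) (continuous_const.intervalIntegrable _ _) h
  rw [intervalIntegral.integral_const, show x + 1 / 2 - (x - 1 / 2) = 1 by ring, one_smul] at this
  exact this

section Wave

variable {m σ : ℝ} {V R : ℝ → ℝ}

theorem IsSolitaryWave.continuous_V (h : IsSolitaryWave m V R σ) : Continuous V :=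
  h.V_bc1.1.continuous

theorem IsSolitaryWave.continuous_R (h : IsSolitaryWave m V R σ) : Continuous R :=
  h.R_bc1.1.continuous

theorem IsSolitaryWave.hasDerivAt_R (h : IsSolitaryWave m V R σ) (x : ℝ) :
    HasDerivAt R (V (x + 1 / 2) - V (x - 1 / 2)) x := by
  rw [← h.wave.distance_eq]
  exact (h.R_bc1.1.differentiable (by norm_num) x).hasDerivAt

theorem IsSolitaryWave.hasDerivAt_V (hm : 1 < m) (h : IsSolitaryWave m V R σ) (x : ℝ) :
    HasDerivAt V ((stress m (R (x + 1 / 2)) - stress m (R (x - 1 / 2))) / σ) x := by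
  have hd := (h.V_bc1.1.differentiable (by norm_num) x).hasDerivAt
  have he := h.wave.velocity_eq x
  rw [(hasDerivAt_potential hm (h.R_range _).2).deriv,
    (hasDerivAt_potential hm (h.R_range _).2).deriv] at he
  rw [← he, mul_div_cancel_left₀ _ h.wave.speed_pos.ne']
  exact hd

theorem IsSolitaryWave.continuous_stress (hm : 1 < m) (h : IsSolitaryWave m V R σ) :
    Continuous fun x => stress m (R x) := by
  have : ∀ x, ContinuousAt (stress m) (R x) := fun x => by
    refine ((continuousAt_force hm ?_).comp continuousAt_neg).div_const 2 |>.sub_const _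
    linarith [(h.R_range x).2]
  exact continuous_iff_continuousAt.2 fun x => (this x).comp h.continuous_R.continuousAt

theorem IsSolitaryWave.tendsto_V (h : IsSolitaryWave m V R σ) : Tendsto V atTop (𝓝 0) :=
  tendsto_zero_of_antitoneOn_memLp h.V_memLp h.V_nonneg h.V_unimodal.2

theorem IsSolitaryWave.tendsto_R (h : IsSolitaryWave m V R σ) : Tendsto R atTop (𝓝 0) :=
  tendsto_zero_of_antitoneOn_memLp h.R_memLp (fun x => (h.R_range x).1) h.R_unimodal.2

theorem IsSolitaryWave.R_eq (h : IsSolitaryWave m V R σ) (x : ℝ) :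
    R x = ∫ t in (x - 1 / 2)..(x + 1 / 2), V t :=
  eq_integral_window h.continuous_V h.hasDerivAt_R h.tendsto_R h.tendsto_V x

theorem IsSolitaryWave.V_eq (hm : 1 < m) (h : IsSolitaryWave m V R σ) (x : ℝ) :
    σ * V x = ∫ t in (x - 1 / 2)..(x + 1 / 2), stress m (R t) := by
  refine eq_integral_window (F := fun x => σ * V x) (h.continuous_stress hm) (fun y => ?_) ?_ ?_ x
  · refine ((h.hasDerivAt_V hm y).const_mul σ).congr_deriv ?_
    rw [mul_div_cancel₀ _ h.wave.speed_pos.ne']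
  · simpa using h.tendsto_V.const_mul σ
  · have hc : ContinuousAt (stress m) 0 :=
      ((continuousAt_force hm (by norm_num)).comp continuousAt_neg).div_const 2 |>.sub_const _
    have := hc.tendsto.comp h.tendsto_R
    rwa [stress_zero] at this

theorem IsSolitaryWave.V_anti (h : IsSolitaryWave m V R σ) {x y : ℝ} (hx : 0 ≤ x) (hxy : x ≤ y) :
    V y ≤ V x := h.V_unimodal.2 hx (hx.trans hxy) hxy

theorem IsSolitaryWave.R_anti (h : IsSolitaryWave m V R σ) {x y : ℝ} (hx : 0 ≤ x) (hxy : x ≤ y) :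
    R y ≤ R x := h.R_unimodal.2 hx (hx.trans hxy) hxy

theorem IsSolitaryWave.R_abs (h : IsSolitaryWave m V R σ) (x : ℝ) : R |x| = R x := by
  rcases abs_choice x with e | e <;> rw [e]
  exact h.R_even x

theorem IsSolitaryWave.V_abs (h : IsSolitaryWave m V R σ) (x : ℝ) : V |x| = V x := by
  rcases abs_choice x with e | e <;> rw [e]
  exact h.V_even x

theorem IsSolitaryWave.R_anti_abs (h : IsSolitaryWave m V R σ) {x y : ℝ} (hxy : |x| ≤ |y|) :
    R y ≤ R x := by
  rw [← h.R_abs x, ← h.R_abs y]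
  exact h.R_anti (abs_nonneg x) hxy

theorem IsSolitaryWave.R_le_V (h : IsSolitaryWave m V R σ) {x : ℝ} (hx : 1 / 2 ≤ x) :
    R x ≤ V (x - 1 / 2) := by
  rw [h.R_eq]
  exact integral_window_le h.continuous_V fun t ht => h.V_anti (by linarith) ht.1

theorem IsSolitaryWave.V_le_stress (hm : 1 < m) (h : IsSolitaryWave m V R σ) {x : ℝ}
    (hx : 1 / 2 ≤ x) : σ * V x ≤ stress m (R (x - 1 / 2)) := by
  rw [h.V_eq hm]
  exact integral_window_le (h.continuous_stress hm) fun t ht =>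
    stress_mono hm (h.R_range _).2 (h.R_anti (by linarith) ht.1)

theorem IsSolitaryWave.integral_sq_le (h : IsSolitaryWave m V R σ) : ∫ x, V x ^ 2 ≤ 1 := by
  rw [← norm2_sq h.V_memLp]
  have h0 : 0 ≤ norm2 V := ENNReal.toReal_nonneg
  have := h.V_norm
  nlinarith

/-- If `R(0)` is close to `1`, then `V` is close in `L²` to the indicator function of
`[-1/2, 1/2]`, hence `R(1/2)` is close to `1/2`. -/
theorem IsSolitaryWave.R_half_le (h : IsSolitaryWave m V R σ) (h0 : 99 / 100 ≤ R 0) :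
    R (1 / 2) ≤ 3 / 4 := by
  have hc := h.continuous_V
  have hi : ∀ a b, IntervalIntegrable V volume a b := fun a b => hc.intervalIntegrable a b
  have hi2 : ∀ a b, IntervalIntegrable (fun x => V x ^ 2) volume a b := fun a b =>
    (hc.pow 2).intervalIntegrable a b
  have hR0 : R 0 = ∫ t in (-(1/2):ℝ)..(1 / 2), V t := by
    rw [h.R_eq]; norm_num
  have hR1 : R (1 / 2) = ∫ t in (0:ℝ)..1, V t := by
    rw [h.R_eq]; norm_num
  have hsym : ∫ t in (-(1/2):ℝ)..0, V t = ∫ t in (0:ℝ)..(1 / 2), V t := by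
    have := intervalIntegral.integral_comp_neg (a := 0) (b := 1 / 2) V
    rw [neg_zero] at this
    rw [← this]
    exact intervalIntegral.integral_congr fun x _ => h.V_even x
  have hs0 := intervalIntegral.integral_add_adjacent_intervals (hi (-(1/2)) 0) (hi 0 (1/2))
  have hs1 := intervalIntegral.integral_add_adjacent_intervals (hi 0 (1/2)) (hi (1/2) 1)
  have hs2 := intervalIntegral.integral_add_adjacent_intervals (hi2 (-(1/2)) (1/2)) (hi2 (1/2) 1)
  have htot : ∫ t in (-(1/2):ℝ)..1, V t ^ 2 ≤ 1 := by
    rw [intervalIntegral.integral_of_le (by norm_num)]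
    exact (setIntegral_le_integral h.V_memLp.integrable_sq
      (.of_forall fun t => sq_nonneg _)).trans h.integral_sq_le
  have hcore : 2 * R 0 - 1 ≤ ∫ t in (-(1/2):ℝ)..(1 / 2), V t ^ 2 := by
    have := intervalIntegral.integral_mono_on (μ := volume) (a := -(1/2)) (b := 1/2)
      (f := fun t => 2 * V t - 1) (by norm_num)
      ((by fun_prop : Continuous fun t => 2 * V t - 1).intervalIntegrable _ _) (hi2 _ _)
      (fun t _ => by nlinarith [sq_nonneg (V t - 1)])
    rw [intervalIntegral.integral_sub ((hi _ _).const_mul 2) (by simp),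
      intervalIntegral.integral_const_mul, ← hR0] at this
    norm_num at this
    linarith
  have htail : ∫ t in (1/2:ℝ)..1, V t ≤ 2 * (∫ t in (1/2:ℝ)..1, V t ^ 2) + 1 / 16 := by
    have := intervalIntegral.integral_mono_on (μ := volume) (a := 1/2) (b := 1)
      (g := fun t => 2 * V t ^ 2 + 1 / 8) (by norm_num) (hi _ _)
      ((by fun_prop : Continuous fun t => 2 * V t ^ 2 + 1 / 8).intervalIntegrable _ _)
      (fun t _ => by nlinarith [sq_nonneg (V t - 1 / 4)])
    rw [intervalIntegral.integral_add ((hi2 _ _).const_mul 2) (by simp),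
      intervalIntegral.integral_const_mul] at this
    norm_num at this
    norm_num
    linarith
  have hR0' := (h.R_range 0).2
  linarith

end Wave

/-! ### The tip of a high wave -/

/-- A solitary wave of height `R(0) = 1 - ε` with `ε ≤ 1/100`, together with the scaling
parameter `s > 0` determined by `σ s² ε^(m+2) = 1`; its inverse is the width of the tip. -/
structure IsHighWave (m : ℝ) (V R : ℝ → ℝ) (σ ε s : ℝ) : Prop extends
    IsSolitaryWave m V R σ where
  height : R 0 = 1 - ε
  eps_pos : 0 < ε
  eps_le : ε ≤ 1 / 100
  s_pos : 0 < s
  scaling : σ * s ^ 2 * ε ^ (m + 2) = 1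

/-- The bound for the residual of the rescaled tip in units of `ε^(m+1)`. -/
noncomputable def residualConst (m : ℝ) : ℝ := 1 + 2 * stress m (3 / 4)

theorem residualConst_pos {m : ℝ} (hm : 1 < m) : 0 < residualConst m := by
  have := stress_nonneg (r := 3 / 4) hm ⟨by norm_num, by norm_num⟩
  unfold residualConst
  linarith

/-- The rescaled tip `y ↦ (1 - ε - R(y/s))/ε` of the distance profile. -/
noncomputable def tip (R : ℝ → ℝ) (ε s y : ℝ) : ℝ := (1 - ε - R (y / s)) / ε

/-- The derivative of the rescaled tip. -/
noncomputable def tipDeriv (V : ℝ → ℝ) (ε s y : ℝ) : ℝ :=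
  (V (y / s - 1 / 2) - V (y / s + 1 / 2)) / (ε * s)

section HighWave

variable {m σ ε s : ℝ} {V R : ℝ → ℝ}

theorem IsHighWave.R_half_le (h : IsHighWave m V R σ ε s) : R (1 / 2) ≤ 3 / 4 :=
  h.toIsSolitaryWave.R_half_le (by rw [h.height]; linarith [h.eps_le])

theorem IsHighWave.hasDerivAt_tip (h : IsHighWave m V R σ ε s) (y : ℝ) :
    HasDerivAt (tip R ε s) (tipDeriv V ε s y) y := by
  have hε := h.eps_pos.ne'
  have hs := h.s_pos.ne'
  have h1 : HasDerivAt (fun y : ℝ => y / s) (1 / s) y := (hasDerivAt_id y).div_const s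
  refine ((((h.hasDerivAt_R (y / s)).comp y h1).const_sub (1 - ε)).div_const ε).congr_deriv ?_
  rw [tipDeriv]
  field_simp
  ring

theorem IsHighWave.hasDerivAt_tipDeriv (hm : 1 < m) (h : IsHighWave m V R σ ε s) (y : ℝ) :
    HasDerivAt (tipDeriv V ε s) (ε ^ (m + 1) * (2 * stress m (R (y / s)) -
      stress m (R (y / s - 1)) - stress m (R (y / s + 1)))) y := by
  have hε := h.eps_pos.ne'
  have hs := h.s_pos.ne'
  have hσ := h.wave.speed_pos.ne'
  have h1 : HasDerivAt (fun y : ℝ => y / s) (1 / s) y := (hasDerivAt_id y).div_const s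
  have hscale : ε ^ (m + 1) = 1 / (σ * s ^ 2 * ε) := by
    have := h.scaling
    rw [show m + 2 = m + 1 + 1 by ring, Real.rpow_add_one hε] at this
    field_simp
    linarith
  refine (((((h.hasDerivAt_V hm (y / s - 1 / 2)).comp y (h1.sub_const (1 / 2)))).sub
    ((h.hasDerivAt_V hm (y / s + 1 / 2)).comp y (h1.add_const (1 / 2)))).div_const
      (ε * s)).congr_deriv ?_
  rw [hscale, show y / s - 1 / 2 + 1 / 2 = y / s by ring,
    show y / s - 1 / 2 - 1 / 2 = y / s - 1 by ring,
    show y / s + 1 / 2 + 1 / 2 = y / s + 1 by ring, show y / s + 1 / 2 - 1 / 2 = y / s by ring]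
  field_simp
  ring

theorem IsHighWave.force_tip (h : IsHighWave m V R σ ε s) (y : ℝ) :
    force m (tip R ε s y) = ε ^ (m + 1) * (2 * stress m (R (y / s)) + 2 / (m + 1)) := by
  have hε := h.eps_pos
  have hR := (h.R_range (y / s)).2
  have e1 : 1 + tip R ε s y = (1 - R (y / s)) / ε := by
    unfold tip; field_simp; ring
  rw [stress, force, force, e1, Real.div_rpow (by linarith) hε.le, ← sub_eq_add_neg]
  have := (Real.rpow_pos_of_pos hε (m + 1)).ne'
  have := (Real.rpow_pos_of_pos (sub_pos.2 hR) (m + 1)).ne'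
  field_simp
  ring

theorem IsHighWave.div_mem (h : IsHighWave m V R σ ε s) {y : ℝ} (hy : y ∈ Icc 0 (s / 2)) :
    y / s ∈ Icc (0:ℝ) (1 / 2) := by
  have hs := h.s_pos
  refine ⟨div_nonneg hy.1 hs.le, ?_⟩
  rw [div_le_iff₀ hs]
  linarith [hy.2]

theorem IsHighWave.stress_side_le (hm : 1 < m) (h : IsHighWave m V R σ ε s) {x : ℝ}
    (hx : 1 / 2 ≤ |x|) : stress m (R x) ≤ stress m (3 / 4) := by
  refine stress_mono hm (by norm_num) (le_trans ?_ h.R_half_le)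
  refine h.R_anti_abs ?_
  rwa [abs_of_pos (by norm_num : (0:ℝ) < 1 / 2)]

/-- The rescaled tip is convex because `R(1 ± x) ≤ R(x)` for `0 ≤ x ≤ 1/2`. -/
theorem IsHighWave.tip_convex (hm : 1 < m) (h : IsHighWave m V R σ ε s) {y : ℝ}
    (hy : y ∈ Icc 0 (s / 2)) : 0 ≤ ε ^ (m + 1) * (2 * stress m (R (y / s)) -
      stress m (R (y / s - 1)) - stress m (R (y / s + 1))) := by
  have hx := h.div_mem hy
  have h1 : stress m (R (y / s - 1)) ≤ stress m (R (y / s)) := by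
    refine stress_mono hm (h.R_range _).2 (h.R_anti_abs ?_)
    rw [abs_of_nonneg hx.1, abs_of_nonpos (by linarith [hx.2])]
    linarith [hx.2]
  have h2 : stress m (R (y / s + 1)) ≤ stress m (R (y / s)) := by
    refine stress_mono hm (h.R_range _).2 (h.R_anti_abs ?_)
    rw [abs_of_nonneg hx.1, abs_of_nonneg (by linarith [hx.1])]
    linarith [hx.2]
  exact mul_nonneg (Real.rpow_nonneg h.eps_pos.le _) (by linarith)

theorem IsHighWave.tip_residual (hm : 1 < m) (h : IsHighWave m V R σ ε s) {y : ℝ}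
    (hy : y ∈ Icc 0 (s / 2)) : |ε ^ (m + 1) * (2 * stress m (R (y / s)) -
      stress m (R (y / s - 1)) - stress m (R (y / s + 1))) - force m (tip R ε s y)|
      ≤ residualConst m * ε ^ (m + 1) := by
  have hx := h.div_mem hy
  have h1 : stress m (R (y / s - 1)) ≤ stress m (3 / 4) := by
    refine h.stress_side_le hm ?_
    rw [abs_of_nonpos (by linarith [hx.2])]
    linarith [hx.2]
  have h2 : stress m (R (y / s + 1)) ≤ stress m (3 / 4) := by
    refine h.stress_side_le hm ?_
    rw [abs_of_nonneg (by linarith [hx.1])]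
    linarith [hx.1]
  have h3 := stress_nonneg hm (h.R_range (y / s - 1))
  have h4 := stress_nonneg hm (h.R_range (y / s + 1))
  have hm1 : 2 / (m + 1) ≤ 1 := by rw [div_le_one (by linarith)]; linarith
  have hm0 : 0 ≤ 2 / (m + 1) := div_nonneg (by norm_num) (by linarith)
  have hp := Real.rpow_nonneg h.eps_pos.le (m + 1)
  rw [h.force_tip, ← mul_sub, abs_mul, abs_of_nonneg hp, mul_comm]
  refine mul_le_mul_of_nonneg_right ?_ hp
  unfold residualConst
  rw [abs_le]
  constructor <;> linarith

theorem IsHighWave.continuous_tip (h : IsHighWave m V R σ ε s) : Continuous (tip R ε s) :=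
  continuous_iff_continuousAt.2 fun y => (h.hasDerivAt_tip y).continuousAt

theorem IsHighWave.tip_zero (h : IsHighWave m V R σ ε s) : tip R ε s 0 = 0 := by
  simp [tip, h.height]

theorem IsHighWave.tipDeriv_zero (h : IsHighWave m V R σ ε s) : tipDeriv V ε s 0 = 0 := by
  have := h.V_even (1 / 2)
  simp only [tipDeriv, zero_div, zero_sub, zero_add]
  rw [this, sub_self, zero_div]

theorem IsHighWave.tip_growth (hm : 1 < m) (h : IsHighWave m V R σ ε s)
    (hε : residualConst m * ε ^ (m + 1) ≤ force m 1 / 2) {y : ℝ} (hy : y ∈ Icc 0 (s / 2)) :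
    growthRate m * (1 + y) ≤ 1 + tip R ε s y :=
  growthRate_mul_le hm (fun x _ => h.hasDerivAt_tip x) (fun x _ => h.hasDerivAt_tipDeriv hm x)
    h.tip_zero h.tipDeriv_zero (fun x hx => h.tip_convex hm hx) (fun x hx => by
      have := (abs_le.1 (h.tip_residual hm hx)).1
      linarith) y hy

theorem IsHighWave.tip_stability (hm : 1 < m) (h : IsHighWave m V R σ ε s)
    (hε : residualConst m * ε ^ (m + 1) ≤ force m 1 / 2) {S : ℝ → ℝ} (hS : IsLimitProfile m S)
    {y : ℝ} (hy : y ∈ Icc 0 (s / 2)) :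
    |tipDeriv V ε s y - deriv S y| ≤ stabConst m * (residualConst m * ε ^ (m + 1)) * y ∧
      |tip R ε s y - S y| ≤ stabConst m * (residualConst m * ε ^ (m + 1)) * y ^ 2 :=
  stability hm h.continuous_tip hS.continuous
    (fun x _ => h.hasDerivAt_tip x) (fun x _ => h.hasDerivAt_tipDeriv hm x)
    (fun x _ => hS.hasDerivAt x) (fun x _ => hS.ode' x)
    (by rw [h.tip_zero, hS.init]) (by rw [h.tipDeriv_zero, hS.init_deriv])
    (fun x hx => h.tip_growth hm hε hx) (fun x hx => hS.growth hm hx.1)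
    (fun x hx => h.tip_residual hm hx) (fun x _ => rfl) y hy

end HighWave

/-! ### Uniform estimates for high waves -/

theorem exists_rpow_le {p r : ℝ} (hp : 0 < p) (hr : 0 < r) :
    ∃ ε₀, 0 < ε₀ ∧ ∀ ε, 0 < ε → ε ≤ ε₀ → ε ^ p ≤ r := by
  refine ⟨r ^ (1 / p), Real.rpow_pos_of_pos hr _, fun ε hε hle => ?_⟩
  calc ε ^ p ≤ (r ^ (1 / p)) ^ p := Real.rpow_le_rpow hε.le hle hp.le
    _ = r := by rw [← Real.rpow_mul hr.le]; field_simp; simp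

theorem one_add_half_rpow_neg_le {a ε s p : ℝ} (ha : 0 < a) (hε : 0 < ε) (h : a ≤ ε * s)
    (hp : 0 ≤ p) : (1 + s / 2) ^ (-p) ≤ (a / 2) ^ (-p) * ε ^ p := by
  have h1 : a / 2 / ε ≤ 1 + s / 2 := by
    rw [div_le_iff₀ hε]
    nlinarith
  have h2 : 0 < a / 2 / ε := by positivity
  calc (1 + s / 2) ^ (-p) ≤ (a / 2 / ε) ^ (-p) := Real.rpow_le_rpow_of_nonpos h2 h1 (by linarith)
    _ = _ := by
      rw [Real.div_rpow (by positivity) hε.le, Real.rpow_neg hε.le]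
      field_simp

section Uniform

variable {m : ℝ} {S : ℝ → ℝ}

/-- The tip of a wave of height `1 - ε` has width of order `ε`: the rescaled tip grows linearly
from above and below and reaches a height of order `1/ε` at `y = s/2`. -/
theorem exists_scale_bounds (hm : 1 < m) (hS : IsLimitProfile m S) :
    ∃ a b ε₀, 0 < a ∧ 0 < b ∧ 0 < ε₀ ∧ ∀ V R σ ε s, IsHighWave m V R σ ε s → ε ≤ ε₀ →
      residualConst m * ε ^ (m + 1) ≤ force m 1 / 2 ∧ a ≤ ε * s ∧ ε * s ≤ b := by
  have hg := growthRate_pos hm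
  have hμ := muBar_pos hm
  have hK0 := residualConst_pos hm
  have hK : 0 < stabConst m * residualConst m := mul_pos (stabConst_pos m) hK0
  have hf : 0 < force m 1 := force_pos hm (by norm_num)
  set K := stabConst m * residualConst m with hKdef
  obtain ⟨ε₁, hε₁, h₁⟩ := exists_rpow_le (p := m + 1) (r := force m 1 / 2 / residualConst m)
    (by linarith) (by positivity)
  obtain ⟨ε₂, hε₂, h₂⟩ := exists_rpow_le (p := m) (r := 1 / 10 / (K * (2 / growthRate m) ^ 2))
    (by linarith) (by positivity)
  refine ⟨1 / (5 * muBar m), 4 / growthRate m, min ε₁ ε₂, by positivity, by positivity,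
    lt_min hε₁ hε₂, ?_⟩
  intro V R σ ε s h hle
  have hε := h.eps_pos
  have hs := h.s_pos
  have hres : residualConst m * ε ^ (m + 1) ≤ force m 1 / 2 := by
    have := h₁ ε hε (hle.trans (min_le_left _ _))
    rw [le_div_iff₀ hK0] at this
    linarith
  have hmem : s / 2 ∈ Icc 0 (s / 2) := ⟨by positivity, le_rfl⟩
  have htip : ε * tip R ε s (s / 2) = 1 - ε - R (1 / 2) := by
    unfold tip
    rw [show s / 2 / s = 1 / 2 by field_simp]
    field_simp
  have hup : ε * s ≤ 4 / growthRate m := by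
    have h1 := mul_le_mul_of_nonneg_left (h.tip_growth hm hres hmem) hε.le
    have h2 := (h.R_range (1 / 2)).1
    rw [le_div_iff₀ hg]
    nlinarith [mul_pos hε hg]
  refine ⟨hres, ?_, hup⟩
  have h3 := (abs_le.1 (h.tip_stability hm hres hS hmem).2).2
  have h4 : S (s / 2) ≤ muBar m * (s / 2) := by
    have := hS.le_muBar_mul hm (s / 2)
    rwa [abs_of_pos (by positivity)] at this
  have h5 := h.R_half_le
  have h6 : ε * (K * ε ^ (m + 1) * (s / 2) ^ 2) ≤ 1 / 10 := by
    have h7 := h₂ ε hε (hle.trans (min_le_right _ _))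
    rw [le_div_iff₀ (by positivity)] at h7
    have h8 : (ε * s / 2) ^ 2 ≤ (2 / growthRate m) ^ 2 := by
      apply pow_le_pow_left₀ (by positivity)
      calc ε * s / 2 ≤ 4 / growthRate m / 2 := by gcongr
        _ = _ := by ring
    have hp := Real.rpow_pos_of_pos hε m
    calc ε * (K * ε ^ (m + 1) * (s / 2) ^ 2) = K * ε ^ m * (ε * s / 2) ^ 2 := by
          rw [Real.rpow_add_one hε.ne']; ring
      _ ≤ K * ε ^ m * (2 / growthRate m) ^ 2 := by gcongr
      _ = ε ^ m * (K * (2 / growthRate m) ^ 2) := by ring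
      _ ≤ _ := h7
  have h9 : ε * tip R ε s (s / 2) ≤ ε * (muBar m * (s / 2)) +
      ε * (K * ε ^ (m + 1) * (s / 2) ^ 2) := by
    rw [← mul_add]
    apply mul_le_mul_of_nonneg_left _ hε.le
    rw [hKdef]
    linarith
  have h10 := h.eps_le
  rw [div_le_iff₀ (by positivity)]
  nlinarith

/-- The rescaled tip is close to the limit profile. -/
theorem exists_tip_bounds (hm : 1 < m) (hS : IsLimitProfile m S) :
    ∃ C ε₀, 0 < C ∧ 0 < ε₀ ∧ ∀ V R σ ε s, IsHighWave m V R σ ε s → ε ≤ ε₀ →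
      ∀ y ∈ Icc 0 (s / 2), |tipDeriv V ε s y - deriv S y| ≤ C * ε ^ m ∧
        ε * |tip R ε s y - S y| ≤ C * ε ^ m := by
  obtain ⟨a, b, ε₀, ha, hb, hε₀, H⟩ := exists_scale_bounds hm hS
  have hK : 0 < stabConst m * residualConst m := mul_pos (stabConst_pos m) (residualConst_pos hm)
  refine ⟨stabConst m * residualConst m * (b + b ^ 2), ε₀, by positivity, hε₀, ?_⟩
  intro V R σ ε s h hle y hy
  obtain ⟨hres, -, hup⟩ := H V R σ ε s h hle
  have hε := h.eps_pos
  have hst := h.tip_stability hm hres hS hy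
  have hp := Real.rpow_pos_of_pos hε m
  have hyb : ε * y ≤ b := by
    have := hy.2
    have := h.s_pos
    nlinarith
  have hy0 : 0 ≤ ε * y := mul_nonneg hε.le hy.1
  rw [Real.rpow_add_one hε.ne'] at hst
  constructor
  · calc _ ≤ _ := hst.1
      _ = stabConst m * residualConst m * (ε * y) * ε ^ m := by ring
      _ ≤ stabConst m * residualConst m * (b + b ^ 2) * ε ^ m := by gcongr; nlinarith
  · calc _ ≤ ε * _ := mul_le_mul_of_nonneg_left hst.2 hε.le
      _ = stabConst m * residualConst m * (ε * y) ^ 2 * ε ^ m := by ring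
      _ ≤ stabConst m * residualConst m * (b + b ^ 2) * ε ^ m := by
        gcongr
        have := pow_le_pow_left₀ hy0 hyb 2
        linarith

/-- Iterating `V x ≤ θ V (x - 1)` with `θ ≤ 1/e` gives exponential decay with rate one. -/
theorem exp_decay_of_le_mul_sub_one {V : ℝ → ℝ} {θ : ℝ} (hθ0 : 0 ≤ θ) (hθ : θ ≤ Real.exp (-1))
    (hV0 : ∀ x, 0 ≤ x → V x ≤ V 0) (hV : ∀ x, 0 ≤ V x)
    (hrec : ∀ x, 1 ≤ x → V x ≤ θ * V (x - 1)) :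
    ∀ x, 1 ≤ x → V x ≤ θ * V 0 * Real.exp (2 - x) := by
  have key : ∀ n : ℕ, ∀ x : ℝ, 1 ≤ x → x ≤ n + 2 → V x ≤ θ * V 0 * Real.exp (2 - x) := by
    intro n
    have hbase : ∀ x : ℝ, 1 ≤ x → x ≤ 2 → V x ≤ θ * V 0 * Real.exp (2 - x) := by
      intro x h1 h2
      have h3 : V x ≤ θ * V 0 := (hrec x h1).trans
        (mul_le_mul_of_nonneg_left (hV0 _ (by linarith)) hθ0)
      exact h3.trans (le_mul_of_one_le_right (mul_nonneg hθ0 (hV 0))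
        (Real.one_le_exp (by linarith)))
    induction n with
    | zero => intro x h1 h2; exact hbase x h1 (by simpa using h2)
    | succ n ih =>
      intro x h1 h2
      rcases le_total x 2 with hx | hx
      · exact hbase x h1 hx
      · push_cast at h2
        have h3 := ih (x - 1) (by linarith) (by linarith)
        calc V x ≤ θ * V (x - 1) := hrec x h1
          _ ≤ Real.exp (-1) * (θ * V 0 * Real.exp (2 - (x - 1))) := by
            gcongr
            exact hV _
          _ = θ * V 0 * (Real.exp (-1) * Real.exp (2 - (x - 1))) := by ring
          _ = _ := by rw [← Real.exp_add]; ring_nf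
  intro x hx
  exact key ⌈x⌉₊ x hx (by linarith [Nat.le_ceil x])

/-- The tails of the wave are of order `ε^m` and decay exponentially. -/
theorem exists_tail_bounds (hm : 1 < m) (hS : IsLimitProfile m S) :
    ∃ C ε₀, 0 < C ∧ 0 < ε₀ ∧ ∀ V R σ ε s, IsHighWave m V R σ ε s → ε ≤ ε₀ →
      1 / σ ≤ C * ε ^ m ∧ ∀ x, 1 ≤ x → V x ≤ C * ε ^ m * Real.exp (-x) := by
  obtain ⟨a, b, ε₀, ha, hb, hε₀, H⟩ := exists_scale_bounds hm hS
  obtain ⟨C₁, ε₁, hC₁, hε₁, H₁⟩ := exists_tip_bounds hm hS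
  have hμ := muBar_pos hm
  set D := 1 / (1 / 4 : ℝ) ^ (m + 2) with hD
  have hDpos : 0 < D := one_div_pos.2 (Real.rpow_pos_of_pos (by norm_num) _)
  have hexp := Real.exp_pos (-1)
  obtain ⟨ε₂, hε₂, h₂⟩ := exists_rpow_le (p := m) (r := Real.exp (-1) / (D * b ^ 2))
    (by linarith) (by positivity)
  obtain ⟨ε₃, hε₃, h₃⟩ := exists_rpow_le (p := m) (r := 1 / C₁) (by linarith) (by positivity)
  set B := 2 * (b * (muBar m + 1)) with hB
  have hBpos : 0 < B := by positivity
  refine ⟨b ^ 2 + D * b ^ 2 * B * Real.exp 2, min (min ε₀ ε₁) (min ε₂ ε₃), by positivity,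
    by positivity, ?_⟩
  intro V R σ ε s h hle
  simp only [le_min_iff] at hle
  obtain ⟨hres, hlow, hup⟩ := H V R σ ε s h hle.1.1
  have hε := h.eps_pos
  have hs := h.s_pos
  have hσ := h.wave.speed_pos
  have hp := Real.rpow_pos_of_pos hε m
  have hσinv : 1 / σ ≤ b ^ 2 * ε ^ m := by
    have e : 1 / σ = (ε * s) ^ 2 * ε ^ m := by
      have := h.scaling
      rw [Real.rpow_add hε, Real.rpow_two] at this
      field_simp
      linarith
    rw [e]
    gcongr
  set θ := D * b ^ 2 * ε ^ m with hθ
  have hθ0 : 0 ≤ θ := by positivity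
  have hθ1 : θ ≤ Real.exp (-1) := by
    have := h₂ ε hε hle.2.1
    rw [le_div_iff₀ (by positivity)] at this
    rw [hθ]; linarith
  have hrec : ∀ x, 1 ≤ x → V x ≤ θ * V (x - 1) := by
    intro x hx
    have h1 := h.V_le_stress hm (x := x) (by linarith)
    have h2 : R (x - 1 / 2) ≤ 1 - 1 / 4 := by
      have := h.R_anti (x := 1 / 2) (y := x - 1 / 2) (by norm_num) (by linarith)
      linarith [h.R_half_le]
    have h3 := stress_le_mul hm (by norm_num) (h.R_range (x - 1 / 2)).1 h2
    have h4 := h.R_le_V (x := x - 1 / 2) (by linarith)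
    rw [show x - 1 / 2 - 1 / 2 = x - 1 by ring] at h4
    have h5 : σ * V x ≤ D * V (x - 1) := h1.trans (h3.trans (by gcongr))
    have hVn := h.V_nonneg (x - 1)
    calc V x = 1 / σ * (σ * V x) := by field_simp
      _ ≤ 1 / σ * (D * V (x - 1)) := by gcongr
      _ ≤ b ^ 2 * ε ^ m * (D * V (x - 1)) := by gcongr
      _ = θ * V (x - 1) := by rw [hθ]; ring
  have hexp1 : Real.exp (-1) ≤ 1 / 2 := by
    have := Real.exp_neg_one_lt_half
    linarith
  have hV0 : V 0 ≤ B := by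
    have h1 := hrec 1 le_rfl
    rw [sub_self] at h1
    have hVn := h.V_nonneg 0
    have hmem : s / 2 ∈ Icc 0 (s / 2) := ⟨by positivity, le_rfl⟩
    have h2 := (abs_le.1 (H₁ V R σ ε s h hle.1.2 _ hmem).1).2
    have h3 := h₃ ε hε hle.2.2
    rw [le_div_iff₀ hC₁] at h3
    have h4 := (abs_le.1 (hS.abs_deriv_le hm (s / 2))).2
    have h5 : tipDeriv V ε s (s / 2) ≤ muBar m + 1 := by linarith
    unfold tipDeriv at h5
    rw [show s / 2 / s = 1 / 2 by field_simp, div_le_iff₀ (by positivity)] at h5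
    norm_num at h5
    have h6 : (muBar m + 1) * (ε * s) ≤ (muBar m + 1) * b := by gcongr
    have h7 : θ * V 0 ≤ 1 / 2 * V 0 := by gcongr; exact hθ1.trans hexp1
    rw [hB]
    linarith
  refine ⟨hσinv.trans ?_, fun x hx => ?_⟩
  · gcongr
    have : 0 ≤ D * b ^ 2 * B * Real.exp 2 := by positivity
    linarith
  · have h1 := exp_decay_of_le_mul_sub_one (V := V) hθ0 hθ1 (fun x hx => h.V_anti le_rfl hx) h.V_nonneg
      hrec x hx
    calc V x ≤ θ * V 0 * Real.exp (2 - x) := h1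
      _ ≤ θ * B * Real.exp (2 - x) := by gcongr
      _ = D * b ^ 2 * B * Real.exp 2 * ε ^ m * Real.exp (-x) := by
        rw [sub_eq_add_neg, Real.exp_add, hθ]; ring
      _ ≤ _ := by
        gcongr
        have : 0 ≤ b ^ 2 := by positivity
        linarith

/-- The transition layers: after rescaling, `V` near `±1/2` is the transition profile. The sum
`V(x+1/2) + V(x-1/2)` is almost constant since its derivative only involves the stress away from
the tip, while the difference is the slope of the tip. -/
theorem exists_transition_bounds (hm : 1 < m) (hS : IsLimitProfile m S) :
    ∃ C ε₀, 0 < C ∧ 0 < ε₀ ∧ ∀ V R σ ε s, IsHighWave m V R σ ε s → ε ≤ ε₀ →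
      ∀ x, |x| ≤ 1 / 2 → |V (1 / 2 - x) - ε * s * transitionProfile m S (s * x)| ≤ C * ε ^ m := by
  obtain ⟨a, b, ε₀, ha, hb, hε₀, H⟩ := exists_scale_bounds hm hS
  obtain ⟨C₁, ε₁, hC₁, hε₁, H₁⟩ := exists_tip_bounds hm hS
  obtain ⟨C₂, ε₂, hC₂, hε₂, H₂⟩ := exists_tail_bounds hm hS
  have hμ := muBar_pos hm
  have hst : 0 ≤ stress m (3 / 4) := stress_nonneg hm ⟨by norm_num, by norm_num⟩
  set D := muBar m * decayConst m * (a / 2) ^ (-m) with hD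
  have hDpos : 0 < D := by
    have := decayConst_pos hm
    have := Real.rpow_pos_of_pos (half_pos ha) (-m)
    positivity
  refine ⟨C₂ * stress m (3 / 4) + 2 * C₂ + b * (C₁ + D) + b * C₁, min ε₀ (min ε₁ ε₂),
    by positivity, by positivity, ?_⟩
  intro V R σ ε s h hle
  simp only [le_min_iff] at hle
  obtain ⟨hres, hlow, hup⟩ := H V R σ ε s h hle.1
  obtain ⟨hσinv, htail⟩ := H₂ V R σ ε s h hle.2.2
  have H₁ := H₁ V R σ ε s h hle.2.1
  have hε := h.eps_pos
  have hs := h.s_pos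
  have hεs : 0 < ε * s := mul_pos hε hs
  have hσ := h.wave.speed_pos
  have hp := Real.rpow_pos_of_pos hε m
  have hV1 : V 1 ≤ C₂ * ε ^ m := by
    refine (htail 1 le_rfl).trans (mul_le_of_le_one_right (by positivity) ?_)
    exact Real.exp_le_one_iff.2 (by norm_num)
  have hdiff : ∀ x, V (x - 1 / 2) - V (x + 1 / 2) = ε * s * tipDeriv V ε s (s * x) := fun x => by
    unfold tipDeriv
    rw [mul_div_cancel_left₀ _ hs.ne']
    field_simp
  -- the sum of the two shifted velocities at the matching point `x = 1/2`
  have hhalf : |V (1 / 2 + 1 / 2) + V (1 / 2 - 1 / 2) - ε * s * muBar m| ≤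
      (2 * C₂ + b * (C₁ + D)) * ε ^ m := by
    have hmem : s / 2 ∈ Icc 0 (s / 2) := ⟨by positivity, le_rfl⟩
    have h1 := hdiff (1 / 2)
    have h2 := (H₁ _ hmem).1
    rw [show s * (1 / 2) = s / 2 by ring] at h1
    have h3 : |deriv S (s / 2) - muBar m| ≤ D * ε ^ m := by
      rw [abs_sub_comm, abs_of_nonneg (sub_nonneg.2 (abs_le.1 (hS.abs_deriv_le hm _)).2)]
      refine (hS.muBar_sub_deriv_le hm hmem.1).trans ?_
      have := one_add_half_rpow_neg_le ha hε hlow (by linarith : 0 ≤ m)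
      have hdc := decayConst_pos hm
      rw [hD, mul_assoc (muBar m * decayConst m)]
      gcongr
    have hVn := h.V_nonneg 1
    have e : V (1 / 2 + 1 / 2) + V (1 / 2 - 1 / 2) - ε * s * muBar m = 2 * V 1 +
        ε * s * ((tipDeriv V ε s (s / 2) - deriv S (s / 2)) + (deriv S (s / 2) - muBar m)) := by
      rw [sub_add_sub_cancel, mul_sub, ← h1]
      norm_num
      ring
    rw [e]
    calc _ ≤ |2 * V 1| + |ε * s * ((tipDeriv V ε s (s / 2) - deriv S (s / 2)) +
            (deriv S (s / 2) - muBar m))| := abs_add_le _ _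
      _ = 2 * V 1 + ε * s * |(tipDeriv V ε s (s / 2) - deriv S (s / 2)) +
            (deriv S (s / 2) - muBar m)| := by
          rw [abs_mul (ε * s), abs_of_pos hεs, abs_of_nonneg (by positivity : 0 ≤ 2 * V 1)]
      _ ≤ 2 * (C₂ * ε ^ m) + b * (C₁ * ε ^ m + D * ε ^ m) := by
          gcongr
          exact (abs_add_le _ _).trans (add_le_add h2 h3)
      _ = _ := by ring
  have hsum : ∀ x ∈ Icc (0:ℝ) (1 / 2), |V (x + 1 / 2) + V (x - 1 / 2) - ε * s * muBar m| ≤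
      (C₂ * stress m (3 / 4) + 2 * C₂ + b * (C₁ + D)) * ε ^ m := by
    intro x hx
    have hd : ∀ y ∈ Icc x (1 / 2), HasDerivAt (fun y => V (y + 1 / 2) + V (y - 1 / 2))
        ((stress m (R (y + 1)) - stress m (R (y - 1))) / σ) y := fun y _ => by
      refine (((h.hasDerivAt_V hm (y + 1 / 2)).comp_add_const y (1 / 2)).add
        ((h.hasDerivAt_V hm (y - 1 / 2)).comp_sub_const y (1 / 2))).congr_deriv ?_
      rw [show y - 1 / 2 + 1 / 2 = y by ring, show y - 1 / 2 - 1 / 2 = y - 1 by ring,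
        show y + 1 / 2 + 1 / 2 = y + 1 by ring, show y + 1 / 2 - 1 / 2 = y by ring]
      ring
    have hb := abs_sub_le_mul_of_hasDerivAt (C := stress m (3 / 4) * (C₂ * ε ^ m)) hx.2 hd
      (fun y hy => by
        have h1 := stress_nonneg hm (h.R_range (y + 1))
        have h2 := stress_nonneg hm (h.R_range (y - 1))
        have h3 : stress m (R (y + 1)) ≤ stress m (3 / 4) := h.stress_side_le hm (by
          rw [abs_of_nonneg (by linarith [hx.1, hy.1])]; linarith [hx.1, hy.1])
        have h4 : stress m (R (y - 1)) ≤ stress m (3 / 4) := h.stress_side_le hm (by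
          rw [abs_of_nonpos (by linarith [hy.2])]; linarith [hy.2])
        rw [div_eq_mul_one_div, abs_mul, abs_of_pos (by positivity : 0 < 1 / σ)]
        gcongr
        rw [abs_le]
        constructor <;> linarith)
    have hb' : |V (1 / 2 + 1 / 2) + V (1 / 2 - 1 / 2) - (V (x + 1 / 2) + V (x - 1 / 2))| ≤
        C₂ * stress m (3 / 4) * ε ^ m := by
      refine hb.trans ?_
      calc _ ≤ stress m (3 / 4) * (C₂ * ε ^ m) * 1 := by gcongr; linarith [hx.1]
        _ = _ := by ring
    calc _ = |(V (1 / 2 + 1 / 2) + V (1 / 2 - 1 / 2) - ε * s * muBar m) -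
            (V (1 / 2 + 1 / 2) + V (1 / 2 - 1 / 2) - (V (x + 1 / 2) + V (x - 1 / 2)))| := by
          congr 1; ring
      _ ≤ _ := (abs_sub _ _).trans (add_le_add hhalf hb')
      _ = _ := by ring
  have hdif : ∀ x ∈ Icc (0:ℝ) (1 / 2),
      |V (x - 1 / 2) - V (x + 1 / 2) - ε * s * deriv S (s * x)| ≤ b * C₁ * ε ^ m := by
    intro x hx
    have h1 := (H₁ (s * x) ⟨mul_nonneg hs.le hx.1, by nlinarith [hx.2]⟩).1
    rw [hdiff, ← mul_sub, abs_mul, abs_of_pos hεs, mul_assoc b]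
    gcongr
  intro x hx
  have hN : 0 ≤ (C₂ * stress m (3 / 4) + 2 * C₂ + b * (C₁ + D) + b * C₁) * ε ^ m := by positivity
  unfold transitionProfile
  rcases le_total 0 x with hx0 | hx0
  · rw [abs_of_nonneg hx0] at hx
    have h1 := hsum x ⟨hx0, hx⟩
    have h2 := hdif x ⟨hx0, hx⟩
    have h3 : V (1 / 2 - x) = V (x - 1 / 2) := by rw [← h.V_even, neg_sub]
    rw [h3]
    rw [abs_le] at h1 h2 ⊢
    constructor <;> linarith [h1.1, h1.2, h2.1, h2.2]
  · rw [abs_of_nonpos hx0] at hx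
    have h1 := hsum (-x) ⟨by linarith, hx⟩
    have h2 := hdif (-x) ⟨by linarith, hx⟩
    have h3 : V (-x + 1 / 2) = V (1 / 2 - x) := by rw [neg_add_eq_sub]
    rw [mul_neg, hS.deriv_odd hm, h3] at h2
    rw [h3] at h1
    rw [abs_le] at h1 h2 ⊢
    constructor <;> linarith [h1.1, h1.2, h2.1, h2.2]

theorem hasDerivAt_footProfile (hS : IsLimitProfile m S) (y : ℝ) :
    HasDerivAt (footProfile m S) (transitionProfile m S y) y := by
  refine (((((hS.hasDerivAt y).add ((hasDerivAt_id y).const_mul (muBar m))).add_const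
    (kappaBar S))).const_mul (1 / 2)).congr_deriv ?_
  simp [transitionProfile]

/-- At the feet `1/2 ≤ |x| ≤ 3/2` the distance profile is an integrated transition layer, and
matching with the tip at `x = 1/2` determines the scaling parameter `s`. -/
theorem exists_foot_bounds (hm : 1 < m) (hS : IsLimitProfile m S) :
    ∃ C ε₀, 0 < C ∧ 0 < ε₀ ∧ ∀ V R σ ε s, IsHighWave m V R σ ε s → ε ≤ ε₀ →
      (∀ x ∈ Icc (1 / 2 : ℝ) (3 / 2), |R x - ε * footProfile m S (s * (1 - x))| ≤ C * ε ^ m) ∧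
      |ε * s * muBar m - (1 + ε * (kappaBar S - 1))| ≤ C * ε ^ m := by
  obtain ⟨a, b, ε₀, ha, hb, hε₀, H⟩ := exists_scale_bounds hm hS
  obtain ⟨C₁, ε₁, hC₁, hε₁, H₁⟩ := exists_tip_bounds hm hS
  obtain ⟨C₂, ε₂, hC₂, hε₂, H₂⟩ := exists_tail_bounds hm hS
  obtain ⟨C₃, ε₃, hC₃, hε₃, H₃⟩ := exists_transition_bounds hm hS
  obtain ⟨C₄, hC₄, H₄⟩ := hS.exists_asymptote hm
  set D := C₄ * (a / 2) ^ (-(m - 1)) with hD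
  have hDpos : 0 < D := mul_pos hC₄ (Real.rpow_pos_of_pos (half_pos ha) _)
  refine ⟨C₁ + 2 * C₂ + C₃ + 3 * D, min (min ε₀ ε₁) (min ε₂ ε₃), by positivity, by positivity, ?_⟩
  intro V R σ ε s h hle
  simp only [le_min_iff] at hle
  obtain ⟨hres, hlow, hup⟩ := H V R σ ε s h hle.1.1
  obtain ⟨hσinv, htail⟩ := H₂ V R σ ε s h hle.2.1
  have H₁ := H₁ V R σ ε s h hle.1.2
  have H₃ := H₃ V R σ ε s h hle.2.2
  have hε := h.eps_pos
  have hs := h.s_pos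
  have hp := Real.rpow_pos_of_pos hε m
  have hmem : s / 2 ∈ Icc 0 (s / 2) := ⟨by positivity, le_rfl⟩
  have hV : ∀ x, 1 ≤ x → V x ≤ C₂ * ε ^ m := fun x hx => by
    refine (htail x hx).trans (mul_le_of_le_one_right (by positivity) ?_)
    exact Real.exp_le_one_iff.2 (by linarith)
  have hasym : |ε * (muBar m * (s / 2) - S (s / 2) - kappaBar S)| ≤ D * ε ^ m := by
    rw [abs_mul, abs_of_pos hε]
    have h1 := H₄ _ hmem.1
    have h2 := one_add_half_rpow_neg_le ha hε hlow (by linarith : 0 ≤ m - 1)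
    rw [neg_sub] at h2
    calc _ ≤ ε * (C₄ * (1 + s / 2) ^ (1 - m)) := by gcongr
      _ ≤ ε * (C₄ * ((a / 2) ^ (1 - m) * ε ^ (m - 1))) := by gcongr
      _ = _ := by
        rw [hD, neg_sub, Real.rpow_sub_one hε.ne']
        field_simp
  have hR3 : |R (3 / 2)| ≤ C₂ * ε ^ m := by
    rw [abs_of_nonneg (h.R_range _).1]
    refine (h.R_le_V (by norm_num)).trans (hV _ (by norm_num))
  have hfoot : ∀ x ∈ Icc (1 / 2 : ℝ) (3 / 2),
      |R x - ε * footProfile m S (s * (1 - x))| ≤ (2 * C₂ + C₃ + D) * ε ^ m := by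
    intro x hx
    have hd : ∀ y ∈ Icc x (3 / 2), HasDerivAt (fun x => R x - ε * footProfile m S (s * (1 - x)))
        (V (y + 1 / 2) - (V (y - 1 / 2) - ε * s * transitionProfile m S (s * (1 - y)))) y := by
      intro y _
      have hin : HasDerivAt (fun x : ℝ => s * (1 - x)) (-s) y := by
        simpa using ((hasDerivAt_id y).const_sub 1).const_mul s
      refine ((h.hasDerivAt_R y).sub
        (((hasDerivAt_footProfile hS (s * (1 - y))).comp y hin).const_mul ε)).congr_deriv ?_
      ring
    have hb := abs_sub_le_mul_of_hasDerivAt (C := (C₂ + C₃) * ε ^ m) hx.2 hd (fun y hy => by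
      have h1 := hV (y + 1 / 2) (by linarith [hx.1, hy.1])
      have h2 := H₃ (1 - y) (abs_le.2 ⟨by linarith [hy.2], by linarith [hx.1, hy.1]⟩)
      rw [show 1 / 2 - (1 - y) = y - 1 / 2 by ring] at h2
      calc _ ≤ |V (y + 1 / 2)| + _ := abs_sub _ _
        _ ≤ C₂ * ε ^ m + C₃ * ε ^ m := by
          gcongr
          rwa [abs_of_nonneg (h.V_nonneg _)]
        _ = _ := by ring)
    have hb' : (C₂ + C₃) * ε ^ m * (3 / 2 - x) ≤ (C₂ + C₃) * ε ^ m :=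
      mul_le_of_le_one_right (by positivity) (by linarith [hx.1])
    have hend : |R (3 / 2) - ε * footProfile m S (s * (1 - 3 / 2))| ≤ (C₂ + D) * ε ^ m := by
      have e : ε * footProfile m S (s * (1 - 3 / 2)) =
          -(1 / 2 * (ε * (muBar m * (s / 2) - S (s / 2) - kappaBar S))) := by
        rw [show s * (1 - 3 / 2) = -(s / 2) by ring, footProfile, hS.even hm]
        ring
      rw [e]
      calc _ ≤ _ := abs_sub _ _
        _ ≤ C₂ * ε ^ m + 1 / 2 * (D * ε ^ m) := by
          rw [abs_neg, abs_mul, abs_of_pos (by norm_num : (0:ℝ) < 1 / 2)]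
          gcongr
        _ ≤ _ := by
          have : 0 < D * ε ^ m := by positivity
          linarith
    have := hb.trans hb'
    rw [abs_le] at this hend ⊢
    constructor <;> linarith [this.1, this.2, hend.1, hend.2]
  refine ⟨fun x hx => (hfoot x hx).trans ?_, ?_⟩
  · gcongr ?_ * _
    linarith
  · have h1 := hfoot (1 / 2) ⟨le_rfl, by norm_num⟩
    have h2 := (H₁ _ hmem).2
    rw [← abs_of_pos hε, ← abs_mul, abs_of_pos hε] at h2
    have e1 : ε * (tip R ε s (s / 2) - S (s / 2)) = 1 - ε - R (1 / 2) - ε * S (s / 2) := by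
      unfold tip
      rw [show s / 2 / s = 1 / 2 by field_simp]
      field_simp
    rw [e1] at h2
    have e2 : ε * footProfile m S (s * (1 - 1 / 2)) =
        1 / 2 * (ε * S (s / 2) + ε * (muBar m * (s / 2)) + ε * kappaBar S) := by
      rw [show s * (1 - 1 / 2) = s / 2 by ring, footProfile]
      ring
    rw [e2] at h1
    have e3 : ε * (muBar m * (s / 2) - S (s / 2) - kappaBar S) =
        ε * (muBar m * (s / 2)) - ε * S (s / 2) - ε * kappaBar S := by ring
    rw [e3] at hasym
    have e4 : ε * s * muBar m - (1 + ε * (kappaBar S - 1)) =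
        2 * (ε * (muBar m * (s / 2))) - 1 - ε * kappaBar S + ε := by ring
    rw [e4]
    rw [abs_le] at h1 h2 hasym ⊢
    constructor <;> linarith [h1.1, h1.2, h2.1, h2.2, hasym.1, hasym.2,
      (by positivity : 0 < D * ε ^ m)]

/-! ### Profiles with free parameters -/

/-- The distance profile with independent parameters: amplitude defect `ε` and inverse tip
width `s`. -/
noncomputable def distanceProfile (m : ℝ) (S : ℝ → ℝ) (ε s x : ℝ) : ℝ :=
  if |x| < 1 / 2 then 1 - ε - ε * S (s * |x|)
  else if |x| < 3 / 2 then ε * footProfile m S (s * (1 - |x|))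
  else 0

/-- The velocity profile with independent parameters `ε` and `s`. -/
noncomputable def velocityProfile (m : ℝ) (S : ℝ → ℝ) (ε s x : ℝ) : ℝ :=
  ε * s * (if |x| < 1 then transitionProfile m S (s * (1 / 2 - |x|)) else 0)

/-- On the support of the explicit profiles the weight `exp (-|x|)` is bounded below, so there
uniform bounds are weighted bounds. -/
theorem one_le_mul_exp_neg {x : ℝ} (hx : |x| ≤ 2) : 1 ≤ Real.exp 2 * Real.exp (-|x|) := by
  rw [← Real.exp_add]
  exact Real.one_le_exp (by linarith)

/-- Uniform approximation of a high wave by the explicit profiles with its own parameters. -/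
theorem exists_wave_approximation (hm : 1 < m) (hS : IsLimitProfile m S) :
    ∃ C ε₀, 0 < C ∧ 0 < ε₀ ∧ ∀ V R σ ε s, IsHighWave m V R σ ε s → ε ≤ ε₀ →
      (∀ x, |distanceProfile m S ε s x - R x| ≤ C * ε ^ m * Real.exp (-|x|)) ∧
      (∀ x, |velocityProfile m S ε s x - V x| ≤ C * ε ^ m * Real.exp (-|x|)) ∧
      |ε * s * muBar m - (1 + ε * (kappaBar S - 1))| ≤ C * ε ^ m := by
  obtain ⟨C₁, ε₁, hC₁, hε₁, H₁⟩ := exists_tip_bounds hm hS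
  obtain ⟨C₂, ε₂, hC₂, hε₂, H₂⟩ := exists_tail_bounds hm hS
  obtain ⟨C₃, ε₃, hC₃, hε₃, H₃⟩ := exists_transition_bounds hm hS
  obtain ⟨C₄, ε₄, hC₄, hε₄, H₄⟩ := exists_foot_bounds hm hS
  have hexp : 1 ≤ Real.exp 2 := Real.one_le_exp (by norm_num)
  refine ⟨(C₁ + C₂ + C₃ + C₄) * Real.exp 2, min (min ε₁ ε₂) (min ε₃ ε₄), by positivity,
    by positivity, ?_⟩
  intro V R σ ε s h hle
  simp only [le_min_iff] at hle
  have H₁ := H₁ V R σ ε s h hle.1.1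
  obtain ⟨-, htail⟩ := H₂ V R σ ε s h hle.1.2
  have H₃ := H₃ V R σ ε s h hle.2.1
  obtain ⟨hfoot, hscale⟩ := H₄ V R σ ε s h hle.2.2
  have hε := h.eps_pos
  have hs := h.s_pos
  have hp := Real.rpow_pos_of_pos hε m
  have core : ∀ {c t x : ℝ}, |x| ≤ 2 → |t| ≤ c * ε ^ m → 0 ≤ c → c ≤ C₁ + C₂ + C₃ + C₄ →
      |t| ≤ (C₁ + C₂ + C₃ + C₄) * Real.exp 2 * ε ^ m * Real.exp (-|x|) := by
    intro c t x hx ht hc0 hc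
    calc |t| ≤ c * ε ^ m := ht
      _ ≤ c * ε ^ m * (Real.exp 2 * Real.exp (-|x|)) :=
        le_mul_of_one_le_right (by positivity) (one_le_mul_exp_neg hx)
      _ ≤ (C₁ + C₂ + C₃ + C₄) * ε ^ m * (Real.exp 2 * Real.exp (-|x|)) := by gcongr
      _ = _ := by ring
  refine ⟨fun x => ?_, fun x => ?_, hscale.trans ?_⟩
  · rw [← h.R_abs x]
    unfold distanceProfile
    split_ifs with h1 h2
    · refine core (by linarith) ?_ hC₁.le (by linarith)
      have h3 := (H₁ (s * |x|) ⟨by positivity, by nlinarith [abs_nonneg x]⟩).2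
      rw [← abs_of_pos hε, ← abs_mul, abs_of_pos hε] at h3
      have e : 1 - ε - ε * S (s * |x|) - R |x| = ε * (tip R ε s (s * |x|) - S (s * |x|)) := by
        unfold tip
        rw [mul_div_cancel_left₀ _ hs.ne']
        field_simp
        ring
      rwa [e]
    · refine core (by linarith) ?_ hC₄.le (by linarith)
      rw [abs_sub_comm]
      exact hfoot |x| ⟨not_lt.1 h1, h2.le⟩
    · rw [zero_sub, abs_neg, abs_of_nonneg (h.R_range _).1]
      rw [not_lt] at h2
      calc R |x| ≤ V (|x| - 1 / 2) := h.R_le_V (by linarith)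
        _ ≤ C₂ * ε ^ m * Real.exp (-(|x| - 1 / 2)) := htail _ (by linarith)
        _ = C₂ * (Real.exp (1 / 2)) * ε ^ m * Real.exp (-|x|) := by
          rw [show -(|x| - 1 / 2) = 1 / 2 + -|x| by ring, Real.exp_add]; ring
        _ ≤ _ := by
          gcongr
          · linarith
          · norm_num
  · rw [← h.V_abs x]
    unfold velocityProfile
    split_ifs with h1
    · refine core (by linarith) ?_ hC₃.le (by linarith)
      have h2 := H₃ (1 / 2 - |x|) (abs_le.2 ⟨by linarith, by linarith [abs_nonneg x]⟩)
      rw [abs_sub_comm]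
      rwa [sub_sub_cancel] at h2
    · rw [mul_zero, zero_sub, abs_neg, abs_of_nonneg (h.V_nonneg _)]
      refine (htail _ (not_lt.1 h1)).trans ?_
      gcongr
      calc C₂ ≤ C₁ + C₂ + C₃ + C₄ := by linarith
        _ ≤ _ := le_mul_of_one_le_right (by positivity) hexp
  · gcongr
    calc C₄ ≤ C₁ + C₂ + C₃ + C₄ := by linarith
      _ ≤ _ := le_mul_of_one_le_right (by positivity) hexp

end Uniform

/-! ### The exponential weight -/

theorem integrable_exp_neg_mul_abs {r : ℝ} (hr : 0 < r) :
    Integrable (fun x : ℝ => Real.exp (-r * |x|)) := by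
  rw [← integrableOn_univ, ← Iic_union_Ioi (a := (0:ℝ))]
  refine IntegrableOn.union ?_ ?_
  · refine (integrableOn_exp_mul_Iic hr 0).congr_fun (fun x hx => ?_) measurableSet_Iic
    simp only
    rw [abs_of_nonpos hx, neg_mul_neg]
  · refine (exp_neg_integrableOn_Ioi 0 hr).congr_fun (fun x hx => ?_) measurableSet_Ioi
    simp only
    rw [abs_of_pos hx]

theorem memLp_exp_neg_abs {q : ℝ≥0∞} (hq : 1 ≤ q) :
    MemLp (fun x : ℝ => Real.exp (-|x|)) q volume := by
  have hc : Continuous fun x : ℝ => Real.exp (-|x|) := by fun_prop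
  rcases eq_or_ne q ∞ with rfl | hq'
  · refine memLp_top_of_bound hc.aestronglyMeasurable 1 (.of_forall fun x => ?_)
    rw [Real.norm_eq_abs, Real.abs_exp]
    exact Real.exp_le_one_iff.2 (by simp)
  · have h0 : q ≠ 0 := (zero_lt_one.trans_le hq).ne'
    rw [← integrable_norm_rpow_iff hc.aestronglyMeasurable h0 hq']
    have : 0 < q.toReal := ENNReal.toReal_pos h0 hq'
    refine (integrable_exp_neg_mul_abs this).congr (.of_forall fun x => ?_)
    simp only [Real.norm_eq_abs, Real.abs_exp]
    rw [← Real.exp_mul]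
    ring_nf

theorem eLpNorm_le_of_abs_le_exp {f : ℝ → ℝ} {a : ℝ} (q : ℝ≥0∞)
    (h : ∀ x, |f x| ≤ a * Real.exp (-|x|)) :
    eLpNorm f q volume ≤ ENNReal.ofReal a *
      eLpNorm (fun x : ℝ => Real.exp (-|x|)) q volume :=
  eLpNorm_le_mul_eLpNorm_of_ae_le_mul (.of_forall fun x => by
    rw [Real.norm_eq_abs, Real.norm_eq_abs, Real.abs_exp]
    exact h x) q

/-! ### Dependence of the profiles on the parameters -/

theorem abs_sub_le_of_abs_deriv_le {f f' : ℝ → ℝ} {C : ℝ} (hf : ∀ x, HasDerivAt f (f' x) x)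
    (h : ∀ x, |f' x| ≤ C) (x y : ℝ) : |f x - f y| ≤ C * |x - y| := by
  rcases le_total y x with hxy | hxy
  · rw [abs_of_nonneg (sub_nonneg.2 hxy)]
    exact abs_sub_le_mul_of_hasDerivAt hxy (fun x _ => hf x) (fun x _ => h x)
  · rw [abs_sub_comm, abs_sub_comm x, abs_of_nonneg (sub_nonneg.2 hxy)]
    exact abs_sub_le_mul_of_hasDerivAt hxy (fun x _ => hf x) (fun x _ => h x)

section Parameters

variable {m : ℝ} {S : ℝ → ℝ}

theorem abs_transitionProfile_le (hm : 1 < m) (hS : IsLimitProfile m S) (y : ℝ) :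
    |transitionProfile m S y| ≤ muBar m := by
  have := abs_le.1 (hS.abs_deriv_le hm y)
  unfold transitionProfile
  rw [abs_le]
  constructor <;> linarith [this.1, this.2]

/-- Since `y S''(y)` is bounded, the transition profile is Lipschitz with respect to the
logarithm of the scaling factor. -/
theorem abs_transitionProfile_scale_sub_le (hm : 1 < m) (hS : IsLimitProfile m S) {s t : ℝ}
    (hs : 0 < s) (hst : s ≤ t) (z : ℝ) :
    |transitionProfile m S (t * z) - transitionProfile m S (s * z)| ≤
      1 / growthRate m / s * (t - s) := by
  have hg := growthRate_pos hm
  refine abs_sub_le_mul_of_hasDerivAt (f := fun r => transitionProfile m S (r * z))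
    (f' := fun r => 1 / 2 * (force m (S (r * z)) * z)) hst (fun r _ => ?_) (fun r hr => ?_)
  · have h1 : HasDerivAt (fun r : ℝ => r * z) z r := by simpa using (hasDerivAt_id r).mul_const z
    exact (((hS.ode' (r * z)).comp r h1).add_const (muBar m)).const_mul (1 / 2)
  · have hr0 : 0 < r := hs.trans_le hr.1
    have h1 := hS.abs_mul_force_le hm (r * z)
    have hf := force_pos hm (hS.pos (r * z))
    rw [abs_mul, abs_of_pos hr0] at h1
    rw [abs_mul, abs_mul, abs_of_pos hf, abs_of_pos (by norm_num : (0:ℝ) < 1 / 2)]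
    have h2 : force m (S (r * z)) * |z| ≤ 1 / growthRate m / r := by
      rw [le_div_iff₀ hr0]
      linarith
    have h3 : 1 / growthRate m / r ≤ 1 / growthRate m / s := by
      gcongr
      exact hr.1
    have h4 : 0 ≤ force m (S (r * z)) * |z| := by positivity
    linarith

/-- The velocity profiles are Lipschitz in the parameters. The bound `s₂ ≤ 108 * s₁`, with a generous
numerical factor, only says that the scaling parameters are comparable. -/
theorem exists_velocityProfile_lipschitz (hm : 1 < m) (hS : IsLimitProfile m S) :
    ∃ C, 0 < C ∧ ∀ ε₁ s₁ ε₂ s₂, 0 < ε₁ → 0 < s₁ → 0 < ε₂ → 0 < s₂ → s₂ ≤ 108 * s₁ →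
      ∀ x, |velocityProfile m S ε₁ s₁ x - velocityProfile m S ε₂ s₂ x| ≤
        C * (|ε₁ - ε₂| * s₁ + ε₂ * |s₁ - s₂|) * Real.exp (-|x|) := by
  have hg := growthRate_pos hm
  have hμ := muBar_pos hm
  refine ⟨(muBar m + 108 * (1 / growthRate m)) * Real.exp 2, by positivity, ?_⟩
  intro ε₁ s₁ ε₂ s₂ hε₁ hs₁ hε₂ hs₂ h12 x
  have hE : 0 ≤ |ε₁ - ε₂| * s₁ + ε₂ * |s₁ - s₂| := by positivity
  unfold velocityProfile
  split_ifs with hx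
  · set z := 1 / 2 - |x|
    have hW : s₂ * |transitionProfile m S (s₁ * z) - transitionProfile m S (s₂ * z)| ≤
        108 * (1 / growthRate m) * |s₁ - s₂| := by
      rcases le_total s₁ s₂ with h | h
      · have := abs_transitionProfile_scale_sub_le hm hS hs₁ h z
        rw [abs_sub_comm, abs_sub_comm s₁, abs_of_nonneg (sub_nonneg.2 h)]
        calc _ ≤ 108 * s₁ * (1 / growthRate m / s₁ * (s₂ - s₁)) := by
              gcongr
          _ = _ := by field_simp
      · have := abs_transitionProfile_scale_sub_le hm hS hs₂ h z
        rw [abs_of_nonneg (sub_nonneg.2 h)]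
        have h0 : 0 ≤ 1 / growthRate m * (s₁ - s₂) :=
          mul_nonneg (by positivity) (sub_nonneg.2 h)
        calc _ ≤ s₂ * (1 / growthRate m / s₂ * (s₁ - s₂)) := by gcongr
          _ = 1 / growthRate m * (s₁ - s₂) := by field_simp
          _ ≤ _ := by linarith
    have hW1 := abs_transitionProfile_le hm hS (s₁ * z)
    have e : ε₁ * s₁ * transitionProfile m S (s₁ * z) - ε₂ * s₂ * transitionProfile m S (s₂ * z) =
        ((ε₁ - ε₂) * s₁ + ε₂ * (s₁ - s₂)) * transitionProfile m S (s₁ * z) +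
        ε₂ * (s₂ * (transitionProfile m S (s₁ * z) - transitionProfile m S (s₂ * z))) := by ring
    rw [e]
    calc _ ≤ _ := abs_add_le _ _
      _ ≤ (|ε₁ - ε₂| * s₁ + ε₂ * |s₁ - s₂|) * muBar m +
          ε₂ * (108 * (1 / growthRate m) * |s₁ - s₂|) := by
        apply add_le_add
        · rw [abs_mul]
          gcongr
          refine (abs_add_le _ _).trans ?_
          rw [abs_mul, abs_mul, abs_of_pos hs₁, abs_of_pos hε₂]
        · rw [abs_mul, abs_of_pos hε₂, abs_mul, abs_of_pos hs₂]
          gcongr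
      _ ≤ (muBar m + 108 * (1 / growthRate m)) * (|ε₁ - ε₂| * s₁ + ε₂ * |s₁ - s₂|) := by
        have : 0 ≤ 108 * (1 / growthRate m) * (|ε₁ - ε₂| * s₁) := by positivity
        linarith
      _ ≤ (muBar m + 108 * (1 / growthRate m)) * (|ε₁ - ε₂| * s₁ + ε₂ * |s₁ - s₂|) *
          (Real.exp 2 * Real.exp (-|x|)) :=
        le_mul_of_one_le_right (by positivity) (one_le_mul_exp_neg (by linarith))
      _ = _ := by ring
  · simp only [mul_zero, sub_self, abs_zero]
    positivity

theorem abs_footProfile_le (hm : 1 < m) (hS : IsLimitProfile m S) (y : ℝ) :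
    |footProfile m S y| ≤ muBar m * |y| + |kappaBar S| := by
  have h1 := hS.le_muBar_mul hm y
  have h2 := hS.nonneg hm y
  have h3 : |muBar m * y| = muBar m * |y| := by rw [abs_mul, abs_of_pos (muBar_pos hm)]
  have h4 := abs_le.1 h3.le
  have h5 := neg_abs_le (kappaBar S)
  have h6 := le_abs_self (kappaBar S)
  unfold footProfile
  rw [abs_le]
  constructor <;> linarith [h4.1, h4.2]

theorem exists_distanceProfile_lipschitz (hm : 1 < m) (hS : IsLimitProfile m S) :
    ∃ C, 0 < C ∧ ∀ ε₁ s₁ ε₂ s₂, 0 < ε₁ → 1 ≤ s₁ → 0 < ε₂ → 0 < s₂ →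
      ∀ x, |distanceProfile m S ε₁ s₁ x - distanceProfile m S ε₂ s₂ x| ≤
        C * (|ε₁ - ε₂| * s₁ + ε₂ * |s₁ - s₂|) * Real.exp (-|x|) := by
  have hμ := muBar_pos hm
  refine ⟨(1 + muBar m + |kappaBar S|) * Real.exp 2, by positivity, ?_⟩
  intro ε₁ s₁ ε₂ s₂ hε₁ hs₁ hε₂ hs₂ x
  have hE : 0 ≤ |ε₁ - ε₂| * s₁ + ε₂ * |s₁ - s₂| := by positivity
  have hs₁0 : 0 < s₁ := by linarith
  have core : ∀ t, |x| ≤ 2 →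
      |t| ≤ (1 + muBar m + |kappaBar S|) * (|ε₁ - ε₂| * s₁ + ε₂ * |s₁ - s₂|) →
      |t| ≤ (1 + muBar m + |kappaBar S|) * Real.exp 2 *
        (|ε₁ - ε₂| * s₁ + ε₂ * |s₁ - s₂|) * Real.exp (-|x|) := by
    intro t hx ht
    calc |t| ≤ _ := ht
      _ ≤ (1 + muBar m + |kappaBar S|) * (|ε₁ - ε₂| * s₁ + ε₂ * |s₁ - s₂|) *
        (Real.exp 2 * Real.exp (-|x|)) :=
        le_mul_of_one_le_right (by positivity) (one_le_mul_exp_neg hx)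
      _ = _ := by ring
  have hmul : ∀ z : ℝ, |z| ≤ 1 / 2 → |s₁ * z| ≤ s₁ ∧ |s₁ * z - s₂ * z| ≤ |s₁ - s₂| := by
    intro z hz
    constructor
    · rw [abs_mul, abs_of_pos hs₁0]
      exact mul_le_of_le_one_right hs₁0.le (by linarith)
    · rw [← sub_mul, abs_mul]
      exact mul_le_of_le_one_right (abs_nonneg _) (by linarith)
  have hd0 : |ε₁ - ε₂| ≤ |ε₁ - ε₂| * s₁ := le_mul_of_one_le_right (abs_nonneg _) hs₁
  have hκ := abs_nonneg (kappaBar S)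
  unfold distanceProfile
  split_ifs with h1 h2
  · apply core _ (by linarith)
    obtain ⟨ha, hb⟩ := hmul |x| (by rw [abs_abs]; exact h1.le)
    have hL := abs_sub_le_of_abs_deriv_le hS.hasDerivAt (hS.abs_deriv_le hm) (s₁ * |x|) (s₂ * |x|)
    have hL' : |S (s₁ * |x|) - S (s₂ * |x|)| ≤ muBar m * |s₁ - s₂| := hL.trans (by gcongr)
    have hS1 : |1 + S (s₁ * |x|)| ≤ 1 + muBar m * s₁ := by
      rw [abs_of_pos (hS.pos _)]
      have := hS.le_muBar_mul hm (s₁ * |x|)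
      have := mul_le_mul_of_nonneg_left ha hμ.le
      linarith
    have e : 1 - ε₁ - ε₁ * S (s₁ * |x|) - (1 - ε₂ - ε₂ * S (s₂ * |x|)) =
      -((ε₁ - ε₂) * (1 + S (s₁ * |x|)) + ε₂ * (S (s₁ * |x|) - S (s₂ * |x|))) := by ring
    rw [e, abs_neg]
    calc _ ≤ _ := abs_add_le _ _
      _ ≤ |ε₁ - ε₂| * (1 + muBar m * s₁) + ε₂ * (muBar m * |s₁ - s₂|) := by
        rw [abs_mul, abs_mul, abs_of_pos hε₂]
        gcongr
      _ ≤ _ := by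
        have : 0 ≤ |kappaBar S| * (|ε₁ - ε₂| * s₁ + ε₂ * |s₁ - s₂|) := by positivity
        have : 0 ≤ ε₂ * |s₁ - s₂| := by positivity
        linarith
  · apply core _ (by linarith)
    rw [not_lt] at h1
    set z := 1 - |x| with hz
    obtain ⟨ha, hb⟩ := hmul z (abs_le.2 ⟨by linarith, by linarith⟩)
    have hL := abs_sub_le_of_abs_deriv_le (hasDerivAt_footProfile hS)
      (abs_transitionProfile_le hm hS) (s₁ * z) (s₂ * z)
    have hL' : |footProfile m S (s₁ * z) - footProfile m S (s₂ * z)| ≤ muBar m * |s₁ - s₂| :=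
      hL.trans (by gcongr)
    have hT : |footProfile m S (s₁ * z)| ≤ muBar m * s₁ + |kappaBar S| * s₁ := by
      refine (abs_footProfile_le hm hS _).trans ?_
      have : |kappaBar S| ≤ |kappaBar S| * s₁ := le_mul_of_one_le_right hκ hs₁
      have : muBar m * |s₁ * z| ≤ muBar m * s₁ := by gcongr
      linarith
    have e : ε₁ * footProfile m S (s₁ * z) - ε₂ * footProfile m S (s₂ * z) =
      (ε₁ - ε₂) * footProfile m S (s₁ * z) +
        ε₂ * (footProfile m S (s₁ * z) - footProfile m S (s₂ * z)) := by ring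
    rw [e]
    calc _ ≤ _ := abs_add_le _ _
      _ ≤ |ε₁ - ε₂| * (muBar m * s₁ + |kappaBar S| * s₁) + ε₂ * (muBar m * |s₁ - s₂|) := by
        rw [abs_mul, abs_mul, abs_of_pos hε₂]
        gcongr
      _ ≤ _ := by
        have : 0 ≤ |kappaBar S| * (ε₂ * |s₁ - s₂|) := by positivity
        have : 0 ≤ ε₂ * |s₁ - s₂| := by positivity
        have : 0 ≤ |ε₁ - ε₂| * s₁ := by positivity
        linarith
  · simp only [sub_self, abs_zero]
    positivity

/-! ### The norm of the approximate velocity profile -/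

theorem measurable_velocityProfile (hS : IsLimitProfile m S) (ε s : ℝ) :
    Measurable (velocityProfile m S ε s) := by
  have hd := hS.continuous_deriv
  unfold velocityProfile transitionProfile
  refine Measurable.const_mul (Measurable.ite ?_ ?_ measurable_const) _
  · exact measurableSet_lt continuous_abs.measurable measurable_const
  · exact (by fun_prop : Continuous fun x : ℝ =>
      1 / 2 * (deriv S (s * (1 / 2 - |x|)) + muBar m)).measurable

theorem memLp_velocityProfile (hm : 1 < m) (hS : IsLimitProfile m S) {ε s : ℝ} (hε : 0 < ε)
    (hs : 0 < s) : MemLp (velocityProfile m S ε s) 2 volume := by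
  have hμ := muBar_pos hm
  refine (memLp_exp_neg_abs (q := 2) (by norm_num)).of_le_mul (c := ε * s * muBar m * Real.exp 2)
    (measurable_velocityProfile hS ε s).aestronglyMeasurable (.of_forall fun x => ?_)
  rw [Real.norm_eq_abs, Real.norm_eq_abs, Real.abs_exp]
  unfold velocityProfile
  split_ifs with hx
  · rw [abs_mul, abs_of_pos (mul_pos hε hs), mul_assoc (ε * s * muBar m)]
    calc _ ≤ ε * s * muBar m := by
          gcongr
          exact abs_transitionProfile_le hm hS _
      _ ≤ _ := le_mul_of_one_le_right (by positivity) (one_le_mul_exp_neg (by linarith))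
  · simp only [mul_zero, abs_zero]
    positivity

/-- By the oddness of `S'`, the `L²` norm of the velocity profile only involves the kinetic
deficit. -/
theorem norm2_velocityProfile_sq (hm : 1 < m) (hS : IsLimitProfile m S) {ε s : ℝ} (hε : 0 < ε)
    (hs : 0 < s) : norm2 (velocityProfile m S ε s) ^ 2 =
      (ε * s * muBar m) ^ 2 - 2 * ε * (ε * s) * kineticDeficit m S (s / 2) := by
  rw [norm2_sq (memLp_velocityProfile hm hS hε hs)]
  set f : ℝ → ℝ := fun r => (ε * s) ^ 2 * (transitionProfile m S (s * (1 / 2 - r))) ^ 2 with hf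
  have e1 : ∀ x, velocityProfile m S ε s x ^ 2 = (Iio (1:ℝ)).indicator f |x| := fun x => by
    unfold velocityProfile
    split_ifs with hx
    · rw [indicator_of_mem (show |x| ∈ Iio (1:ℝ) from hx)]
      simp only [hf]
      ring
    · rw [indicator_of_notMem (show |x| ∉ Iio (1:ℝ) from hx)]
      simp
  simp only [e1]
  rw [integral_comp_abs (f := (Iio (1:ℝ)).indicator f),
    setIntegral_indicator measurableSet_Iio, Ioi_inter_Iio, ← integral_Ioc_eq_integral_Ioo,
    ← intervalIntegral.integral_of_le zero_le_one]
  -- an antiderivative of the squared transition profile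
  set B : ℝ → ℝ := fun y =>
    (muBar m ^ 2 * y + muBar m * S y - kineticDeficit m S y) / 2 with hB
  have hBd : ∀ y, HasDerivAt B (transitionProfile m S y ^ 2) y := fun y => by
    refine (((((hasDerivAt_id y).const_mul (muBar m ^ 2)).add
      ((hS.hasDerivAt y).const_mul (muBar m))).sub
      (hS.hasDerivAt_kineticDeficit (m := m) y)).div_const 2).congr_deriv ?_
    unfold transitionProfile
    ring
  have hd : ∀ r, HasDerivAt (fun r => -(ε ^ 2 * s) * B (s * (1 / 2 - r))) (f r) r := fun r => by
    have hin : HasDerivAt (fun r : ℝ => s * (1 / 2 - r)) (-s) r :=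
      (((hasDerivAt_id r).const_sub (1 / 2)).const_mul s).congr_deriv (by simp)
    refine (((hBd (s * (1 / 2 - r))).comp r hin).const_mul (-(ε ^ 2 * s))).congr_deriv ?_
    simp only [hf]
    ring
  have hfc : Continuous f := by
    have := hS.continuous_deriv
    simp only [hf, transitionProfile]
    fun_prop
  rw [intervalIntegral.integral_eq_sub_of_hasDerivAt (fun r _ => hd r)
    (hfc.intervalIntegrable _ _)]
  rw [show s * (1 / 2 - 1) = -(s / 2) by ring, show s * (1 / 2 - 0) = s / 2 by ring]
  simp only [hB, hS.even hm, hS.kineticDeficit_neg hm]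
  ring

end Parameters

/-! ### The explicit approximation -/

section Hat

variable {m : ℝ} {S : ℝ → ℝ}

theorem RHat_eq (m : ℝ) (S : ℝ → ℝ) (ε : ℝ) :
    RHat m S ε = distanceProfile m S ε (1 / muHat m S ε) := by
  funext x
  simp only [RHat, distanceProfile, one_div_mul_eq_div]

theorem VHat_eq (m : ℝ) (S : ℝ → ℝ) (ε : ℝ) :
    VHat m S ε = velocityProfile m S ε (1 / muHat m S ε) := by
  funext x
  simp only [VHat, velocityProfile, one_div_mul_eq_div, mul_one_div]

theorem exists_hat_scale_bounds (hm : 1 < m) (S : ℝ → ℝ) :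
    ∃ ε₀, 0 < ε₀ ∧ ∀ ε, 0 < ε → ε ≤ ε₀ →
      ε * (1 / muHat m S ε) * muBar m = 1 + ε * (kappaBar S - 1) ∧
      |ε * (kappaBar S - 1)| ≤ 1 / 2 ∧ 0 < muHat m S ε ∧ 1 ≤ 1 / muHat m S ε := by
  have hμ := muBar_pos hm
  set k := kappaBar S - 1 with hk
  refine ⟨min (1 / (2 * (|k| + 1))) (1 / (2 * muBar m)), by positivity, ?_⟩
  intro ε hε hle
  have h1 := hle.trans (min_le_left _ _)
  have h2 := hle.trans (min_le_right _ _)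
  rw [le_div_iff₀ (by positivity)] at h1 h2
  have hεk : |ε * k| ≤ 1 / 2 := by
    rw [abs_mul, abs_of_pos hε]
    nlinarith
  have hpos : 1 / 2 ≤ 1 + ε * k := by linarith [(abs_le.1 hεk).1]
  have hhat : muHat m S ε = muBar m * ε / (1 + ε * k) := rfl
  have hhat0 : 0 < muHat m S ε := by rw [hhat]; positivity
  refine ⟨?_, hεk, hhat0, ?_⟩
  · rw [hhat]; field_simp
  · rw [one_le_div hhat0, hhat, div_le_one (by linarith)]
    linarith

/-- The squared norm of the approximate velocity profile is a quadratic polynomial up to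
`O(ε^m)`. -/
theorem exists_norm2_VHat_expansion (hm : 1 < m) (hS : IsLimitProfile m S) :
    ∃ a b C ε₀, 0 < a ∧ 0 < C ∧ 0 < ε₀ ∧ ∀ ε, 0 < ε → ε ≤ ε₀ →
      |norm2 (VHat m S ε) ^ 2 - (1 - 2 * a * ε + b * ε ^ 2)| ≤ C * ε ^ m := by
  have hμ := muBar_pos hm
  obtain ⟨A, C₁, hC₁, hA, hpos⟩ := hS.exists_kineticDeficit_limit hm
  obtain ⟨ε₀, hε₀, H⟩ := exists_hat_scale_bounds hm S
  set k := kappaBar S - 1 with hk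
  refine ⟨A / muBar m - k, k ^ 2 - 2 * k * A / muBar m,
    3 / muBar m * (C₁ * (1 / (2 * muBar m) / 2) ^ (-(m - 1))), ε₀, by rw [hk]; linarith,
    by positivity, hε₀, ?_⟩
  intro ε hε hle
  obtain ⟨h1, h2, h3, h4⟩ := H ε hε hle
  have hs : 0 < 1 / muHat m S ε := by linarith
  set s := 1 / muHat m S ε with hsdef
  have hεs : ε * s = (1 + ε * k) / muBar m := by rw [← h1]; field_simp
  rw [VHat_eq, norm2_velocityProfile_sq hm hS hε hs, h1, hεs]
  have e : (1 + ε * k) ^ 2 - 2 * ε * ((1 + ε * k) / muBar m) * kineticDeficit m S (s / 2) -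
      (1 - 2 * (A / muBar m - k) * ε + (k ^ 2 - 2 * k * A / muBar m) * ε ^ 2) =
      -(2 * ε * ((1 + ε * k) / muBar m) * (kineticDeficit m S (s / 2) - A)) := by
    field_simp
    ring
  rw [e, abs_neg, abs_mul]
  have hk1 := abs_le.1 h2
  have hlow : 1 / (2 * muBar m) ≤ ε * s := by
    rw [hεs, div_le_div_iff₀ (by positivity) hμ]
    nlinarith [hk1.1]
  have hrate := one_add_half_rpow_neg_le (by positivity : 0 < 1 / (2 * muBar m)) hε hlow
    (by linarith : 0 ≤ m - 1)
  have hdef := hA (s / 2) (by positivity)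
  rw [show 1 - m = -(m - 1) by ring] at hdef
  have hc : |2 * ε * ((1 + ε * k) / muBar m)| ≤ 3 / muBar m * ε := by
    rw [abs_of_nonneg (by have : 0 ≤ 1 + ε * k := by linarith [hk1.1]
                          positivity)]
    calc 2 * ε * ((1 + ε * k) / muBar m) ≤ 2 * ε * ((3 / 2) / muBar m) := by
          gcongr; linarith [hk1.2]
      _ = _ := by ring
  calc _ ≤ 3 / muBar m * ε * (C₁ * ((1 / (2 * muBar m) / 2) ^ (-(m - 1)) * ε ^ (m - 1))) := by
        gcongr
        exact hdef.trans (by gcongr)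
    _ = 3 / muBar m * (C₁ * (1 / (2 * muBar m) / 2) ^ (-(m - 1))) * (ε ^ (m - 1) * ε) := by ring
    _ = _ := by rw [← Real.rpow_add_one hε.ne', sub_add_cancel]

theorem tendsto_rpow_nhdsGT_zero {p : ℝ} (hp : 0 < p) :
    Tendsto (fun ε : ℝ => ε ^ p) (𝓝[>] 0) (𝓝 0) := by
  have := (Real.continuousAt_rpow_const 0 p (Or.inr hp.le)).tendsto
  rw [Real.zero_rpow hp.ne'] at this
  exact this.mono_left nhdsWithin_le_nhds

theorem eventually_nhdsGT_zero_le {ε₀ : ℝ} (h : 0 < ε₀) :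
    ∀ᶠ ε in 𝓝[>] (0:ℝ), 0 < ε ∧ ε ≤ ε₀ := by
  filter_upwards [Ioc_mem_nhdsGT h] with ε hε using hε

theorem exists_tendsto_deltaHat_div (hm : 1 < m) (hS : IsLimitProfile m S) :
    ∃ a, 0 < a ∧ Tendsto (fun ε => deltaHat m S ε / ε) (𝓝[>] 0) (𝓝 a) := by
  obtain ⟨a, b, C, ε₀, ha, hC, hε₀, H⟩ := exists_norm2_VHat_expansion hm hS
  refine ⟨a, ha, ?_⟩
  set N : ℝ → ℝ := fun ε => norm2 (VHat m S ε) ^ 2 with hN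
  have hid : Tendsto (fun ε : ℝ => ε) (𝓝[>] 0) (𝓝 0) := tendsto_id.mono_left nhdsWithin_le_nhds
  have hquot : Tendsto (fun ε => (1 - N ε) / ε) (𝓝[>] 0) (𝓝 (2 * a)) := by
    have hlin : Tendsto (fun ε : ℝ => 2 * a - b * ε) (𝓝[>] 0) (𝓝 (2 * a - b * 0)) :=
      (hid.const_mul b).const_sub (2 * a)
    rw [mul_zero, sub_zero] at hlin
    have hrem : Tendsto (fun ε => (1 - N ε) / ε - (2 * a - b * ε)) (𝓝[>] 0) (𝓝 0) := by
      have h0 := (tendsto_rpow_nhdsGT_zero (show 0 < m - 1 by linarith)).const_mul C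
      rw [mul_zero] at h0
      refine squeeze_zero_norm' ?_ h0
      filter_upwards [eventually_nhdsGT_zero_le hε₀] with ε hε
      have h1 := H ε hε.1 hε.2
      have e : (1 - N ε) / ε - (2 * a - b * ε) = -((N ε - (1 - 2 * a * ε + b * ε ^ 2)) / ε) := by
        have := hε.1.ne'
        field_simp
        ring
      rw [e, norm_neg, Real.norm_eq_abs, abs_div, abs_of_pos hε.1, Real.rpow_sub_one hε.1.ne',
        ← mul_div_assoc]
      exact div_le_div_of_nonneg_right h1 hε.1.le
    have := hrem.add hlin
    simpa using this
  have hN1 : Tendsto N (𝓝[>] 0) (𝓝 1) := by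
    have h1 := (hquot.mul hid).const_sub 1
    rw [mul_zero, sub_zero] at h1
    refine h1.congr' ?_
    filter_upwards [self_mem_nhdsWithin] with ε hε
    rw [div_mul_cancel₀ _ (ne_of_gt hε)]
    ring
  have hv : Tendsto (fun ε => norm2 (VHat m S ε)) (𝓝[>] 0) (𝓝 1) := by
    have := hN1.sqrt
    rw [Real.sqrt_one] at this
    refine this.congr fun ε => Real.sqrt_sq ENNReal.toReal_nonneg
  have hden : Tendsto (fun ε => 1 + norm2 (VHat m S ε)) (𝓝[>] 0) (𝓝 (1 + 1)) := hv.const_add 1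
  have hfin := hquot.div hden (by norm_num)
  rw [show 2 * a / (1 + 1) = a by ring] at hfin
  refine hfin.congr fun ε => ?_
  have h0 : 0 ≤ norm2 (VHat m S ε) := ENNReal.toReal_nonneg
  have h1 : 1 + norm2 (VHat m S ε) ≠ 0 := by positivity
  simp only [Pi.div_apply, hN, deltaHat]
  rw [div_div, mul_comm, ← div_div]
  congr 1
  rw [div_eq_iff h1]
  ring

theorem eventually_deltaHat_mem (hm : 1 < m) (hS : IsLimitProfile m S) :
    ∀ᶠ ε in 𝓝[>] (0 : ℝ), deltaHat m S ε ∈ Ioo (0 : ℝ) 1 := by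
  obtain ⟨a, ha, h⟩ := exists_tendsto_deltaHat_div hm hS
  have h1 := h.eventually (lt_mem_nhds ha)
  have h2 := h.eventually (gt_mem_nhds (show a < 2 * a by linarith))
  filter_upwards [h1, h2, eventually_nhdsGT_zero_le (show 0 < 1 / (4 * a) by positivity)]
    with ε h1 h2 hε
  obtain ⟨hε0, hε1⟩ := hε
  rw [div_lt_iff₀ hε0] at h2
  rw [lt_div_iff₀ hε0] at h1
  rw [le_div_iff₀ (by positivity)] at hε1
  constructor <;> nlinarith

theorem tendsto_deltaHat (hm : 1 < m) (hS : IsLimitProfile m S) :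
    Tendsto (deltaHat m S) (𝓝[>] 0) (𝓝[>] 0) := by
  obtain ⟨a, ha, h⟩ := exists_tendsto_deltaHat_div hm hS
  refine tendsto_nhdsWithin_iff.2 ⟨?_, ?_⟩
  · have hid : Tendsto (fun ε : ℝ => ε) (𝓝[>] 0) (𝓝 0) :=
      tendsto_id.mono_left nhdsWithin_le_nhds
    have h1 := h.mul hid
    rw [mul_zero] at h1
    refine h1.congr' ?_
    filter_upwards [self_mem_nhdsWithin] with ε hε
    rw [div_mul_cancel₀ _ (ne_of_gt hε)]
  · filter_upwards [eventually_deltaHat_mem hm hS] with ε hε using hε.1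

/-! ### Comparison of a wave with the approximation of equal norm -/

theorem abs_norm2_sub_le {f g : ℝ → ℝ} (hf : MemLp f 2 volume) (hg : MemLp g 2 volume) {a : ℝ}
    (ha : 0 ≤ a) (h : ∀ x, |f x - g x| ≤ a * Real.exp (-|x|)) :
    |norm2 f - norm2 g| ≤ a * norm2 (fun x => Real.exp (-|x|)) := by
  have hG := memLp_exp_neg_abs (q := 2) (by norm_num)
  have key : ∀ {f g : ℝ → ℝ}, MemLp f 2 volume → MemLp g 2 volume →
      (∀ x, |f x - g x| ≤ a * Real.exp (-|x|)) →
      norm2 f ≤ norm2 g + a * norm2 (fun x => Real.exp (-|x|)) := by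
    intro f g hf hg h
    have h1 : eLpNorm f 2 volume ≤ eLpNorm g 2 volume + ENNReal.ofReal a *
        eLpNorm (fun x : ℝ => Real.exp (-|x|)) 2 volume := by
      have h2 := eLpNorm_add_le hg.aestronglyMeasurable (hf.sub hg).aestronglyMeasurable
        (p := 2) (by norm_num)
      rw [add_sub_cancel] at h2
      exact h2.trans (add_le_add le_rfl (eLpNorm_le_of_abs_le_exp 2 h))
    have hfin : ENNReal.ofReal a * eLpNorm (fun x : ℝ => Real.exp (-|x|)) 2 volume ≠ ∞ :=
      ENNReal.mul_ne_top ENNReal.ofReal_ne_top hG.eLpNorm_ne_top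
    have h3 := ENNReal.toReal_mono (ENNReal.add_ne_top.2 ⟨hg.eLpNorm_ne_top, hfin⟩) h1
    rw [ENNReal.toReal_add hg.eLpNorm_ne_top hfin, ENNReal.toReal_mul,
      ENNReal.toReal_ofReal ha] at h3
    exact h3
  rw [abs_le]
  constructor
  · have := key hg hf fun x => by rw [abs_sub_comm]; exact h x
    linarith
  · have := key hf hg h
    linarith

/-- If the scaling parameter of a high wave is known up to `O(ε^m)`, it is comparable with that
of the explicit approximation. -/
theorem scale_diff_le (hm : 1 < m) {η s t C k : ℝ} (hη : 0 < η)
    (hs : |η * s * muBar m - (1 + η * k)| ≤ C * η ^ m) (ht : η * t * muBar m = 1 + η * k) :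
    η * |t - s| ≤ C / muBar m * η ^ m := by
  have hμ := muBar_pos hm
  rw [← ht, ← sub_mul, ← mul_sub, abs_mul, abs_mul, abs_of_pos hη, abs_of_pos hμ,
    abs_sub_comm] at hs
  rw [div_mul_eq_mul_div, le_div_iff₀ hμ]
  exact hs

/-- The velocity norm of a high wave agrees up to `O(η^m)` with that of the explicit approximation
for the same amplitude defect `η`. -/
theorem exists_norm2_comparison (hm : 1 < m) (hS : IsLimitProfile m S) :
    ∃ C ε₀, 0 < C ∧ 0 < ε₀ ∧ ∀ V R σ η s, IsHighWave m V R σ η s → η ≤ ε₀ →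
      s ≤ 12 * (1 / muHat m S η) ∧ |norm2 (VHat m S η) - norm2 V| ≤ C * η ^ m := by
  have hμ := muBar_pos hm
  obtain ⟨C₂, ε₂, hC₂, hε₂, H₂⟩ := exists_wave_approximation hm hS
  obtain ⟨C₃, hC₃, H₃⟩ := exists_velocityProfile_lipschitz hm hS
  obtain ⟨ε₄, hε₄, H₄⟩ := exists_hat_scale_bounds hm S
  obtain ⟨ε₅, hε₅, H₅⟩ := exists_rpow_le (p := m) (r := 1 / (2 * C₂)) (by linarith) (by positivity)
  set M := norm2 (fun x : ℝ => Real.exp (-|x|)) with hM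
  have hM0 : 0 ≤ M := ENNReal.toReal_nonneg
  refine ⟨(C₃ * (C₂ / muBar m) + C₂) * M + 1, min ε₂ (min ε₄ ε₅), by positivity,
    by positivity, ?_⟩
  intro V R σ η s h hηle
  simp only [le_min_iff] at hηle
  obtain ⟨hη2, hη4, hη5⟩ := hηle
  have hη := h.eps_pos
  have hs := h.s_pos
  have hpη := Real.rpow_pos_of_pos hη m
  obtain ⟨-, hVapp, hsc⟩ := H₂ V R σ η s h hη2
  obtain ⟨ht, hk, hhat, ht1⟩ := H₄ η hη hη4
  set t := 1 / muHat m S η with htdef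
  have ht0 : 0 < t := by linarith
  have hC2 : C₂ * η ^ m ≤ 1 / 2 := by
    have := H₅ η hη hη5
    rw [le_div_iff₀ (by positivity)] at this
    linarith
  have hst := scale_diff_le hm hη hsc ht
  have hs12 : s ≤ 12 * t := by
    have h1 := (abs_le.1 hsc).2
    have h2 := (abs_le.1 hk).1
    have h3 := (abs_le.1 hk).2
    have h4 : η * s * muBar m ≤ 12 * (η * t * muBar m) := by rw [ht]; linarith
    have h5 : η * muBar m * s ≤ η * muBar m * (12 * t) := by linarith
    exact le_of_mul_le_mul_left h5 (by positivity)
  refine ⟨hs12, ?_⟩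
  have hpt : ∀ x, |VHat m S η x - V x| ≤
      ((C₃ * (C₂ / muBar m) + C₂) * η ^ m) * Real.exp (-|x|) := by
    intro x
    have h1 := H₃ η t η s hη ht0 hη hs (by linarith) x
    rw [sub_self, abs_zero, zero_mul, zero_add, ← VHat_eq] at h1
    have h3 : C₃ * (η * |t - s|) * Real.exp (-|x|) ≤
        C₃ * (C₂ / muBar m * η ^ m) * Real.exp (-|x|) := by gcongr
    calc _ ≤ _ := abs_sub_le _ (velocityProfile m S η s x) _
      _ ≤ C₃ * (C₂ / muBar m * η ^ m) * Real.exp (-|x|) + C₂ * η ^ m * Real.exp (-|x|) :=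
        add_le_add (h1.trans h3) (hVapp x)
      _ = _ := by ring
  have hVmem : MemLp (VHat m S η) 2 volume := by
    rw [VHat_eq]; exact memLp_velocityProfile hm hS hη ht0
  refine (abs_norm2_sub_le hVmem h.V_memLp (by positivity) hpt).trans ?_
  rw [← hM]
  linarith

/-- A high wave and an explicit approximation with the same velocity norm have almost the same
amplitude, because the norm of the approximation depends on its parameter with nonzero slope. -/
theorem exists_amplitude_comparison (hm : 1 < m) (hS : IsLimitProfile m S) :
    ∃ C ε₀, 0 < C ∧ 0 < ε₀ ∧ ∀ V R σ η s ε, IsHighWave m V R σ η s →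
      norm2 V = norm2 (VHat m S ε) → η ≤ ε₀ → 0 < ε → ε ≤ ε₀ →
      |ε - η| ≤ C * ε ^ m ∧ η ≤ 3 * ε ∧ ε ≤ 3 * η := by
  have hm1 : 0 < m - 1 := by linarith
  obtain ⟨a, b, C₁, ε₁, ha, hC₁, hε₁, H₁⟩ := exists_norm2_VHat_expansion hm hS
  obtain ⟨D, ε₂, hDpos, hε₂, H₂⟩ := exists_norm2_comparison hm hS
  obtain ⟨ε₅, hε₅, H₅⟩ := exists_rpow_le (p := m) (r := 1 / D) (by linarith) (by positivity)
  obtain ⟨E, hE⟩ : ∃ E, E = (3 * D + 2 * C₁) / a := ⟨_, rfl⟩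
  have hEpos : 0 < E := hE ▸ by positivity
  obtain ⟨ε₆, hε₆, H₆⟩ := exists_rpow_le (p := m - 1) (r := 1 / (2 * E)) hm1 (by positivity)
  refine ⟨E * (3 ^ m + 1), min (min ε₁ (min ε₂ ε₅)) (min ε₆ (a / (2 * (|b| + 1)))),
    by positivity, by positivity, ?_⟩
  intro V R σ η s ε h hnorm hηle hε hεle
  simp only [le_min_iff] at hηle hεle
  obtain ⟨⟨hη1, hη2, hη5⟩, hη6, hη7⟩ := hηle
  obtain ⟨⟨hε1, -⟩, hε6, hε7⟩ := hεle
  have hη := h.eps_pos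
  have hpη := Real.rpow_pos_of_pos hη m
  have hpε := Real.rpow_pos_of_pos hε m
  have hD1 : D * η ^ m ≤ 1 := by
    have := H₅ η hη hη5
    rw [le_div_iff₀ hDpos] at this
    linarith
  have hdn := (H₂ V R σ η s h hη2).2
  have hv0 : 0 ≤ norm2 V := ENNReal.toReal_nonneg
  have hv1 := h.V_norm
  have hsq : |norm2 (VHat m S η) ^ 2 - norm2 (VHat m S ε) ^ 2| ≤ 3 * D * η ^ m := by
    rw [← hnorm, sq_sub_sq, abs_mul, mul_comm]
    have h1 : |norm2 (VHat m S η) + norm2 V| ≤ 3 := by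
      have := (abs_le.1 hdn).2
      have : 0 ≤ norm2 (VHat m S η) := ENNReal.toReal_nonneg
      rw [abs_of_nonneg (by positivity)]
      linarith
    calc _ ≤ D * η ^ m * 3 := by gcongr
      _ = _ := by ring
  have hq1 := H₁ η hη hη1
  have hq2 := H₁ ε hε hε1
  have hslope : a * |ε - η| ≤
      |(1 - 2 * a * η + b * η ^ 2) - (1 - 2 * a * ε + b * ε ^ 2)| := by
    have e : (1 - 2 * a * η + b * η ^ 2) - (1 - 2 * a * ε + b * ε ^ 2) =
      (2 * a - b * (ε + η)) * (ε - η) := by ring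
    rw [e, abs_mul]
    gcongr
    refine le_trans ?_ (le_abs_self _)
    rw [le_div_iff₀ (by positivity)] at hη7 hε7
    have h1 : b * (ε + η) ≤ |b| * (ε + η) := by gcongr; exact le_abs_self b
    nlinarith
  have hmain : |ε - η| ≤ E * (η ^ m + ε ^ m) := by
    rw [hE, div_mul_eq_mul_div, le_div_iff₀ ha]
    have h1 : |(1 - 2 * a * η + b * η ^ 2) - (1 - 2 * a * ε + b * ε ^ 2)| ≤
        3 * D * η ^ m + C₁ * η ^ m + C₁ * ε ^ m := by
      rw [abs_le] at hsq hq1 hq2 ⊢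
      constructor <;> linarith [hsq.1, hsq.2, hq1.1, hq1.2, hq2.1, hq2.2]
    have h2 : 0 ≤ C₁ * η ^ m := by positivity
    have h3 : 0 ≤ D * ε ^ m := by positivity
    have h4 : 0 ≤ C₁ * ε ^ m := by positivity
    linarith
  have hsmall : ∀ r, 0 < r → r ≤ ε₆ → E * r ^ m ≤ r / 2 := by
    intro r hr hr6
    have h1 := H₆ r hr hr6
    rw [le_div_iff₀ (by positivity)] at h1
    have e : r ^ m = r ^ (m - 1) * r := by rw [← Real.rpow_add_one hr.ne', sub_add_cancel]
    rw [e]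
    have := mul_le_mul_of_nonneg_right h1 hr.le
    linarith
  have hs1 := hsmall η hη hη6
  have hs2 := hsmall ε hε hε6
  have hab := abs_le.1 hmain
  have h3ε : η ≤ 3 * ε := by linarith [hab.1]
  have h3η : ε ≤ 3 * η := by linarith [hab.2]
  refine ⟨hmain.trans ?_, h3ε, h3η⟩
  have h5 : η ^ m ≤ 3 ^ m * ε ^ m := by
    rw [← Real.mul_rpow (by norm_num) hε.le]
    exact Real.rpow_le_rpow hη.le h3ε (by linarith)
  calc E * (η ^ m + ε ^ m) ≤ E * (3 ^ m * ε ^ m + ε ^ m) := by gcongr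
    _ = _ := by ring

/-- The scaling parameter `s` of a high wave of amplitude defect `η` is close to that of the
explicit approximation with the same velocity norm and parameter `ε`. -/
theorem exists_parameter_comparison (hm : 1 < m) (hS : IsLimitProfile m S) :
    ∃ C ε₀, 0 < C ∧ 0 < ε₀ ∧ ∀ V R σ η s ε, IsHighWave m V R σ η s →
      norm2 V = norm2 (VHat m S ε) → η ≤ ε₀ → 0 < ε → ε ≤ ε₀ →
      |ε - η| * (1 / muHat m S ε) + η * |1 / muHat m S ε - s| ≤ C * ε ^ (m - 1) ∧
      η ^ m ≤ 3 ^ m * ε ^ (m - 1) ∧ s ≤ 108 * (1 / muHat m S ε) := by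
  have hμ := muBar_pos hm
  obtain ⟨C₁, ε₁, hC₁, hε₁, H₁⟩ := exists_amplitude_comparison hm hS
  obtain ⟨C₂, ε₂, hC₂, hε₂, H₂⟩ := exists_wave_approximation hm hS
  obtain ⟨ε₄, hε₄, H₄⟩ := exists_hat_scale_bounds hm S
  obtain ⟨D, ε₆, hD, hε₆, H₆⟩ := exists_norm2_comparison hm hS
  refine ⟨2 * C₁ / muBar m + C₁ / muBar m + C₂ / muBar m * 3 ^ m,
    min (min (min ε₁ ε₂) (min ε₄ ε₆)) 1, by positivity, by positivity, ?_⟩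
  intro V R σ η s ε h hnorm hηle hε hεle
  simp only [le_min_iff] at hηle hεle
  obtain ⟨⟨⟨hη1, hη2⟩, hη4, hη6⟩, -⟩ := hηle
  obtain ⟨⟨⟨hε1, -⟩, hε4, -⟩, hεone⟩ := hεle
  have hη := h.eps_pos
  have hp1 := Real.rpow_pos_of_pos hε (m - 1)
  obtain ⟨hdiff, h3ε, h3η⟩ := H₁ V R σ η s ε h hnorm hη1 hε hε1
  have hsc := (H₂ V R σ η s h hη2).2.2
  obtain ⟨htη, hkη, hhatη, ht1η⟩ := H₄ η hη hη4
  obtain ⟨htε, hkε, hhatε, ht1ε⟩ := H₄ ε hε hε4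
  have hst12 := (H₆ V R σ η s h hη6).1
  generalize 1 / muHat m S η = t at *
  generalize 1 / muHat m S ε = u at *
  have hst := scale_diff_le hm hη hsc htη
  generalize kappaBar S - 1 = k at *
  have hu0 : 0 < u := by linarith
  have hkη' := abs_le.1 hkη
  have hkε' := abs_le.1 hkε
  have hstep : ε ^ m = ε ^ (m - 1) * ε := by rw [← Real.rpow_add_one hε.ne', sub_add_cancel]
  have hηε : η ^ m ≤ 3 ^ m * ε ^ (m - 1) := by
    calc η ^ m ≤ (3 * ε) ^ m := Real.rpow_le_rpow hη.le h3ε (by linarith)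
      _ = 3 ^ m * (ε ^ (m - 1) * ε) := by rw [Real.mul_rpow (by norm_num) hε.le, hstep]
      _ ≤ 3 ^ m * ε ^ (m - 1) := by
        gcongr
        exact mul_le_of_le_one_right hp1.le hεone
  have hut : η * |u - t| ≤ C₁ / muBar m * ε ^ (m - 1) := by
    have e : ε * (η * muBar m) * (u - t) = -(ε - η) := by
      have h1 : ε * (η * muBar m) * (u - t) = η * (ε * u * muBar m) - ε * (η * t * muBar m) := by
        ring
      rw [h1, htε, htη]
      ring
    have e2 : ε * (η * muBar m) * |u - t| = |ε - η| := by
      rw [← abs_neg (ε - η), ← e, abs_mul, abs_of_pos (by positivity : 0 < ε * (η * muBar m))]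
    rw [div_mul_eq_mul_div, le_div_iff₀ hμ]
    have h2 : ε * (η * |u - t| * muBar m) ≤ ε * (C₁ * ε ^ (m - 1)) := by
      calc ε * (η * |u - t| * muBar m) = |ε - η| := by rw [← e2]; ring
        _ ≤ C₁ * ε ^ m := hdiff
        _ = _ := by rw [hstep]; ring
    exact le_of_mul_le_mul_left h2 hε
  have hus : η * |u - s| ≤ (C₁ / muBar m + C₂ / muBar m * 3 ^ m) * ε ^ (m - 1) := by
    have h1 : |u - s| ≤ |u - t| + |t - s| := abs_sub_le _ _ _
    have h2 : C₂ / muBar m * η ^ m ≤ C₂ / muBar m * (3 ^ m * ε ^ (m - 1)) := by gcongr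
    calc η * |u - s| ≤ η * |u - t| + η * |t - s| := by rw [← mul_add]; gcongr
      _ ≤ C₁ / muBar m * ε ^ (m - 1) + C₂ / muBar m * (3 ^ m * ε ^ (m - 1)) :=
        add_le_add hut (hst.trans h2)
      _ = _ := by ring
  have hd : |ε - η| * u ≤ 2 * C₁ / muBar m * ε ^ (m - 1) := by
    have hεu_up : ε * u ≤ 2 / muBar m := by
      rw [le_div_iff₀ hμ, htε]; linarith
    calc |ε - η| * u ≤ C₁ * ε ^ m * u := by gcongr
      _ = C₁ * ε ^ (m - 1) * (ε * u) := by rw [hstep]; ring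
      _ ≤ C₁ * ε ^ (m - 1) * (2 / muBar m) := by gcongr
      _ = _ := by ring
  refine ⟨?_, hηε, ?_⟩
  · rw [add_assoc, add_mul]
    exact add_le_add hd hus
  · have h1 : η * t * muBar m ≤ 3 / 2 := by rw [htη]; linarith
    have h2 : 1 / 2 ≤ ε * u * muBar m := by rw [htε]; linarith
    have h3 : ε * u * muBar m ≤ 3 * η * u * muBar m := by gcongr
    have h5 : η * muBar m * t ≤ η * muBar m * (9 * u) := by linarith
    have h6 : t ≤ 9 * u := le_of_mul_le_mul_left h5 (by positivity)
    linarith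

end Hat

section Error

variable {m : ℝ} {S : ℝ → ℝ}

/-- The error of the explicit profiles for a high wave with the same velocity norm. -/
theorem exists_profile_error (hm : 1 < m) (hS : IsLimitProfile m S) :
    ∃ C ε₀, 0 < C ∧ 0 < ε₀ ∧ ∀ V R σ η s ε, IsHighWave m V R σ η s →
      norm2 V = norm2 (VHat m S ε) → η ≤ ε₀ → 0 < ε → ε ≤ ε₀ →
      (∀ x, |RHat m S ε x - R x| ≤ C * ε ^ (m - 1) * Real.exp (-|x|)) ∧
      (∀ x, |VHat m S ε x - V x| ≤ C * ε ^ (m - 1) * Real.exp (-|x|)) := by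
  obtain ⟨A, ε₁, hA, hε₁, H₁⟩ := exists_parameter_comparison hm hS
  obtain ⟨C₂, ε₂, hC₂, hε₂, H₂⟩ := exists_wave_approximation hm hS
  obtain ⟨C₃, hC₃, H₃⟩ := exists_velocityProfile_lipschitz hm hS
  obtain ⟨ε₄, hε₄, H₄⟩ := exists_hat_scale_bounds hm S
  obtain ⟨C₅, hC₅, H₅⟩ := exists_distanceProfile_lipschitz hm hS
  refine ⟨(C₃ + C₅) * A + C₂ * 3 ^ m, min (min ε₁ ε₂) ε₄, by positivity, by positivity, ?_⟩
  intro V R σ η s ε h hnorm hηle hε hεle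
  simp only [le_min_iff] at hηle hεle
  obtain ⟨⟨hη1, hη2⟩, -⟩ := hηle
  obtain ⟨⟨hε1, -⟩, hε4⟩ := hεle
  have hη := h.eps_pos
  have hs := h.s_pos
  have hp1 := Real.rpow_pos_of_pos hε (m - 1)
  obtain ⟨hpar, hηε, hs108⟩ := H₁ V R σ η s ε h hnorm hη1 hε hε1
  obtain ⟨hRapp, hVapp, -⟩ := H₂ V R σ η s h hη2
  obtain ⟨-, -, -, hu1⟩ := H₄ ε hε hε4
  rw [RHat_eq, VHat_eq]
  generalize 1 / muHat m S ε = u at *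
  have hcomb : ∀ (f g w : ℝ) (c x : ℝ), 0 < c → c ≤ C₃ + C₅ →
      |f - g| ≤ c * (|ε - η| * u + η * |u - s|) * Real.exp (-|x|) →
      |g - w| ≤ C₂ * η ^ m * Real.exp (-|x|) →
      |f - w| ≤ ((C₃ + C₅) * A + C₂ * 3 ^ m) * ε ^ (m - 1) * Real.exp (-|x|) := by
    intro f g w c x hc hc' hfg hgw
    calc |f - w| ≤ |f - g| + |g - w| := abs_sub_le _ _ _
      _ ≤ (C₃ + C₅) * (A * ε ^ (m - 1)) * Real.exp (-|x|) +
          C₂ * (3 ^ m * ε ^ (m - 1)) * Real.exp (-|x|) := by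
        refine add_le_add (hfg.trans ?_) (hgw.trans ?_)
        · gcongr
        · gcongr
      _ = _ := by ring
  exact ⟨fun x => hcomb _ _ _ _ _ hC₅ (by linarith) (H₅ ε u η s hε hu1 hη hs x) (hRapp x),
    fun x => hcomb _ _ _ _ _ hC₃ (by linarith)
      (H₃ ε u η s hε (by linarith) hη hs hs108 x) (hVapp x)⟩

theorem abs_rpow_sub_one_le (hm : 1 < m) {t : ℝ} (ht0 : 0 < t) (ht : t ≤ 3) :
    |t ^ m - 1| ≤ m * 3 ^ (m - 1) * |t - 1| := by
  have hd : ∀ x : ℝ, 0 < x → HasDerivAt (fun x : ℝ => x ^ m) (m * x ^ (m - 1)) x := fun x hx =>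
    Real.hasDerivAt_rpow_const (Or.inl hx.ne')
  have hb : ∀ x : ℝ, 0 < x → x ≤ 3 → |m * x ^ (m - 1)| ≤ m * 3 ^ (m - 1) := fun x hx hx3 => by
    have hp := Real.rpow_pos_of_pos hx (m - 1)
    have hm0 : 0 < m := by linarith
    rw [abs_of_pos (by positivity)]
    gcongr
  rcases le_total t 1 with h | h
  · rw [abs_sub_comm, abs_sub_comm t, abs_of_nonneg (sub_nonneg.2 h)]
    have := abs_sub_le_mul_of_hasDerivAt h (fun x hx => hd x (ht0.trans_le hx.1))
      (fun x hx => hb x (ht0.trans_le hx.1) (by linarith [hx.2]))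
    simpa using this
  · rw [abs_of_nonneg (sub_nonneg.2 h)]
    have := abs_sub_le_mul_of_hasDerivAt h (fun x hx => hd x (by linarith [hx.1]))
      (fun x hx => hb x (by linarith [hx.1]) (hx.2.trans ht))
    simpa using this

theorem abs_inv_sq_sub_le {p r l : ℝ} (hl : 0 < l) (hp : l ≤ p) (hr : l ≤ r) :
    |1 / p ^ 2 - 1 / r ^ 2| ≤ 2 / l ^ 3 * |p - r| := by
  have hp0 : 0 < p := hl.trans_le hp
  have hr0 : 0 < r := hl.trans_le hr
  have e : 1 / p ^ 2 - 1 / r ^ 2 =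
      (r - p) * (1 / (p * r ^ 2) + 1 / (p ^ 2 * r)) := by
    field_simp
    ring
  have h1 : 1 / (p * r ^ 2) ≤ 1 / (l * l ^ 2) := by gcongr
  have h2 : 1 / (p ^ 2 * r) ≤ 1 / (l ^ 2 * l) := by gcongr
  rw [e, abs_mul, abs_sub_comm r, mul_comm,
    abs_of_pos (by positivity : 0 < 1 / (p * r ^ 2) + 1 / (p ^ 2 * r))]
  gcongr
  calc _ ≤ 1 / (l * l ^ 2) + 1 / (l ^ 2 * l) := add_le_add h1 h2
    _ = _ := by field_simp; norm_num

/-- The error of the explicit wave speed for a high wave with the same velocity norm. -/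
theorem exists_speed_error (hm : 1 < m) (hS : IsLimitProfile m S) :
    ∃ C ε₀, 0 < C ∧ 0 < ε₀ ∧ ∀ V R σ η s ε, IsHighWave m V R σ η s →
      norm2 V = norm2 (VHat m S ε) → η ≤ ε₀ → 0 < ε → ε ≤ ε₀ →
      ε ^ m * |sigmaHat m S ε - σ| ≤ C * ε ^ (m - 1) := by
  have hμ := muBar_pos hm
  have hm0 : 0 < m := by linarith
  obtain ⟨C₁, ε₁, hC₁, hε₁, H₁⟩ := exists_amplitude_comparison hm hS
  obtain ⟨A, ε₂, hA, hε₂, H₂⟩ := exists_parameter_comparison hm hS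
  obtain ⟨a, b, ε₃, ha, hb, hε₃, H₃⟩ := exists_scale_bounds hm hS
  obtain ⟨ε₄, hε₄, H₄⟩ := exists_hat_scale_bounds hm S
  obtain ⟨l, hl⟩ : ∃ l, l = min a (1 / (2 * muBar m)) := ⟨_, rfl⟩
  have hl0 : 0 < l := hl ▸ by positivity
  refine ⟨2 / l ^ 3 * A + m * 3 ^ (m - 1) * (3 * C₁) * (1 / l ^ 2),
    min (min ε₁ ε₂) (min ε₃ ε₄), by positivity, by positivity, ?_⟩
  intro V R σ η s ε h hnorm hηle hε hεle
  simp only [le_min_iff] at hηle hεle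
  obtain ⟨⟨hη1, hη2⟩, hη3, -⟩ := hηle
  obtain ⟨⟨hε1, hε2⟩, -, hε4⟩ := hεle
  have hη := h.eps_pos
  have hs := h.s_pos
  have hp1 := Real.rpow_pos_of_pos hε (m - 1)
  obtain ⟨hdiff, -, h3η⟩ := H₁ V R σ η s ε h hnorm hη1 hε hε1
  have hpar := (H₂ V R σ η s ε h hnorm hη2 hε hε2).1
  have hlow := (H₃ V R σ η s h hη3).2.1
  obtain ⟨htε, hkε, hhatε, hu1⟩ := H₄ ε hε hε4
  have hstep : ε ^ m = ε ^ (m - 1) * ε := by rw [← Real.rpow_add_one hε.ne', sub_add_cancel]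
  -- both speeds are expressed by the products `ε u` and `η s`
  have hsig1 : ε ^ m * sigmaHat m S ε = 1 / (ε * (1 / muHat m S ε)) ^ 2 := by
    rw [sigmaHat, show -m - 2 = -(m + 2) by ring, Real.rpow_neg hε.le,
      Real.rpow_add hε, Real.rpow_two]
    have := (Real.rpow_pos_of_pos hε m).ne'
    field_simp
  have hsig2 : ε ^ m * σ = (ε / η) ^ m * (1 / (η * s) ^ 2) := by
    have h1 := h.scaling
    rw [Real.rpow_add hη, Real.rpow_two] at h1
    have := (Real.rpow_pos_of_pos hη m).ne'
    rw [Real.div_rpow hε.le hη.le]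
    field_simp
    linarith
  generalize 1 / muHat m S ε = u at *
  have hu0 : 0 < u := by linarith
  have hlp : l ≤ ε * u := by
    rw [hl]
    refine (min_le_right _ _).trans ?_
    rw [div_le_iff₀ (by positivity)]
    linarith [(abs_le.1 hkε).1]
  have hlr : l ≤ η * s := by
    rw [hl]
    exact (min_le_left _ _).trans hlow
  have hpr : |ε * u - η * s| ≤ A * ε ^ (m - 1) := by
    have e : ε * u - η * s = (ε - η) * u + η * (u - s) := by ring
    rw [e]
    refine (abs_add_le _ _).trans ?_
    rwa [abs_mul, abs_mul, abs_of_pos hu0, abs_of_pos hη]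
  have hsq := abs_inv_sq_sub_le hl0 hlp hlr
  have hrinv : 1 / (η * s) ^ 2 ≤ 1 / l ^ 2 := by gcongr
  have hratio : |1 - (ε / η) ^ m| ≤ m * 3 ^ (m - 1) * (3 * C₁) * ε ^ (m - 1) := by
    have h1 : ε / η ≤ 3 := by rw [div_le_iff₀ hη]; exact h3η
    rw [abs_sub_comm]
    refine (abs_rpow_sub_one_le hm (div_pos hε hη) h1).trans ?_
    have h2 : |ε / η - 1| ≤ 3 * C₁ * ε ^ (m - 1) := by
      rw [div_sub_one hη.ne', abs_div, abs_of_pos hη, div_le_iff₀ hη]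
      calc |ε - η| ≤ C₁ * ε ^ (m - 1) * ε := by rw [mul_assoc, ← hstep]; exact hdiff
        _ ≤ C₁ * ε ^ (m - 1) * (3 * η) := by gcongr
        _ = _ := by ring
    calc _ ≤ m * 3 ^ (m - 1) * (3 * C₁ * ε ^ (m - 1)) := by gcongr
      _ = _ := by ring
  have hab : ε ^ m * |sigmaHat m S ε - σ| = |ε ^ m * sigmaHat m S ε - ε ^ m * σ| := by
    rw [← mul_sub, abs_mul, abs_of_pos (Real.rpow_pos_of_pos hε m)]
  rw [hab, hsig1, hsig2]
  have e : 1 / (ε * u) ^ 2 - (ε / η) ^ m * (1 / (η * s) ^ 2) =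
      (1 / (ε * u) ^ 2 - 1 / (η * s) ^ 2) + (1 - (ε / η) ^ m) * (1 / (η * s) ^ 2) := by ring
  rw [e]
  have hpos : 0 < 1 / (η * s) ^ 2 := by positivity
  calc _ ≤ _ := abs_add_le _ _
    _ ≤ 2 / l ^ 3 * (A * ε ^ (m - 1)) +
        m * 3 ^ (m - 1) * (3 * C₁) * ε ^ (m - 1) * (1 / l ^ 2) := by
      rw [abs_mul, abs_of_pos hpos]
      gcongr
      exact hsq.trans (by gcongr)
    _ = _ := by ring

end Error

/-! ### High energy forces a high amplitude -/

section Energy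

variable {m σ : ℝ} {V R : ℝ → ℝ}

theorem potential_zero (m : ℝ) : potential m 0 = 0 := by
  simp [potential]

theorem potential_mem_Icc (hm : 1 < m) {p r : ℝ} (hp : 0 < p) (hr : 0 ≤ r) (hrp : r ≤ 1 - p) :
    potential m r ∈ Icc 0 (1 / p ^ (m + 2) * r ^ 2) := by
  have hd : ∀ x ∈ Icc 0 r, HasDerivAt (potential m) (stress m x) x := fun x hx =>
    hasDerivAt_potential hm (by linarith [hx.2])
  have hD : 0 < 1 / p ^ (m + 2) := one_div_pos.2 (Real.rpow_pos_of_pos hp _)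
  have h1 := mul_le_sub_of_hasDerivAt (C := 0) hr hd
    (fun x hx => stress_nonneg hm ⟨hx.1, by linarith [hx.2]⟩)
  have h2 := sub_le_mul_of_hasDerivAt (C := 1 / p ^ (m + 2) * r) hr hd (fun x hx =>
    (stress_le_mul hm hp hx.1 (hx.2.trans hrp)).trans (by gcongr; exact hx.2))
  rw [potential_zero] at h1 h2
  constructor
  · linarith
  · linarith

theorem IsSolitaryWave.integral_R_sq_le (h : IsSolitaryWave m V R σ) : ∫ x, R x ^ 2 ≤ 3 := by
  have hR2 : Integrable fun x => R x ^ 2 := h.R_memLp.integrable_sq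
  have hV2 : Integrable fun x => V x ^ 2 := h.V_memLp.integrable_sq
  have hVs : Integrable fun x => V (x - 1 / 2) ^ 2 := hV2.comp_sub_right (1 / 2)
  have e : ∫ x, R x ^ 2 = 2 * ∫ x in Ioi (0:ℝ), R x ^ 2 := by
    rw [← integral_comp_abs (f := fun x => R x ^ 2)]
    simp only [h.R_abs]
  have hsplit : ∫ x in Ioi (0:ℝ), R x ^ 2 =
      (∫ x in Ioc (0:ℝ) (1 / 2), R x ^ 2) + ∫ x in Ioi (1 / 2 : ℝ), R x ^ 2 := by
    rw [← setIntegral_union (Ioc_disjoint_Ioi le_rfl) measurableSet_Ioi hR2.integrableOn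
      hR2.integrableOn, Ioc_union_Ioi_eq_Ioi (by norm_num)]
  have h1 : ∫ x in Ioc (0:ℝ) (1 / 2), R x ^ 2 ≤ 1 / 2 := by
    calc _ ≤ ∫ _ in Ioc (0:ℝ) (1 / 2), (1:ℝ) := by
          refine setIntegral_mono_on hR2.integrableOn (by simp) measurableSet_Ioc fun x _ => ?_
          have := h.R_range x
          nlinarith [this.1, this.2]
      _ = _ := by norm_num
  have h2 : ∫ x in Ioi (1 / 2 : ℝ), R x ^ 2 ≤ 1 := by
    calc _ ≤ ∫ x in Ioi (1 / 2 : ℝ), V (x - 1 / 2) ^ 2 := by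
          refine setIntegral_mono_on hR2.integrableOn hVs.integrableOn measurableSet_Ioi
            fun x hx => ?_
          have h3 := h.R_le_V (le_of_lt hx)
          have h4 := (h.R_range x).1
          gcongr
      _ ≤ ∫ x, V (x - 1 / 2) ^ 2 := setIntegral_le_integral hVs (.of_forall fun x => sq_nonneg _)
      _ = ∫ x, V x ^ 2 := integral_sub_right_eq_self (fun x => V x ^ 2) (1 / 2)
      _ ≤ 1 := h.integral_sq_le
  linarith

theorem IsSolitaryWave.energy_le (hm : 1 < m) (h : IsSolitaryWave m V R σ) {p : ℝ} (hp : 0 < p)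
    (hR : R 0 ≤ 1 - p) : ∫ x, potential m (R x) ≤ 1 / p ^ (m + 2) * 3 := by
  have hD : 0 < 1 / p ^ (m + 2) := one_div_pos.2 (Real.rpow_pos_of_pos hp _)
  have hmem : ∀ x, potential m (R x) ∈ Icc 0 (1 / p ^ (m + 2) * R x ^ 2) := fun x =>
    potential_mem_Icc hm hp (h.R_range x).1
      ((h.R_anti_abs (by rw [abs_zero]; exact abs_nonneg x)).trans hR)
  calc _ ≤ ∫ x, 1 / p ^ (m + 2) * R x ^ 2 :=
        integral_mono_of_nonneg (.of_forall fun x => (hmem x).1)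
          (h.R_memLp.integrable_sq.const_mul _) (.of_forall fun x => (hmem x).2)
    _ = 1 / p ^ (m + 2) * ∫ x, R x ^ 2 := integral_const_mul _ _
    _ ≤ _ := by gcongr; exact h.integral_R_sq_le

theorem IsHighEnergyFamily.eventually_height {V R : ℝ → ℝ → ℝ} {σ : ℝ → ℝ} (hm : 1 < m)
    (h : IsHighEnergyFamily m V R σ) {p : ℝ} (hp : 0 < p) :
    ∀ᶠ δ in 𝓝[>] (0:ℝ), 1 - R δ 0 ≤ p := by
  filter_upwards [h.energy_explodes.eventually_gt_atTop (1 / p ^ (m + 2) * 3),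
    Ioo_mem_nhdsGT zero_lt_one] with δ hδ hmem
  by_contra hcon
  exact absurd ((h.isSolitaryWave hmem).energy_le hm hp (by linarith)) (not_le.2 hδ)

theorem IsSolitaryWave.exists_isHighWave (h : IsSolitaryWave m V R σ)
    (hR : 1 - R 0 ≤ 1 / 100) : ∃ s, IsHighWave m V R σ (1 - R 0) s := by
  have hη : 0 < 1 - R 0 := by linarith [(h.R_range 0).2]
  have hx : 0 < σ * (1 - R 0) ^ (m + 2) := mul_pos h.wave.speed_pos (Real.rpow_pos_of_pos hη _)
  refine ⟨1 / √(σ * (1 - R 0) ^ (m + 2)), h, by ring, hη, hR, by positivity, ?_⟩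
  rw [div_pow, Real.sq_sqrt hx.le]
  have := h.wave.speed_pos.ne'
  field_simp

end Energy

/-- The error bounds along a high-energy family. The weight `exp (-|x|)` lies in every `L^q`. -/
theorem IsHighEnergyFamily.eventually_error {m : ℝ} {S : ℝ → ℝ} {V R : ℝ → ℝ → ℝ} {σ : ℝ → ℝ}
    (hm : 1 < m) (hW : IsHighEnergyFamily m V R σ) (hS : IsLimitProfile m S) :
    ∃ C, 0 < C ∧ ∀ᶠ ε in 𝓝[>] (0:ℝ),
      (∀ x, |RHat m S ε x - R (deltaHat m S ε) x| ≤ C * ε ^ (m - 1) * Real.exp (-|x|)) ∧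
      (∀ x, |VHat m S ε x - V (deltaHat m S ε) x| ≤ C * ε ^ (m - 1) * Real.exp (-|x|)) ∧
      ε ^ m * |sigmaHat m S ε - σ (deltaHat m S ε)| ≤ C * ε ^ (m - 1) := by
  obtain ⟨C₁, ε₁, hC₁, hε₁, H₁⟩ := exists_profile_error hm hS
  obtain ⟨C₂, ε₂, hC₂, hε₂, H₂⟩ := exists_speed_error hm hS
  refine ⟨C₁ + C₂, by positivity, ?_⟩
  have hht := (tendsto_deltaHat hm hS).eventually
    (hW.eventually_height hm (show 0 < min (1 / 100) (min ε₁ ε₂) by positivity))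
  filter_upwards [hht, eventually_deltaHat_mem hm hS,
    eventually_nhdsGT_zero_le (show 0 < min ε₁ ε₂ by positivity)] with ε hR hδ hε
  obtain ⟨hε0, hεle⟩ := hε
  simp only [le_min_iff] at hR hεle
  obtain ⟨s, h⟩ := (hW.isSolitaryWave hδ).exists_isHighWave hR.1
  have hnorm : norm2 (V (deltaHat m S ε)) = norm2 (VHat m S ε) := by
    rw [hW.V_norm _ hδ, deltaHat, sub_sub_cancel]
  obtain ⟨hRe, hVe⟩ := H₁ _ _ _ _ s ε h hnorm hR.2.1 hε0 hεle.1
  have hσe := H₂ _ _ _ _ s ε h hnorm hR.2.2 hε0 hεle.2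
  have hp := Real.rpow_pos_of_pos hε0 (m - 1)
  refine ⟨fun x => (hRe x).trans ?_, fun x => (hVe x).trans ?_, hσe.trans ?_⟩
  all_goals
    gcongr
    linarith

end HighEnergyFPU

theorem mainTheorem9 (m : ℝ) (hm : 1 < m) (V R : ℝ → ℝ → ℝ) (σ : ℝ → ℝ)
    (hW : HighEnergyFPU.IsHighEnergyFamily m V R σ) :
    (∃! S : ℝ → ℝ, HighEnergyFPU.IsLimitProfile m S) ∧
    ∀ S : ℝ → ℝ, HighEnergyFPU.IsLimitProfile m S →
      (∃ a : ℝ, 0 < a ∧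
        Tendsto (fun ε => HighEnergyFPU.deltaHat m S ε / ε) (𝓝[>] 0) (𝓝 a)) ∧
      (∀ᶠ ε in 𝓝[>] (0 : ℝ), HighEnergyFPU.deltaHat m S ε ∈ Ioo (0 : ℝ) 1) ∧
      ∀ q : ℝ≥0∞, 1 ≤ q → ∃ C : ℝ, 0 < C ∧ ∀ᶠ ε in 𝓝[>] (0 : ℝ),
        eLpNorm (fun x => HighEnergyFPU.RHat m S ε x
            - R (HighEnergyFPU.deltaHat m S ε) x) q volume
          + eLpNorm (fun x => HighEnergyFPU.VHat m S ε x
            - V (HighEnergyFPU.deltaHat m S ε) x) q volume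
          + ENNReal.ofReal (ε ^ m * |HighEnergyFPU.sigmaHat m S ε
            - σ (HighEnergyFPU.deltaHat m S ε)|)
        ≤ ENNReal.ofReal (C * ε ^ (m - 1)) := by
  refine ⟨?_, fun S hS => ⟨HighEnergyFPU.exists_tendsto_deltaHat_div hm hS,
    HighEnergyFPU.eventually_deltaHat_mem hm hS, fun q hq => ?_⟩⟩
  · obtain ⟨S, hS⟩ := HighEnergyFPU.exists_isLimitProfile hm
    exact ⟨S, hS, fun T hT => hT.unique hm hS⟩
  obtain ⟨C, hC, H⟩ := hW.eventually_error hm hS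
  -- the norm of the exponential weight enters the constant
  have hG := HighEnergyFPU.memLp_exp_neg_abs hq
  obtain ⟨M, hM⟩ : ∃ M, M = (eLpNorm (fun x : ℝ => Real.exp (-|x|)) q volume).toReal := ⟨_, rfl⟩
  have hM0 : 0 ≤ M := hM ▸ ENNReal.toReal_nonneg
  have hMe : eLpNorm (fun x : ℝ => Real.exp (-|x|)) q volume = ENNReal.ofReal M := by
    rw [hM, ENNReal.ofReal_toReal hG.eLpNorm_ne_top]
  refine ⟨C * (2 * M + 1), by positivity, ?_⟩
  filter_upwards [H, self_mem_nhdsWithin] with ε hε hε0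
  obtain ⟨hR, hV, hσ⟩ := hε
  have hp : 0 < ε ^ (m - 1) := Real.rpow_pos_of_pos hε0 _
  have h1 := HighEnergyFPU.eLpNorm_le_of_abs_le_exp q hR
  have h2 := HighEnergyFPU.eLpNorm_le_of_abs_le_exp q hV
  rw [hMe, ← ENNReal.ofReal_mul (by positivity)] at h1 h2
  refine (add_le_add (add_le_add h1 h2) (ENNReal.ofReal_le_ofReal hσ)).trans ?_
  rw [← ENNReal.ofReal_add (by positivity) (by positivity),
    ← ENNReal.ofReal_add (by positivity) (by positivity)]
  exact ENNReal.ofReal_le_ofReal (le_of_eq (by ring))
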